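/- **Setting.** Let $\xi,d\in\mathbb R$ with $-\xi<d$, let $h>0$, let $M\ge 0$ be an integer and $2b=(M+1)h$. Consider the grid points $(x_j,y_s)=(-b+jh,-b+sh)$, $0\le j,s\le M+1$; those with $1\le j,s\le M$ are called interior. Semidiscrete functions are families $f(x_j,y_s,z)$ of complex valued functions of $z\in(-\xi,d)$; complex numbers are regarded as pairs of reals, so that all Hilbert spaces below are real. Let $0<\underline k<\overline k$ and put $$\|f\|_{H^{n,h}}^2=\sum_{j,s=0}^{M+1}\sum_{r=0}^{n}h^2\int_{-\xi}^d|\partial_z^rf(x_j,y_s,z)|^2dz\ \ (\text{weak derivatives}),\qquad \|f\|_{H_n^h}^2=\int_{\underline k}^{\overline k}\|f(\cdot,k)\|_{H^{n,h}}^2dk .$$ A function $u\in H^{2,h}$ is said to have boundary data $(\psi_0,\psi_1)$ if $u=\psi_0$, $u_z=\psi_1$ at $z=-\xi$ for all interior $(x_j,y_s)$, and $u=0$ both at $z=d$ and at all non-interior grid points. Let $H_0^{2,h}\subset H^{2,h}$ be the subspace of functions with boundary data $(0,0)$, and $H_{0,2}^h\subset H_2^h$ the subspace of the functions with $f(\cdot,k)\in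 H_0^{2,h}$ for almost all $k$. For $R>0$ let $B(R)=\{r\in H^h_{0,2}:\|r\|_{H_2^h}<R\}$, with closure $\overline{B(R)}$, and let $P_{\overline B}$ be the orthogonal (nearest point) projection of $H_{0,2}^h$ onto $\overline{B(R)}$. At interior grid points let $\Delta^hu=u_{zz}+u^h_{xx}+u^h_{yy}$ and $\nabla^hu=(\partial_x^hu,\partial_y^hu,\partial_zu)$, where $u_{xx}^h$ is the three-point second difference quotient $h^{-2}[u(x-h)-2u(x)+u(x+h)]$, $\partial_x^hu=(2h)^{-1}[u(x+h)-u(x-h)]$, and similarly in $y$. Let $\varphi_\lambda(z)=e^{-2\lambda z}$ and, at interior grid points, $$L^h(q)=\Delta^hq+2k\Big(\nabla^hV-\int_k^{\overline k}\nabla^hq\,d\kappa\Big)\cdot\Big(k\nabla^hq+\nabla^hV-\int_k^{\overline k}\nabla^hq\,d\kappa\Big)+2i\Big(kq_z+V_z-\int_k^{\overline k}q_z\,d\kappa\Big),$$ where $a\cdot b=\sum_ca_cb_c$ without conjugation. All sums below are over the interior grid points. Put $$I_\mu(W)=e^{2\mu d}\sum_{j,s}h^2\int_{-\xi}^d|\Delta^hW+\Delta^hQ|^2\varphi_\mu\,dz\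 \ (W\in H_0^{2,h}),\qquad J_\lambda(p)=e^{2\lambda d}\sum_{j,s}h^2\int_{\underline k}^{\overline k}\int_{-\xi}^d|L^h(p+F)|^2\varphi_\lambda\,dz\,dk\ \ (p\in H_{0,2}^h).$$ **Theorem 7.5.** There are $\lambda_0>1$ and $C>0$, depending only on $\xi,d,h$, such that the Carleman estimate $$\sum_{j,s}h^2\int_{-\xi}^d|\Delta^hu|^2\varphi_\lambda dz\ \ge\ C\sum_{j,s}h^2\int_{-\xi}^d\big(|u_{zz}|^2+\lambda|u_z|^2+\lambda^3|u|^2\big)\varphi_\lambda dz$$ holds for all $\lambda\ge\lambda_0$ and $u\in H_0^{2,h}$; and there are $\lambda_1\ge\lambda_0$ and $C_1>0$, depending only on the semidiscrete domain (that is, on $\xi,d,h,M$) and on $R,\|F_*\|_{H_3^h},\|V_*\|_{H^{2,h}},\underline k,\overline k$; for every $\lambda\ge\lambda_1$ a number $\gamma_0\in(0,1)$, depending only on these quantities and $\lambda$; and for every $\gamma\in(0,\gamma_0)$ a number $\theta\in(0,1)$, depending only on these quantities, $\lambda$ and $\gamma$, such that the following holds. Let $0<\delta<e^{-2(d+\xi)\lambda_1}$.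 Let $Q,Q_*,V_*\in H^{2,h}$, where $Q$ has some boundary data $(\psi_0,\psi_1)$, $Q_*$ and $V_*$ have the same boundary data $(\psi_{0*},\psi_{1*})$, $\Delta^hV_*=0$ at the interior grid points, and $\|Q-Q_*\|_{H^{2,h}}<\delta$. Let $F,F_*\in H_3^h$ with $\|F-F_*\|_{H_3^h}<\delta$ be such that, for almost all $k$, $F(\cdot,k)$ has boundary data $(\phi_0(\cdot,k),\phi_1(\cdot,k))$ and $F_*(\cdot,k)$ has boundary data $(\phi_{0*}(\cdot,k),\phi_{1*}(\cdot,k))$. Then, with $\mu=\ln(\delta^{-1/(2(d+\xi))})$, the functional $I_\mu$ has a unique minimizer $W$ on $H_0^{2,h}$. Set $V=W+Q$ in $L^h$. Then: 1. $J_\lambda$ has a Fréchet derivative $J'_\lambda(p)\in H_{0,2}^h$ at every $p\in H_{0,2}^h$ (identified by means of the scalar product of $H_2^h$), and $J_\lambda(p+r)-J_\lambda(p)-J_\lambda'(p)(r)\ge C_1\|r\|_{H_2^h}^2$ whenever $p,p+r\in\overline{B(R)}$. 2. $J_\lambda$ has a unique minimizer $p_{\min}$ on $\overline{B(R)}$,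 and $p_{\min}$ is the only $p\in\overline{B(R)}$ such that $J'_\lambda(p)(y-p)\ge0$ for all $y\in\overline{B(R)}$. 3. For every $\gamma\in(0,\gamma_0)$ and $p_0\in B(R)$ the sequence $p_n=P_{\overline B}(p_{n-1}-\gamma J'_\lambda(p_{n-1}))$, $n\ge1$, converges to $p_{\min}$, and $\|p_{\min}-p_n\|_{H_2^h}\le\theta^n\|p_{\min}-p_0\|_{H_2^h}$ for all $n$. -/

import Mathlib

open MeasureTheory Set Filter Topology
open scoped ContDiff InnerProductSpace

noncomputable section

namespace SemiDisc

/-! ### The semidiscrete domain -/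

/-- The interval `(-ξ, d)` of the continuous variable `z` and the step `h` of the grid in `(x, y)`. -/
structure Slab where
  ξ : ℝ
  d : ℝ
  h : ℝ
  lt : -ξ < d
  h_pos : 0 < h

/-! The grid of `(x, y)` consists of the `(M + 2) ^ 2` points
`(x_j, y_s) = (-b + j * h, -b + s * h)`, `0 ≤ j, s ≤ M + 1`, where `2 * b = (M + 1) * h`.  The points
with `1 ≤ j, s ≤ M` are interior to the square `[-b, b] ^ 2`, the other ones are on its boundary. -/

/-- Indices of the grid points. -/
abbrev Grid (M : ℕ) : Type := Fin (M + 2) × Fin (M + 2)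

/-- The interior indices `1, …, M` along one axis. -/
def mid {M : ℕ} (i : Fin M) : Fin (M + 2) := i.castSucc.succ

/-- The left neighbour of an interior index. -/
def lo {M : ℕ} (i : Fin M) : Fin (M + 2) := i.castSucc.castSucc

/-- The right neighbour of an interior index. -/
def hi {M : ℕ} (i : Fin M) : Fin (M + 2) := i.succ.succ

/-- The grid point is on the boundary of the square. -/
def OnLateral {M : ℕ} (g : Grid M) : Prop :=
  g.1 = 0 ∨ g.1 = Fin.last (M + 1) ∨ g.2 = 0 ∨ g.2 = Fin.last (M + 1)

/-- Lebesgue measure on `(-ξ, d)`, multiplied by the area `h ^ 2` of a grid cell. -/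
abbrev zMeas (S : Slab) : Measure ℝ :=
  ENNReal.ofReal (S.h ^ 2) • (volume.restrict (Ioo (-S.ξ) S.d))

/-- Lebesgue measure on the interval of wavenumbers. -/
abbrev kMeas (kmin kmax : ℝ) : Measure ℝ := volume.restrict (Ioo kmin kmax)

/-! ### The function spaces

Complex numbers are regarded as pairs of real numbers, so all Hilbert spaces are real. -/

/-- `v` is the weak derivative of `u` on `(a, b)`. -/
def IsWeakDeriv (a b : ℝ) (u v : ℝ → ℂ) : Prop :=
  ∀ φ : ℝ → ℝ, ContDiff ℝ ∞ φ → HasCompactSupport φ → tsupport φ ⊆ Ioo a b →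
    ∫ z in Ioo a b, ((deriv φ z : ℝ) : ℂ) * u z = -∫ z in Ioo a b, ((φ z : ℝ) : ℂ) * v z

/-- Families `U (g, r)`, `g` a grid point and `0 ≤ r ≤ n`, of functions in `L²(-ξ, d)`, with the
norm `‖U‖² = ∑ g, ∑ r, h ^ 2 * ∫ |U (g, r)| ^ 2 dz`. -/
abbrev Amb (S : Slab) (M n : ℕ) : Type :=
  PiLp 2 (fun _ : Grid M × Fin (n + 1) => Lp ℂ 2 (zMeas S))

theorem ae_zMeas {S : Slab} {P : ℝ → Prop} (hP : ∀ᵐ z ∂(zMeas S), P z) :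
    ∀ᵐ z ∂(volume.restrict (Ioo (-S.ξ) S.d)), P z := by
  have h0 : ENNReal.ofReal (S.h ^ 2) ≠ 0 := by simpa using S.h_pos.ne'
  exact (Measure.ae_ennreal_smul_measure_iff h0).1 hP

theorem integrable_mul_Lp {S : Slab} (u : Lp ℂ 2 (zMeas S)) {φ : ℝ → ℝ}
    (hφ : Continuous φ) (hc : HasCompactSupport φ) :
    Integrable (fun z => ((φ z : ℝ) : ℂ) * u z) (volume.restrict (Ioo (-S.ξ) S.d)) := by
  have h0 : ENNReal.ofReal (S.h ^ 2) ≠ 0 := by simpa using S.h_pos.ne'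
  have hu : MemLp (u : ℝ → ℂ) 2 (volume.restrict (Ioo (-S.ξ) S.d)) := by
    have h1 := (Lp.memLp u).smul_measure (c := (ENNReal.ofReal (S.h ^ 2))⁻¹) (by simpa using h0)
    rwa [smul_smul, ENNReal.inv_mul_cancel h0 ENNReal.ofReal_ne_top, one_smul] at h1
  have hi : Integrable (u : ℝ → ℂ) (volume.restrict (Ioo (-S.ξ) S.d)) :=
    hu.integrable (by norm_num)
  obtain ⟨C, hC⟩ := hc.exists_bound_of_continuous hφ
  refine hi.bdd_mul (c := C) ?_ ?_
  · exact (Complex.continuous_ofReal.comp hφ).aestronglyMeasurable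
  · exact Eventually.of_forall fun z => by simpa using hC z

theorem integral_mul_add {S : Slab} (u v : Lp ℂ 2 (zMeas S)) {φ : ℝ → ℝ}
    (hφ : Continuous φ) (hc : HasCompactSupport φ) :
    ∫ z in Ioo (-S.ξ) S.d, ((φ z : ℝ) : ℂ) * (u + v : Lp ℂ 2 (zMeas S)) z =
      (∫ z in Ioo (-S.ξ) S.d, ((φ z : ℝ) : ℂ) * u z) +
        ∫ z in Ioo (-S.ξ) S.d, ((φ z : ℝ) : ℂ) * v z := by
  rw [← integral_add (integrable_mul_Lp u hφ hc) (integrable_mul_Lp v hφ hc)]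
  refine integral_congr_ae ?_
  filter_upwards [ae_zMeas (Lp.coeFn_add u v)] with z hz
  rw [hz, Pi.add_apply, mul_add]

theorem integral_mul_smul {S : Slab} (c : ℝ) (u : Lp ℂ 2 (zMeas S)) (φ : ℝ → ℝ) :
    ∫ z in Ioo (-S.ξ) S.d, ((φ z : ℝ) : ℂ) * (c • u : Lp ℂ 2 (zMeas S)) z =
      (c : ℂ) * ∫ z in Ioo (-S.ξ) S.d, ((φ z : ℝ) : ℂ) * u z := by
  rw [← integral_const_mul]
  refine integral_congr_ae ?_
  filter_upwards [ae_zMeas (Lp.coeFn_smul c u)] with z hz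
  rw [hz, Pi.smul_apply, Complex.real_smul]
  ring

/-- The Sobolev space of semidiscrete functions with `n` weak derivatives with respect to `z` in
`L²(-ξ, d)`.  The function itself is `U (g, 0)`, its derivative of order `r` is `U (g, r)`. -/
def Sob (S : Slab) (M n : ℕ) : Submodule ℝ (Amb S M n) where
  carrier := {U | ∀ (g : Grid M) (r : Fin n),
    IsWeakDeriv (-S.ξ) S.d (U (g, r.castSucc)) (U (g, r.succ))}
  zero_mem' := by
    intro g r φ h1 h2 h3
    have hz : ∀ ψ : ℝ → ℝ, ∫ z in Ioo (-S.ξ) S.d,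
        ((ψ z : ℝ) : ℂ) * (0 : Lp ℂ 2 (zMeas S)) z = 0 := fun ψ => by
      simpa using integral_mul_smul (S := S) 0 0 ψ
    simp only [PiLp.zero_apply]
    rw [hz, hz, neg_zero]
  add_mem' := by
    intro U V hU hV g r φ h1 h2 h3
    have hd : Continuous (deriv φ) := h1.continuous_deriv (by simp)
    simp only [PiLp.add_apply]
    rw [integral_mul_add _ _ hd h2.deriv, integral_mul_add _ _ h1.continuous h2,
      hU g r φ h1 h2 h3, hV g r φ h1 h2 h3]
    ring
  smul_mem' := by
    intro c U hU g r φ h1 h2 h3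
    simp only [PiLp.smul_apply]
    rw [integral_mul_smul, integral_mul_smul, hU g r φ h1 h2 h3]
    ring

/-- The continuous representative on `[-ξ, d]` of the function `u` on `(-ξ, d)` has the value `c`
at the point `x`. -/
def HasValueAt (S : Slab) (u : ℝ → ℂ) (x : ℝ) (c : ℂ) : Prop :=
  ∃ g : ℝ → ℂ, ContinuousOn g (Icc (-S.ξ) S.d) ∧ u =ᵐ[zMeas S] g ∧ g x = c

/-- The boundary conditions `U = ψ₀` and `∂U/∂z = ψ₁` on the part `Γ = {|x|, |y| < b, z = -ξ}` of
the boundary, and `U = 0` on the rest of the boundary: on the side `z = d` and on the lateral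
sides. -/
def BoundaryCond {S : Slab} {M : ℕ} (U : Amb S M 2) (ψ₀ ψ₁ : Fin M → Fin M → ℂ) : Prop :=
  (∀ i j : Fin M,
    HasValueAt S (U ((mid i, mid j), 0)) (-S.ξ) (ψ₀ i j) ∧
    HasValueAt S (U ((mid i, mid j), 1)) (-S.ξ) (ψ₁ i j) ∧
    HasValueAt S (U ((mid i, mid j), 0)) S.d 0) ∧
  ∀ g : Grid M, OnLateral g → U (g, 0) = 0

theorem HasValueAt.add {S : Slab} {u v : Lp ℂ 2 (zMeas S)} {x : ℝ} {a b : ℂ}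
    (hu : HasValueAt S u x a) (hv : HasValueAt S v x b) :
    HasValueAt S (u + v : Lp ℂ 2 (zMeas S)) x (a + b) := by
  obtain ⟨f, f1, f2, f3⟩ := hu
  obtain ⟨g, g1, g2, g3⟩ := hv
  exact ⟨f + g, f1.add g1, (Lp.coeFn_add u v).trans (f2.add g2), by simp [f3, g3]⟩

theorem HasValueAt.smul {S : Slab} {u : Lp ℂ 2 (zMeas S)} {x : ℝ} {a : ℂ} (c : ℝ)
    (hu : HasValueAt S u x a) : HasValueAt S (c • u : Lp ℂ 2 (zMeas S)) x (c • a) := by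
  obtain ⟨f, f1, f2, f3⟩ := hu
  exact ⟨c • f, f1.const_smul c, (Lp.coeFn_smul c u).trans (f2.const_smul c), by simp [f3]⟩

theorem HasValueAt.zero {S : Slab} {x : ℝ} : HasValueAt S (0 : Lp ℂ 2 (zMeas S)) x 0 :=
  ⟨0, continuousOn_const, Lp.coeFn_zero _ _ _, rfl⟩

/-- The subspace of `Sob S M 2` given by the homogeneous boundary conditions. -/
def Sob0 (S : Slab) (M : ℕ) : Submodule ℝ (Amb S M 2) where
  carrier := {U | U ∈ Sob S M 2 ∧ BoundaryCond U 0 0}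
  zero_mem' := ⟨Submodule.zero_mem _, fun _ _ => ⟨.zero, .zero, .zero⟩, fun _ _ => rfl⟩
  add_mem' := by
    intro U V ⟨hU', hU⟩ ⟨hV', hV⟩
    refine ⟨Submodule.add_mem _ hU' hV', fun i j => ⟨?_, ?_, ?_⟩, fun g hg => ?_⟩
    · simpa using (hU.1 i j).1.add (hV.1 i j).1
    · simpa using (hU.1 i j).2.1.add (hV.1 i j).2.1
    · simpa using (hU.1 i j).2.2.add (hV.1 i j).2.2
    · simp [hU.2 g hg, hV.2 g hg]
  smul_mem' := by
    intro c U ⟨hU', hU⟩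
    refine ⟨Submodule.smul_mem _ c hU', fun i j => ⟨?_, ?_, ?_⟩, fun g hg => ?_⟩
    · simpa using (hU.1 i j).1.smul c
    · simpa using (hU.1 i j).2.1.smul c
    · simpa using (hU.1 i j).2.2.smul c
    · simp [hU.2 g hg]

/-- The Hilbert space of functions `f` of `(x_j, y_s, z, k)` with
`‖f‖² = ∫ ‖f (·, k)‖² dk < ∞`, the norm under the integral being the one of `Sob S M n`. -/
abbrev L2Sob (S : Slab) (M n : ℕ) (kmin kmax : ℝ) : Type :=
  Lp (Sob S M n) 2 (kMeas kmin kmax)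

/-- The subspace of `L2Sob S M 2 kmin kmax` given by the homogeneous boundary conditions. -/
abbrev L2Sob0 (S : Slab) (M : ℕ) (kmin kmax : ℝ) : Type :=
  Lp (Sob0 S M) 2 (kMeas kmin kmax)

/-- A function with three derivatives, as a function with two derivatives. -/
def trunc {S : Slab} {M : ℕ} (U : Amb S M 3) : Amb S M 2 :=
  WithLp.toLp 2 fun a => U (a.1, a.2.castSucc)

/-! ### Finite differences -/

/-- `w g r` is the derivative of order `r ≤ 2` with respect to `z`, at the grid point `g`, of a
semidiscrete function. -/
abbrev Profile (M : ℕ) : Type := Grid M → Fin 3 → ℝ → ℂ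

def prof {S : Slab} {M : ℕ} (U : Amb S M 2) : Profile M := fun g r z => U (g, r) z

/-- The partial finite difference Laplacian at the interior grid point with indices `i, j`. -/
def lapH {M : ℕ} (h : ℝ) (w : Profile M) (i j : Fin M) (z : ℝ) : ℂ :=
  w (mid i, mid j) 2 z
    + (w (lo i, mid j) 0 z - 2 * w (mid i, mid j) 0 z + w (hi i, mid j) 0 z) / (h : ℂ) ^ 2
    + (w (mid i, lo j) 0 z - 2 * w (mid i, mid j) 0 z + w (mid i, hi j) 0 z) / (h : ℂ) ^ 2

/-- The partial finite difference gradient at the interior grid point with indices `i, j`. -/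
def gradH {M : ℕ} (h : ℝ) (w : Profile M) (i j : Fin M) (z : ℝ) : Fin 3 → ℂ :=
  ![(w (hi i, mid j) 0 z - w (lo i, mid j) 0 z) / (2 * (h : ℂ)),
    (w (mid i, hi j) 0 z - w (mid i, lo j) 0 z) / (2 * (h : ℂ)),
    w (mid i, mid j) 1 z]

/-- `∫ q (κ) dκ` over `(k, kmax)`, with its derivatives with respect to `z`. -/
def tailInt {S : Slab} {M : ℕ} (kmax : ℝ) (q : ℝ → Amb S M 2) (k : ℝ) : Profile M :=
  fun g r z => (∫ κ in k..kmax, q κ (g, r) : Lp ℂ 2 (zMeas S)) z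

/-- The nonlinear integro-differential operator
`Δq + 2k (∇V - ∫∇q) · (k ∇q + ∇V - ∫∇q) + 2i (k q_z + V_z - ∫q_z)` in partial finite differences. -/
def opL {S : Slab} {M : ℕ} (kmax : ℝ) (V : Amb S M 2) (q : ℝ → Amb S M 2)
    (i j : Fin M) (k z : ℝ) : ℂ :=
  let gV := gradH S.h (prof V) i j z
  let gq := gradH S.h (prof (q k)) i j z
  let gI := gradH S.h (tailInt kmax q k) i j z
  lapH S.h (prof (q k)) i j z
    + 2 * (k : ℂ) * ∑ c : Fin 3, (gV c - gI c) * ((k : ℂ) * gq c + gV c - gI c)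
    + 2 * Complex.I * ((k : ℂ) * gq 2 + gV 2 - gI 2)

/-! ### The cost functionals -/

/-- `∑ h ^ 2 ∫ |f| ^ 2 e^{-2λz} dz`, the sum being over the interior grid points. -/
def wInt {M : ℕ} (S : Slab) (lam : ℝ) (f : Fin M → Fin M → ℝ → ℂ) : ℝ :=
  ∑ i : Fin M, ∑ j : Fin M,
    S.h ^ 2 * ∫ z in (-S.ξ)..S.d, ‖f i j z‖ ^ 2 * Real.exp (-2 * lam * z)

/-- The cost functional for the tail function. -/
def costI {S : Slab} {M : ℕ} (mu : ℝ) (Q : Amb S M 2) (W : Sob0 S M) : ℝ :=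
  Real.exp (2 * mu * S.d) *
    wInt S mu fun i j z => lapH S.h (prof (W : Amb S M 2)) i j z + lapH S.h (prof Q) i j z

/-- `W` minimizes the cost functional for the tail function. -/
def IsMinI {S : Slab} {M : ℕ} (mu : ℝ) (Q : Amb S M 2) (W : Sob0 S M) : Prop :=
  ∀ W' : Sob0 S M, costI mu Q W ≤ costI mu Q W'

/-- The cost functional for the integro-differential equation. -/
def costJ {S : Slab} {M : ℕ} {kmin kmax : ℝ} (lam : ℝ) (V : Amb S M 2)
    (F : L2Sob S M 3 kmin kmax) (p : L2Sob0 S M kmin kmax) : ℝ :=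
  Real.exp (2 * lam * S.d) * ∑ i : Fin M, ∑ j : Fin M, S.h ^ 2 *
    ∫ k in kmin..kmax, ∫ z in (-S.ξ)..S.d,
      ‖opL kmax V (fun κ => (p κ : Amb S M 2) + trunc (F κ)) i j k z‖ ^ 2
        * Real.exp (-2 * lam * z)

/-- `G` is the Fréchet derivative of `J` at every point, as an element of the Hilbert space. -/
def IsGradient {H : Type*} [NormedAddCommGroup H] [InnerProductSpace ℝ H]
    (J : H → ℝ) (G : H → H) : Prop :=
  ∀ p : H, HasFDerivAt J (innerSL ℝ (G p)) p

/-- `y` is the projection of `x` on `B`: the point of `B` nearest to `x`. -/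
def IsProj {H : Type*} [NormedAddCommGroup H] (B : Set H) (x y : H) : Prop :=
  y ∈ B ∧ ∀ y' ∈ B, ‖x - y‖ ≤ ‖x - y'‖

theorem exists_isProj {H : Type*} [NormedAddCommGroup H] [InnerProductSpace ℝ H] {R : ℝ}
    (hR : 0 < R) (x : H) : ∃ y, IsProj (Metric.closedBall 0 R) x y := by
  by_cases hx : ‖x‖ ≤ R
  · exact ⟨x, by simpa using hx, fun y _ => by simp⟩
  · push Not at hx
    have hx0 : 0 < ‖x‖ := hR.trans hx
    refine ⟨(R / ‖x‖) • x, ?_, fun y hy => ?_⟩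
    · rw [mem_closedBall_zero_iff, norm_smul, Real.norm_of_nonneg (by positivity),
        div_mul_cancel₀ _ hx0.ne']
    · rw [mem_closedBall_zero_iff] at hy
      have h1 : x - (R / ‖x‖) • x = (1 - R / ‖x‖) • x := by rw [sub_smul, one_smul]
      have h2 : (1 - R / ‖x‖) * ‖x‖ = ‖x‖ - R := by field_simp
      have h3 : 0 ≤ 1 - R / ‖x‖ := by
        rw [sub_nonneg, div_le_one hx0]
        exact hx.le
      rw [h1, norm_smul, Real.norm_of_nonneg h3, h2]
      linarith [norm_sub_norm_le x y]

/-- The Carleman estimate with constant `C` for the weight `e^{-2λz}` holds for all `λ ≥ lam0`. -/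
def Carleman (S : Slab) (M : ℕ) (lam0 C : ℝ) : Prop :=
  ∀ lam : ℝ, lam0 ≤ lam → ∀ u : Sob0 S M,
    C * wInt S lam (fun i j => prof (u : Amb S M 2) (mid i, mid j) 2)
      + C * lam * wInt S lam (fun i j => prof (u : Amb S M 2) (mid i, mid j) 1)
      + C * lam ^ 3 * wInt S lam (fun i j => prof (u : Amb S M 2) (mid i, mid j) 0)
      ≤ wInt S lam (lapH S.h (prof (u : Amb S M 2)))

end SemiDisc

end

open SemiDisc

noncomputable section

namespace SemiDisc

/-! ### Projected gradient iterations for strongly convex functions -/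

section Projection

variable {H : Type*} [NormedAddCommGroup H] [InnerProductSpace ℝ H]

/-! The proof rests on a smallness property of the weight. Up to the constant factor, e^{2λd} φ_λ is
w² with w = e^{λ(d-z)}, which decreases in z and is at least 1 on the interval. A function with
vanishing Cauchy data at z = -ξ is a twofold primitive, taken from -ξ, of its second derivative.
Integrating in the direction in which w decreases gains powers of λ: w|u_z| is bounded by a multiple
of λ^{-1/2} ‖w u_zz‖, and w|u| by a multiple of λ^{-3/2} ‖w u_zz‖ (`Sob0.weighted_bounds`). The step
h is fixed, so the difference quotients in x and y are bounded operators acting on values of u, and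
Δ^h u - u_zz is small relative to u_zz. This gives `carleman`. Its constants are free of M because
translating a family that vanishes on the lateral boundary does not increase its norm
(`sum_shift_le`).

The functional J_λ is the squared weighted norm of a quadratic map A(p) = c + Λp + β(v - Tp, w +
Pp), where T is integration over (k, kmax), Pp = kp - Tp, and here v and w denote the data. The
Taylor remainder of ‖A‖² is exactly ‖A(p+r) - A(p)‖² - 2⟨A(p), β(Tr, Pr)⟩
(`norm_sq_quadMap_remainder`). In the weighted norm the increment A(p+r) - A(p) is r_zz plus terms
that are small relative to r_zz, so the first term is at least a quarter of the squared weighted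
norm of r_zz. In the second term the two powers of the weight are distributed over the two factors
Tr and Pr, which leaves A(p) unweighted and hence bounded on the ball uniformly in λ. That term is
therefore also small relative to the same square (`quadMap_remainder_ge`). As the weight is at least
1, the remainder dominates C₁‖r‖² with C₁ independent of λ. The size of A on the ball determines how
large λ must be.

For this size to depend only on the listed quantities, V = W + Q has to be bounded independently of
δ, although the weight parameter μ of its functional grows as δ → 0. Comparing W with V_* - Q_*
shows this: the residual there is the Laplacian of Q - Q_*, of size δ, while the weight is at most
δ^{-1/2} (`IsMinI.norm_le`, `noiseExponent_bounds`).

Finally, strong convexity and a Lipschitz gradient make the projected gradient step a contraction of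
the closed ball. Its fixed point solves the variational inequality and is the minimizer
(`StronglyConvexOnBall.gradient_projection`). -/

theorem IsProj.inner_le {B : Set H} (hB : Convex ℝ B) {x y : H} (h : IsProj B x y) {z : H}
    (hz : z ∈ B) : ⟪x - y, z - y⟫_ℝ ≤ 0 := by
  have hinf : ‖x - y‖ = ⨅ w : B, ‖x - w‖ := by
    have : Nonempty B := ⟨⟨y, h.1⟩⟩
    refine le_antisymm (le_ciInf fun w => h.2 w w.2) ?_
    exact ciInf_le ⟨0, by rintro _ ⟨w, rfl⟩; exact norm_nonneg _⟩ (⟨y, h.1⟩ : B)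
  exact (norm_eq_iInf_iff_real_inner_le_zero hB h.1).1 hinf z hz

theorem IsProj.norm_sub_le {B : Set H} (hB : Convex ℝ B) {x x' y y' : H} (h : IsProj B x y)
    (h' : IsProj B x' y') : ‖y - y'‖ ≤ ‖x - x'‖ := by
  have h1 := h.inner_le hB h'.1
  have h2 := h'.inner_le hB h.1
  have h3 : ‖y - y'‖ * ‖y - y'‖ ≤ ⟪x - x', y - y'⟫_ℝ := by
    rw [← real_inner_self_eq_norm_mul_norm]
    have : ⟪x - x', y - y'⟫_ℝ - ⟪y - y', y - y'⟫_ℝ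
        = -⟪x - y, y' - y⟫_ℝ - ⟪x' - y', y - y'⟫_ℝ := by
      simp only [inner_sub_left, inner_sub_right]; ring
    linarith
  have h4 := real_inner_le_norm (x - x') (y - y')
  by_contra hlt
  push Not at hlt
  nlinarith [norm_nonneg (x - x'), norm_nonneg (y - y')]

theorem IsProj.unique {B : Set H} (hB : Convex ℝ B) {x y y' : H} (h : IsProj B x y)
    (h' : IsProj B x y') : y = y' := by
  have := h.norm_sub_le hB h'
  simpa [sub_eq_zero] using this

/-- `J` is strongly convex on the closed ball of radius `R`, with gradient `G`. -/
def StronglyConvexOnBall (J : H → ℝ) (G : H → H) (R C : ℝ) : Prop :=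
  ∀ p r : H, p ∈ Metric.closedBall 0 R → p + r ∈ Metric.closedBall 0 R →
    C * ‖r‖ ^ 2 ≤ J (p + r) - J p - ⟪G p, r⟫_ℝ

theorem StronglyConvexOnBall.le {J : H → ℝ} {G : H → H} {R C : ℝ}
    (h : StronglyConvexOnBall J G R C) {p q : H} (hp : p ∈ Metric.closedBall 0 R)
    (hq : q ∈ Metric.closedBall 0 R) : C * ‖q - p‖ ^ 2 ≤ J q - J p - ⟪G p, q - p⟫_ℝ := by
  simpa using h p (q - p) hp (by simpa using hq)

/-- Adding the convexity inequalities at `p` and at `q` cancels the values of `J` and doubles the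
constant. -/
theorem StronglyConvexOnBall.monotone {J : H → ℝ} {G : H → H} {R C : ℝ}
    (h : StronglyConvexOnBall J G R C) {p q : H} (hp : p ∈ Metric.closedBall 0 R)
    (hq : q ∈ Metric.closedBall 0 R) : 2 * C * ‖p - q‖ ^ 2 ≤ ⟪G p - G q, p - q⟫_ℝ := by
  have h1 := h.le hp hq
  have h2 := h.le hq hp
  rw [norm_sub_rev] at h1
  have : ⟪G p - G q, p - q⟫_ℝ = -⟪G p, q - p⟫_ℝ - ⟪G q, p - q⟫_ℝ := by
    simp only [inner_sub_left, inner_sub_right]; ring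
  linarith

/-- An admissible bound for the step sizes of the gradient projection method. -/
def stepBound (C L : ℝ) : ℝ := min (1 / 2) (min (1 / (4 * C)) (C / L ^ 2))

/-- Each term of `stepBound` has its own role: 1/2 keeps the steps below 1, 1/(4C) keeps 1 - γC
positive, and C/L² allows the term of order γ² in the squared step to be absorbed. -/
theorem stepBound_mem {C L : ℝ} (hC : 0 < C) (hL : 0 < L) : stepBound C L ∈ Ioo (0 : ℝ) 1 := by
  refine ⟨?_, ?_⟩
  · unfold stepBound; positivity
  · exact (min_le_left _ _).trans_lt (by norm_num)

theorem mul_lt_of_lt_stepBound {C L γ : ℝ} (hC : 0 < C) (hγ : γ ∈ Ioo 0 (stepBound C L)) :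
    γ * C < 1 / 4 := by
  have h1 : γ < 1 / (4 * C) :=
    hγ.2.trans_le ((min_le_right _ _).trans (min_le_left _ _))
  rw [lt_div_iff₀ (by positivity)] at h1
  linarith

theorem sqrt_one_sub_mem {C L γ : ℝ} (hC : 0 < C) (hγ : γ ∈ Ioo 0 (stepBound C L)) :
    Real.sqrt (1 - γ * C) ∈ Ioo (0 : ℝ) 1 := by
  have h1 := mul_lt_of_lt_stepBound hC hγ
  have h2 : 0 < γ * C := mul_pos hγ.1 hC
  refine ⟨Real.sqrt_pos.2 (by linarith), ?_⟩
  rw [Real.sqrt_lt' one_pos]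
  linarith

/-- Expanding the square, the cross term contributes at most -4γC‖p - q‖² by monotonicity, and the
last term at most γ²L²‖p - q‖² ≤ γC‖p - q‖². This leaves the factor 1 - 3γC, which is below 1 - γC.
-/
theorem StronglyConvexOnBall.step_contracts {J : H → ℝ} {G : H → H} {R C L γ : ℝ}
    (h : StronglyConvexOnBall J G R C) (hC : 0 < C) (hL : 0 < L)
    (hG : ∀ p q : H, ‖p‖ ≤ R → ‖q‖ ≤ R →
      ‖G p - G q‖ ≤ L * ‖p - q‖)
    (hγ : γ ∈ Ioo 0 (stepBound C L)) {p q : H} (hp : p ∈ Metric.closedBall 0 R)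
    (hq : q ∈ Metric.closedBall 0 R) :
    ‖(p - γ • G p) - (q - γ • G q)‖ ≤ Real.sqrt (1 - γ * C) * ‖p - q‖ := by
  have h1 := mul_lt_of_lt_stepBound hC hγ
  have hγ0 := hγ.1
  have h2 : γ * L ^ 2 ≤ C := by
    have : γ < C / L ^ 2 := hγ.2.trans_le ((min_le_right _ _).trans (min_le_right _ _))
    rw [lt_div_iff₀ (by positivity)] at this
    exact this.le
  have hm := h.monotone hp hq
  have hl := hG p q (mem_closedBall_zero_iff.1 hp) (mem_closedBall_zero_iff.1 hq)
  have hl2 : ‖G p - G q‖ ^ 2 ≤ L ^ 2 * ‖p - q‖ ^ 2 := by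
    rw [← mul_pow]; exact pow_le_pow_left₀ (norm_nonneg _) hl 2
  have e : (p - γ • G p) - (q - γ • G q) = (p - q) - γ • (G p - G q) := by
    rw [smul_sub]; abel
  refine (sq_le_sq₀ (norm_nonneg _) (by positivity)).1 ?_
  rw [mul_pow, Real.sq_sqrt (by linarith), e, norm_sub_sq_real, norm_smul, inner_smul_right,
    mul_pow, Real.norm_eq_abs, sq_abs, real_inner_comm]
  have h3 : γ ^ 2 * ‖G p - G q‖ ^ 2 ≤ γ * C * ‖p - q‖ ^ 2 := by
    calc γ ^ 2 * ‖G p - G q‖ ^ 2 ≤ γ ^ 2 * (L ^ 2 * ‖p - q‖ ^ 2) := by gcongr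
      _ = γ * (γ * L ^ 2) * ‖p - q‖ ^ 2 := by ring
      _ ≤ γ * C * ‖p - q‖ ^ 2 := by gcongr
  have h4 := mul_le_mul_of_nonneg_left hm hγ0.le
  have h5 : 0 ≤ γ * C * ‖p - q‖ ^ 2 := by positivity
  linarith

/-- Fixed points of the projected gradient step are the solutions of the variational inequality, so
Banach's theorem gives existence without any compactness argument. At a solution strong convexity
yields J y ≥ J pmin + C‖y - pmin‖². Both characterizations of `pmin` follow from this growth. -/
theorem StronglyConvexOnBall.gradient_projection [CompleteSpace H] {J : H → ℝ} {G : H → H}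
    {R C L : ℝ} (h : StronglyConvexOnBall J G R C) (hR : 0 < R) (hC : 0 < C) (hL : 0 < L)
    (hG : ∀ p q : H, ‖p‖ ≤ R → ‖q‖ ≤ R →
      ‖G p - G q‖ ≤ L * ‖p - q‖) :
    ∃ pmin ∈ Metric.closedBall (0 : H) R,
      (∀ p ∈ Metric.closedBall (0 : H) R,
        ((∀ y ∈ Metric.closedBall (0 : H) R, J p ≤ J y) ↔ p = pmin)) ∧
      (∀ p ∈ Metric.closedBall (0 : H) R,
        ((∀ y ∈ Metric.closedBall (0 : H) R, 0 ≤ ⟪G p, y - p⟫_ℝ) ↔ p = pmin)) ∧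
      ∀ γ ∈ Ioo 0 (stepBound C L), ∀ p : ℕ → H, p 0 ∈ Metric.ball 0 R →
        (∀ n : ℕ, IsProj (Metric.closedBall 0 R) (p n - γ • G (p n)) (p (n + 1))) →
        (∀ n : ℕ, ‖pmin - p n‖ ≤ Real.sqrt (1 - γ * C) ^ n * ‖pmin - p 0‖) ∧
          Tendsto p atTop (𝓝 pmin) := by
  set B := Metric.closedBall (0 : H) R with hB
  have hconv : Convex ℝ B := convex_closedBall 0 R
  choose proj hproj using fun x : H => exists_isProj hR x
  -- existence of a solution of the variational inequality
  obtain ⟨pmin, hpB, hvi⟩ : ∃ p ∈ B, ∀ y ∈ B, 0 ≤ ⟪G p, y - p⟫_ℝ := by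
    obtain ⟨γ, hγ⟩ : ∃ γ, γ ∈ Ioo 0 (stepBound C L) :=
      ⟨stepBound C L / 2, half_pos (stepBound_mem hC hL).1, half_lt_self (stepBound_mem hC hL).1⟩
    have hθ := sqrt_one_sub_mem hC hγ
    have hcomp : IsComplete B := Metric.isClosed_closedBall.isComplete
    have hmaps : MapsTo (fun p => proj (p - γ • G p)) B B := fun p _ => (hproj _).1
    have hK : ContractingWith (Real.toNNReal (Real.sqrt (1 - γ * C)))
        (hmaps.restrict (fun p => proj (p - γ • G p)) B B) := by
      refine ⟨by rw [Real.toNNReal_lt_one]; exact hθ.2, LipschitzWith.of_dist_le_mul ?_⟩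
      rintro ⟨p, hp⟩ ⟨q, hq⟩
      rw [Real.coe_toNNReal _ hθ.1.le]
      simp only [Subtype.dist_eq, MapsTo.val_restrict_apply, dist_eq_norm]
      exact ((hproj _).norm_sub_le hconv (hproj _)).trans (h.step_contracts hC hL hG hγ hp hq)
    obtain ⟨p, hp, hfix, -⟩ := hK.exists_fixedPoint' hcomp hmaps
      (x := 0) (by simp [hB, hR.le]) (edist_ne_top _ _)
    refine ⟨p, hp, fun y hy => ?_⟩
    have h1 := (hproj (p - γ • G p)).inner_le hconv hy
    have h2 : proj (p - γ • G p) = p := hfix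
    rw [h2, sub_sub_cancel_left, inner_neg_left, inner_smul_left] at h1
    have h3 : 0 ≤ γ * ⟪G p, y - p⟫_ℝ := by simpa using h1
    exact nonneg_of_mul_nonneg_right h3 hγ.1
  have hmin : ∀ y ∈ B, J pmin + C * ‖y - pmin‖ ^ 2 ≤ J y := fun y hy => by
    have := h.le hpB hy
    have := hvi y hy
    linarith
  have heq : ∀ p ∈ B, J p ≤ J pmin → p = pmin := fun p hp hle => by
    have h1 := hmin p hp
    have h2 : ‖p - pmin‖ ^ 2 = 0 := by
      have := sq_nonneg ‖p - pmin‖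
      nlinarith
    simpa [sub_eq_zero] using h2
  refine ⟨pmin, hpB, fun p hp => ⟨fun hJ => heq p hp (hJ _ hpB), ?_⟩,
    fun p hp => ⟨fun hJ => heq p hp ?_, ?_⟩, ?_⟩
  · rintro rfl y hy
    have := hmin y hy
    nlinarith [sq_nonneg ‖y - p‖]
  · have h1 := h.le hp hpB
    have h2 := hJ _ hpB
    nlinarith [sq_nonneg ‖pmin - p‖]
  · rintro rfl; exact hvi
  · intro γ hγ p hp0 hstep
    have hθ := sqrt_one_sub_mem hC hγ
    have hpn : ∀ n, p n ∈ B := fun n => by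
      cases n with
      | zero => exact Metric.ball_subset_closedBall hp0
      | succ n => exact (hstep n).1
    have hfix : IsProj B (pmin - γ • G pmin) pmin := by
      have h1 := hproj (pmin - γ • G pmin)
      suffices proj (pmin - γ • G pmin) = pmin by rwa [this] at h1
      refine IsProj.unique hconv h1 ⟨hpB, ?_⟩
      have : Nonempty B := ⟨⟨pmin, hpB⟩⟩
      have h2 := (norm_eq_iInf_iff_real_inner_le_zero hconv hpB (u := pmin - γ • G pmin)).2 ?_
      · intro y hy
        rw [h2]
        exact ciInf_le ⟨0, by rintro _ ⟨w, rfl⟩; exact norm_nonneg _⟩ (⟨y, hy⟩ : B)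
      · intro y hy
        rw [sub_sub_cancel_left, inner_neg_left, inner_smul_left]
        have := mul_nonneg hγ.1.le (hvi y hy)
        simpa using this
    have hrate : ∀ n : ℕ, ‖pmin - p n‖ ≤ Real.sqrt (1 - γ * C) ^ n * ‖pmin - p 0‖ := by
      intro n
      induction n with
      | zero => simp
      | succ n ih =>
        calc ‖pmin - p (n + 1)‖ ≤ ‖(pmin - γ • G pmin) - (p n - γ • G (p n))‖ :=
              hfix.norm_sub_le hconv (hstep n)
          _ ≤ Real.sqrt (1 - γ * C) * ‖pmin - p n‖ := h.step_contracts hC hL hG hγ hpB (hpn n)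
          _ ≤ Real.sqrt (1 - γ * C) * (Real.sqrt (1 - γ * C) ^ n * ‖pmin - p 0‖) := by
              gcongr
          _ = _ := by ring
    refine ⟨hrate, ?_⟩
    rw [tendsto_iff_norm_sub_tendsto_zero]
    refine squeeze_zero (fun _ => norm_nonneg _) (fun n => ?_)
      (by simpa using (tendsto_pow_atTop_nhds_zero_of_lt_one hθ.1.le hθ.2).mul_const ‖pmin - p 0‖)
    rw [norm_sub_rev]
    exact hrate n

end Projection

/-! ### Squared norms of quadratic maps -/

section Quadratic

variable {H K₁ K₂ Y : Type*} [NormedAddCommGroup H] [InnerProductSpace ℝ H]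
  [NormedAddCommGroup K₁] [NormedSpace ℝ K₁] [NormedAddCommGroup K₂] [NormedSpace ℝ K₂]
  [NormedAddCommGroup Y] [InnerProductSpace ℝ Y]

/-- A continuous quadratic map, whose quadratic part is given by the bilinear map `β`. -/
def quadMap (c : Y) (Λ : H →L[ℝ] Y) (β : K₁ →L[ℝ] K₂ →L[ℝ] Y) (T : H →L[ℝ] K₁)
    (P : H →L[ℝ] K₂) (v : K₁) (w : K₂) (p : H) : Y :=
  c + Λ p + β (v - T p) (w + P p)

/-- The derivative of `quadMap`. -/
def quadDeriv (Λ : H →L[ℝ] Y) (β : K₁ →L[ℝ] K₂ →L[ℝ] Y) (T : H →L[ℝ] K₁)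
    (P : H →L[ℝ] K₂) (v : K₁) (w : K₂) (p : H) : H →L[ℝ] Y :=
  Λ - (β.flip (w + P p)) ∘L T + (β (v - T p)) ∘L P

theorem exists_bilin_bound (β : K₁ →L[ℝ] K₂ →L[ℝ] Y) :
    ∃ C, 0 ≤ C ∧ ∀ u x, ‖β u x‖ ≤ C * ‖u‖ * ‖x‖ :=
  ⟨‖β‖, β.opNorm_nonneg, β.le_opNorm₂⟩

variable (c : Y) (Λ : H →L[ℝ] Y) (β : K₁ →L[ℝ] K₂ →L[ℝ] Y) (T : H →L[ℝ] K₁)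
  (P : H →L[ℝ] K₂) (v : K₁) (w : K₂)

theorem quadDeriv_apply (p r : H) : quadDeriv Λ β T P v w p r =
    Λ r - β (T r) (w + P p) + β (v - T p) (P r) := rfl

theorem quadMap_add (p r : H) : quadMap c Λ β T P v w (p + r) =
    quadMap c Λ β T P v w p + quadDeriv Λ β T P v w p r - β (T r) (P r) := by
  simp only [quadMap, quadDeriv_apply, map_add, map_sub, add_apply,
    sub_apply]
  abel

/-- The increment is written without a term quadratic in `r`: one argument of β is frozen at `p`,
the other at `p + r`. Both points lie in the ball, so both frozen factors are bounded there. -/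
theorem quadMap_add_sub (p r : H) : quadMap c Λ β T P v w (p + r) - quadMap c Λ β T P v w p =
    Λ r - β (T r) (w + P (p + r)) + β (v - T p) (P r) := by
  simp only [quadMap, map_add, map_sub, add_apply,
    sub_apply]
  abel

theorem hasFDerivAt_quadMap (p : H) :
    HasFDerivAt (quadMap c Λ β T P v w) (quadDeriv Λ β T P v w p) p := by
  have h1 : HasFDerivAt (fun p => v - T p) (-T) p := by
    simpa using (T.hasFDerivAt (x := p)).const_sub v
  have h2 : HasFDerivAt (fun p => w + P p) P p := (P.hasFDerivAt (x := p)).const_add w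
  have h3 := β.hasFDerivAt_of_bilinear h1 h2
  have h4 := ((Λ.hasFDerivAt (x := p)).const_add c).add h3
  refine h4.congr_fderiv ?_
  ext r
  simp [quadDeriv_apply]
  abel

theorem norm_quadMap_le {N : ℝ} (hN : 0 < N) (hc : ‖c‖ ≤ N) (hΛ : ‖Λ‖ ≤ N)
    (hβ : ∀ u x, ‖β u x‖ ≤ N * ‖u‖ * ‖x‖)
    (hT : ‖T‖ ≤ N) (hP : ‖P‖ ≤ N) (hv : ‖v‖ ≤ N) (hw : ‖w‖ ≤ N) {p : H} (hp : ‖p‖ ≤ N) :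
    ‖v - T p‖ ≤ N + N ^ 2 ∧ ‖w + P p‖ ≤ N + N ^ 2 ∧
      ‖quadMap c Λ β T P v w p‖ ≤ N + N ^ 2 + N * (N + N ^ 2) ^ 2 := by
  have bT := (T.le_of_opNorm_le hT p).trans (mul_le_mul_of_nonneg_left hp hN.le)
  have bP := (P.le_of_opNorm_le hP p).trans (mul_le_mul_of_nonneg_left hp hN.le)
  have bΛ := (Λ.le_of_opNorm_le hΛ p).trans (mul_le_mul_of_nonneg_left hp hN.le)
  have bv : ‖v - T p‖ ≤ N + N ^ 2 := (norm_sub_le _ _).trans (by nlinarith)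
  have bw : ‖w + P p‖ ≤ N + N ^ 2 := (norm_add_le _ _).trans (by nlinarith)
  refine ⟨bv, bw, (norm_add₃_le).trans ?_⟩
  have h2 : ‖β (v - T p) (w + P p)‖ ≤ N * (N + N ^ 2) * (N + N ^ 2) := by
    refine (hβ _ _).trans ?_
    gcongr
  nlinarith

variable [CompleteSpace H]

/-- The gradient of the squared norm of `quadMap`. -/
def quadGrad (p : H) : H :=
  (InnerProductSpace.toDual ℝ H).symm
    (2 • (innerSL ℝ (quadMap c Λ β T P v w p)) ∘L (quadDeriv Λ β T P v w p))

theorem inner_quadGrad (p r : H) : ⟪quadGrad c Λ β T P v w p, r⟫_ℝ =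
    2 * ⟪quadMap c Λ β T P v w p, quadDeriv Λ β T P v w p r⟫_ℝ := by
  rw [quadGrad, InnerProductSpace.toDual_symm_apply]
  simp

theorem isGradient_quadGrad :
    IsGradient (fun p => ‖quadMap c Λ β T P v w p‖ ^ 2) (quadGrad c Λ β T P v w) := by
  intro p
  refine ((hasFDerivAt_quadMap c Λ β T P v w p).norm_sq).congr_fderiv ?_
  ext r
  rw [innerSL_apply_apply, inner_quadGrad]
  simp

/-- By the exact expansion, the derivative applied to `r` is the increment plus β(Tr, Pr).
Substituting this for the linear term leaves the square of the increment and a single pairing with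
the quadratic part. -/
theorem norm_sq_quadMap_remainder (p r : H) :
    ‖quadMap c Λ β T P v w (p + r)‖ ^ 2 - ‖quadMap c Λ β T P v w p‖ ^ 2
      - ⟪quadGrad c Λ β T P v w p, r⟫_ℝ =
    ‖quadMap c Λ β T P v w (p + r) - quadMap c Λ β T P v w p‖ ^ 2
      - 2 * ⟪quadMap c Λ β T P v w p, β (T r) (P r)⟫_ℝ := by
  have h1 : quadDeriv Λ β T P v w p r =
      (quadMap c Λ β T P v w (p + r) - quadMap c Λ β T P v w p) + β (T r) (P r) := by
    rw [quadMap_add]; abel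
  rw [inner_quadGrad, h1, inner_add_right, norm_sub_sq_real, inner_sub_right,
    real_inner_self_eq_norm_sq, real_inner_comm]
  ring

/-- A Lipschitz constant for `quadGrad`. -/
def quadLip (N : ℝ) : ℝ :=
  2 * ((N + 2 * N ^ 2 * (N + N ^ 2)) ^ 2 + (N + N ^ 2 + N * (N + N ^ 2) ^ 2) * (2 * N ^ 3))

theorem quadLip_pos {N : ℝ} (hN : 0 < N) : 0 < quadLip N := by
  unfold quadLip; positivity

/-- The gradient is 2 A'(p)*A(p), so its Lipschitz constant comes from the product rule: the bound
of A times the Lipschitz constant of A', plus the Lipschitz constant of A times the bound of A'. A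
single `N` bounds all data, which makes `quadLip` a polynomial in `N`. -/
theorem norm_quadGrad_sub_le {N : ℝ} (hN : 0 < N) (hc : ‖c‖ ≤ N) (hΛ : ‖Λ‖ ≤ N)
    (hβ : ∀ u x, ‖β u x‖ ≤ N * ‖u‖ * ‖x‖)
    (hT : ‖T‖ ≤ N) (hP : ‖P‖ ≤ N) (hv : ‖v‖ ≤ N) (hw : ‖w‖ ≤ N) {p q : H} (hp : ‖p‖ ≤ N)
    (hq : ‖q‖ ≤ N) :
    ‖quadGrad c Λ β T P v w p - quadGrad c Λ β T P v w q‖ ≤ quadLip N * ‖p - q‖ := by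
  have bT : ∀ r, ‖T r‖ ≤ N * ‖r‖ := fun r => T.le_of_opNorm_le hT r
  have bP : ∀ r, ‖P r‖ ≤ N * ‖r‖ := fun r => P.le_of_opNorm_le hP r
  have bΛ : ∀ r, ‖Λ r‖ ≤ N * ‖r‖ := fun r => Λ.le_of_opNorm_le hΛ r
  have bβ : ∀ {x y a b}, ‖x‖ ≤ a → ‖y‖ ≤ b → ‖β x y‖ ≤ N * a * b := fun {x y a b} hx hy => by
    refine (hβ x y).trans ?_
    have := (norm_nonneg x).trans hx
    gcongr
  have bq := fun {r : H} (hr : ‖r‖ ≤ N) => norm_quadMap_le c Λ β T P v w hN hc hΛ hβ hT hP hv hw hr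
  have bv := fun (r : H) (hr : ‖r‖ ≤ N) => (bq hr).1
  have bw := fun (r : H) (hr : ‖r‖ ≤ N) => (bq hr).2.1
  have bA := (bq hp).2.2
  have bD : ∀ r, ‖quadDeriv Λ β T P v w q r‖ ≤ (N + 2 * N ^ 2 * (N + N ^ 2)) * ‖r‖ := fun r => by
    rw [quadDeriv_apply]
    refine (norm_add_le _ _).trans ((add_le_add_left (norm_sub_le _ _) _).trans ?_)
    have h1 := bΛ r
    have h2 := bβ (bT r) (bw q hq)
    have h3 := bβ (bv q hq) (bP r)
    nlinarith
  have bAA : ‖quadMap c Λ β T P v w p - quadMap c Λ β T P v w q‖ ≤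
      (N + 2 * N ^ 2 * (N + N ^ 2)) * ‖p - q‖ := by
    have h0 := quadMap_add_sub c Λ β T P v w q (p - q)
    rw [add_sub_cancel] at h0
    rw [h0]
    refine (norm_add_le _ _).trans ((add_le_add_left (norm_sub_le _ _) _).trans ?_)
    have h1 := bΛ (p - q)
    have h2 := bβ (bT (p - q)) (bw p hp)
    have h3 := bβ (bv q hq) (bP (p - q))
    nlinarith
  have bDD : ∀ r, ‖quadDeriv Λ β T P v w p r - quadDeriv Λ β T P v w q r‖ ≤
      2 * N ^ 3 * ‖p - q‖ * ‖r‖ := fun r => by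
    have h0 : quadDeriv Λ β T P v w p r - quadDeriv Λ β T P v w q r =
        -β (T r) (P (p - q)) - β (T (p - q)) (P r) := by
      simp only [quadDeriv_apply, map_add, map_sub, sub_apply]
      abel
    rw [h0]
    refine (norm_sub_le _ _).trans ?_
    rw [norm_neg]
    have h2 := bβ (bT r) (bP (p - q))
    have h3 := bβ (bT (p - q)) (bP r)
    nlinarith
  -- Testing the difference of the gradients against itself avoids adjoints; one factor ‖x‖ is
  -- divided out at the end.
  set x := quadGrad c Λ β T P v w p - quadGrad c Λ β T P v w q with hx
  have hxx : ‖x‖ * ‖x‖ ≤ quadLip N * ‖p - q‖ * ‖x‖ := by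
    rw [← real_inner_self_eq_norm_mul_norm]
    nth_rewrite 1 [hx]
    rw [inner_sub_left, inner_quadGrad, inner_quadGrad]
    have h0 : 2 * ⟪quadMap c Λ β T P v w p, quadDeriv Λ β T P v w p x⟫_ℝ
        - 2 * ⟪quadMap c Λ β T P v w q, quadDeriv Λ β T P v w q x⟫_ℝ =
        2 * (⟪quadMap c Λ β T P v w p, quadDeriv Λ β T P v w p x - quadDeriv Λ β T P v w q x⟫_ℝ
          + ⟪quadMap c Λ β T P v w p - quadMap c Λ β T P v w q,
              quadDeriv Λ β T P v w q x⟫_ℝ) := by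
      simp only [inner_sub_left, inner_sub_right]; ring
    have h1 := (real_inner_le_norm (quadMap c Λ β T P v w p)
      (quadDeriv Λ β T P v w p x - quadDeriv Λ β T P v w q x)).trans
      (mul_le_mul bA (bDD x) (norm_nonneg _) (by positivity))
    have h2 := (real_inner_le_norm (quadMap c Λ β T P v w p - quadMap c Λ β T P v w q)
      (quadDeriv Λ β T P v w q x)).trans
      (mul_le_mul bAA (bD x) (norm_nonneg _) (by positivity))
    rw [h0]
    unfold quadLip
    linarith
  rcases (norm_nonneg x).eq_or_lt with h | h
  · rw [← h]
    have := quadLip_pos hN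
    positivity
  · exact le_of_mul_le_mul_right hxx h

end Quadratic

/-! ### Multiplication and integration operators on `L²` -/

section LpOperators

open scoped ENNReal

theorem integral_norm_le_mul_norm {α Z : Type*} [MeasurableSpace α] [NormedAddCommGroup Z]
    (μ : Measure α) [IsFiniteMeasure μ] (f : Lp Z 2 μ) :
    ∫ x, ‖f x‖ ∂μ ≤ Real.sqrt (μ.real univ) * ‖f‖ := by
  have h1 : ∫ x, ‖f x‖ ∂μ = (eLpNorm f 1 μ).toReal := by
    rw [eLpNorm_one_eq_lintegral_enorm, integral_norm_eq_lintegral_enorm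
      (Lp.aestronglyMeasurable f)]
  have h2 := eLpNorm_le_eLpNorm_mul_rpow_measure_univ (p := 1) (q := 2) (μ := μ)
    (by norm_num) (Lp.aestronglyMeasurable f)
  have h3 : (eLpNorm f 2 μ * μ univ ^ (1 / (1 : ℝ≥0∞).toReal - 1 / (2 : ℝ≥0∞).toReal)).toReal =
      Real.sqrt (μ.real univ) * ‖f‖ := by
    rw [ENNReal.toReal_mul, ← Lp.norm_def, mul_comm, Real.sqrt_eq_rpow, Measure.real,
      ENNReal.toReal_rpow]
    norm_num
  rw [h1, ← h3]
  refine ENNReal.toReal_mono ?_ h2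
  exact ENNReal.mul_ne_top (Lp.eLpNorm_ne_top f)
    (ENNReal.rpow_ne_top_of_nonneg (by norm_num) (measure_ne_top _ _))

variable {α : Type*} [MeasurableSpace α] {μ : Measure α} {Z Z' : Type*}
  [NormedAddCommGroup Z] [NormedSpace ℝ Z] [NormedAddCommGroup Z'] [NormedSpace ℝ Z']

/-- Multiplication by a bounded function. -/
def mulLp {a : α → ℝ} (ha : MemLp a ∞ μ) : Lp Z 2 μ →L[ℝ] Lp Z 2 μ :=
  (ContinuousLinearMap.lsmul ℝ ℝ).holderL μ ∞ 2 2 ha.toLp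

theorem mulLp_ae {a : α → ℝ} (ha : MemLp a ∞ μ) (f : Lp Z 2 μ) :
    mulLp ha f =ᵐ[μ] fun x => a x • f x := by
  have h1 := (ContinuousLinearMap.lsmul ℝ ℝ).coeFn_holder (r := 2) ha.toLp f
  filter_upwards [h1, ha.coeFn_toLp] with x h1 h2
  change ((ContinuousLinearMap.lsmul ℝ ℝ).holder 2 ha.toLp f) x = _
  rw [h1, h2]
  rfl

theorem mulLp_compLp {a : α → ℝ} (ha : MemLp a ∞ μ) (L : Z →L[ℝ] Z') (f : Lp Z 2 μ) :
    L.compLpL 2 μ (mulLp ha f) = mulLp ha (L.compLpL 2 μ f) := by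
  refine Lp.ext ?_
  filter_upwards [L.coeFn_compLpL (mulLp ha f), mulLp_ae ha f, mulLp_ae ha (L.compLpL 2 μ f),
    L.coeFn_compLpL f] with x h1 h2 h3 h4
  rw [h1, h2, h3, h4, map_smul]

variable {kmin kmax : ℝ}

theorem integrableOn_Icc_Lp {Z : Type*} [NormedAddCommGroup Z] (f : Lp Z 2 (kMeas kmin kmax)) : IntegrableOn f (Icc kmin kmax) := by
  rw [integrableOn_Icc_iff_integrableOn_Ioo]
  exact (Lp.memLp f).integrable (by norm_num)

theorem intervalIntegrable_Lp {Z : Type*} [NormedAddCommGroup Z] (f : Lp Z 2 (kMeas kmin kmax)) {k : ℝ} (hk : k ∈ Icc kmin kmax) :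
    IntervalIntegrable f volume k kmax := by
  rw [intervalIntegrable_iff_integrableOn_Icc_of_le hk.2]
  exact (integrableOn_Icc_Lp f).mono_set (Icc_subset_Icc_left hk.1)

theorem tail_congr {f g : ℝ → Z} (h : f =ᵐ[kMeas kmin kmax] g) {k : ℝ}
    (hk : k ∈ Icc kmin kmax) : ∫ κ in k..kmax, f κ = ∫ κ in k..kmax, g κ := by
  rw [intervalIntegral.integral_of_le hk.2, intervalIntegral.integral_of_le hk.2,
    integral_Ioc_eq_integral_Ioo, integral_Ioc_eq_integral_Ioo]
  exact integral_congr_ae (ae_restrict_of_ae_restrict_of_subset (Ioo_subset_Ioo_left hk.1) h)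

theorem norm_tail_le (f : Lp Z 2 (kMeas kmin kmax)) {k : ℝ} (hk : k ∈ Icc kmin kmax) :
    ‖∫ κ in k..kmax, f κ‖ ≤ Real.sqrt ((kMeas kmin kmax).real univ) * ‖f‖ := by
  refine le_trans ?_ (integral_norm_le_mul_norm _ f)
  rw [intervalIntegral.integral_of_le hk.2, integral_Ioc_eq_integral_Ioo]
  refine (norm_integral_le_integral_norm _).trans ?_
  refine setIntegral_mono_set ?_ (ae_of_all _ fun _ => norm_nonneg _) ?_
  · exact ((Lp.memLp f).integrable (by norm_num)).norm
  · exact (Ioo_subset_Ioo_left hk.1).eventuallyLE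

theorem ae_mem_Ioo : ∀ᵐ k ∂(kMeas kmin kmax), k ∈ Ioo kmin kmax :=
  ae_restrict_mem measurableSet_Ioo

theorem memLp_tail (p : ℝ≥0∞) (f : Lp Z 2 (kMeas kmin kmax)) :
    MemLp (fun k => ∫ κ in k..kmax, f κ) p (kMeas kmin kmax) := by
  refine MemLp.of_bound ?_ (Real.sqrt ((kMeas kmin kmax).real univ) * ‖f‖) ?_
  · rcases le_or_gt kmax kmin with h | h
    · simp [kMeas, Ioo_eq_empty (not_lt.2 h)]
    -- Measurability in k comes from continuity of the integral in its lower limit.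
    · have h1 := intervalIntegral.continuousOn_primitive_interval_left (μ := volume) (f := f)
        (a := kmin) (b := kmax) (by rw [uIcc_of_le h.le]; exact integrableOn_Icc_Lp f)
      rw [uIcc_of_le h.le] at h1
      exact (h1.mono Ioo_subset_Icc_self).aestronglyMeasurable measurableSet_Ioo
  · filter_upwards [ae_mem_Ioo] with k hk
    exact norm_tail_le f (Ioo_subset_Icc_self hk)

variable [CompleteSpace Z] [CompleteSpace Z']

/-- The operator `f ↦ ∫ f (κ) dκ`, the integral being over `(k, kmax)`. -/
def tailLp (Z : Type*) [NormedAddCommGroup Z] [NormedSpace ℝ Z] [CompleteSpace Z]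
    (kmin kmax : ℝ) (p : ℝ≥0∞) [Fact (1 ≤ p)] :
    Lp Z 2 (kMeas kmin kmax) →L[ℝ] Lp Z p (kMeas kmin kmax) :=
  LinearMap.mkContinuous
    { toFun := fun f => (memLp_tail p f).toLp
      map_add' := fun f g => by
        rw [← MemLp.toLp_add]
        refine MemLp.toLp_congr _ _ ?_
        filter_upwards [ae_mem_Ioo] with k hk
        have hk := Ioo_subset_Icc_self hk
        rw [tail_congr (Lp.coeFn_add f g) hk]
        exact intervalIntegral.integral_add (intervalIntegrable_Lp f hk)
          (intervalIntegrable_Lp g hk)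
      map_smul' := fun c f => by
        rw [RingHom.id_apply, ← MemLp.toLp_const_smul]
        refine MemLp.toLp_congr _ _ ?_
        filter_upwards [ae_mem_Ioo] with k hk
        rw [tail_congr (Lp.coeFn_smul c f) (Ioo_subset_Icc_self hk)]
        exact intervalIntegral.integral_smul _ _ }
    (measureUnivNNReal (kMeas kmin kmax) ^ p.toReal⁻¹ *
      Real.sqrt ((kMeas kmin kmax).real univ)) fun f => by
    rw [mul_assoc]
    refine Lp.norm_le_of_ae_bound (by positivity) ?_
    filter_upwards [ae_mem_Ioo, (memLp_tail p f).coeFn_toLp] with k hk h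
    simp only [LinearMap.coe_mk, AddHom.coe_mk]
    rw [h]
    exact norm_tail_le f (Ioo_subset_Icc_self hk)

theorem tailLp_ae (p : ℝ≥0∞) [Fact (1 ≤ p)] (f : Lp Z 2 (kMeas kmin kmax)) :
    tailLp Z kmin kmax p f =ᵐ[kMeas kmin kmax] fun k => ∫ κ in k..kmax, f κ :=
  (memLp_tail p f).coeFn_toLp

/-- Since bounded operators commute with the integral over κ, an estimate available at fixed k for
values in the space of `z`-functions carries over to the integral terms. -/
theorem map_tail (L : Z →L[ℝ] Z') (f : Lp Z 2 (kMeas kmin kmax)) {k : ℝ}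
    (hk : k ∈ Icc kmin kmax) :
    L (∫ κ in k..kmax, f κ) = ∫ κ in k..kmax, L.compLpL 2 _ f κ := by
  rw [tail_congr (L.coeFn_compLpL f) hk]
  exact (L.intervalIntegral_comp_comm (intervalIntegrable_Lp f hk)).symm

theorem tailLp_compLp (p : ℝ≥0∞) [Fact (1 ≤ p)] (L : Z →L[ℝ] Z')
    (f : Lp Z 2 (kMeas kmin kmax)) :
    L.compLpL p _ (tailLp Z kmin kmax p f) = tailLp Z' kmin kmax p (L.compLpL 2 _ f) := by
  refine Lp.ext ?_
  filter_upwards [L.coeFn_compLpL (tailLp Z kmin kmax p f), tailLp_ae p f,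
    tailLp_ae p (L.compLpL 2 _ f), ae_mem_Ioo] with k h1 h2 h3 hk
  rw [h1, h2, h3, map_tail L f (Ioo_subset_Icc_self hk)]

theorem memLp_id_kMeas : MemLp (fun k : ℝ => k) ∞ (kMeas kmin kmax) := by
  refine memLp_top_of_bound measurable_id.aestronglyMeasurable (max |kmin| |kmax|) ?_
  filter_upwards [ae_mem_Ioo] with k hk
  exact abs_le_max_abs_abs hk.1.le hk.2.le

/-- The operator `f ↦ k f (k) - ∫ f (κ) dκ`, the integral being over `(k, kmax)`. -/
def mulSubTail (Z : Type*) [NormedAddCommGroup Z] [NormedSpace ℝ Z] [CompleteSpace Z]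
    (kmin kmax : ℝ) : Lp Z 2 (kMeas kmin kmax) →L[ℝ] Lp Z 2 (kMeas kmin kmax) :=
  mulLp memLp_id_kMeas - tailLp Z kmin kmax 2

theorem mulSubTail_ae (f : Lp Z 2 (kMeas kmin kmax)) :
    mulSubTail Z kmin kmax f =ᵐ[kMeas kmin kmax] fun k => k • f k - ∫ κ in k..kmax, f κ := by
  filter_upwards [Lp.coeFn_sub (mulLp memLp_id_kMeas f) (tailLp Z kmin kmax 2 f),
    mulLp_ae memLp_id_kMeas f, tailLp_ae 2 f] with k h1 h2 h3
  change (mulLp memLp_id_kMeas f - tailLp Z kmin kmax 2 f : Lp Z 2 (kMeas kmin kmax)) k = _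
  rw [h1, Pi.sub_apply, h2, h3]

theorem mulSubTail_compLp (L : Z →L[ℝ] Z') (f : Lp Z 2 (kMeas kmin kmax)) :
    L.compLpL 2 _ (mulSubTail Z kmin kmax f) = mulSubTail Z' kmin kmax (L.compLpL 2 _ f) := by
  simp only [mulSubTail, sub_apply, map_sub, mulLp_compLp, tailLp_compLp]

end LpOperators

/-! ### Weak derivatives -/

/-- This is integration by parts for absolutely continuous functions. The boundary term at `a`
vanishes because the primitive starts there. -/
theorem integral_deriv_mul_primitive_real {a b : ℝ} {φ v : ℝ → ℝ}
    (hφ : ContDiff ℝ 1 φ) (hv : IntervalIntegrable v volume a b) :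
    ∫ z in a..b, deriv φ z * ∫ t in a..z, v t =
      φ b * (∫ t in a..b, v t) - ∫ z in a..b, φ z * v z := by
  have hf : AbsolutelyContinuousOnInterval φ a b := hφ.contDiffOn.absolutelyContinuousOnInterval
  have hg := hv.absolutelyContinuousOnInterval_intervalIntegral (c := a) left_mem_uIcc
  have h := hf.integral_mul_deriv_eq_deriv_mul hg
  have hd : ∫ z in a..b, φ z * deriv (fun x => ∫ t in a..x, v t) z = ∫ z in a..b, φ z * v z := by
    refine intervalIntegral.integral_congr_ae ?_
    filter_upwards [hv.ae_hasDerivAt_integral] with x hx hx'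
    rw [(hx (uIoc_subset_uIcc hx') a left_mem_uIcc).deriv]
  rw [hd] at h
  simp only [intervalIntegral.integral_same, mul_zero, sub_zero] at h
  linarith

theorem integral_deriv_mul_primitive {a b : ℝ} {φ : ℝ → ℝ} {v : ℝ → ℂ}
    (hφ : ContDiff ℝ 1 φ) (hv : IntervalIntegrable v volume a b) :
    ∫ z in a..b, ((deriv φ z : ℝ) : ℂ) * ∫ t in a..z, v t =
      φ b * (∫ t in a..b, v t) - ∫ z in a..b, ((φ z : ℝ) : ℂ) * v z := by
  have hd : Continuous (deriv φ) := hφ.continuous_deriv_one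
  have hvz : ∀ z ∈ uIcc a b, IntervalIntegrable v volume a z := fun z hz =>
    hv.mono_set (uIcc_subset_uIcc_left hz)
  have hprim : ContinuousOn (fun z => ∫ t in a..z, v t) (uIcc a b) :=
    intervalIntegral.continuousOn_primitive_interval' hv left_mem_uIcc
  have h1 : IntervalIntegrable (fun z => ((deriv φ z : ℝ) : ℂ) * ∫ t in a..z, v t) volume a b :=
    ((Complex.continuous_ofReal.comp hd).continuousOn.mul hprim).intervalIntegrable
  have h2 : IntervalIntegrable (fun z => ((φ z : ℝ) : ℂ) * v z) volume a b :=
    hv.continuousOn_mul (Complex.continuous_ofReal.comp hφ.continuous).continuousOn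
  -- Real functionals reduce the complex identity to the real one; only the real and imaginary parts
  -- are used in the end.
  have key : ∀ L : ℂ →L[ℝ] ℝ,
      L (∫ z in a..b, ((deriv φ z : ℝ) : ℂ) * ∫ t in a..z, v t) =
        L (φ b * (∫ t in a..b, v t) - ∫ z in a..b, ((φ z : ℝ) : ℂ) * v z) := fun L => by
    have hL : ∀ (r : ℝ) (c : ℂ), L ((r : ℂ) * c) = r * L c := fun r c => by
      rw [← Complex.real_smul, map_smul, smul_eq_mul]
    have hLv : IntervalIntegrable (fun z => L (v z)) volume a b :=
      ⟨L.integrable_comp hv.1, L.integrable_comp hv.2⟩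
    rw [map_sub, hL, ← L.intervalIntegral_comp_comm h1, ← L.intervalIntegral_comp_comm h2,
      ← L.intervalIntegral_comp_comm hv]
    simp only [hL]
    rw [← integral_deriv_mul_primitive_real hφ hLv]
    refine intervalIntegral.integral_congr fun z hz => ?_
    rw [L.intervalIntegral_comp_comm (hvz z hz)]
  exact Complex.ext (key Complex.reCLM) (key Complex.imCLM)

/-- To the left of `c` nothing has been integrated yet, and to the right of `e` the whole integral
has been, which is zero. -/
theorem tsupport_integral_subset {a b c e : ℝ} (hc : a < c) (he : e < b)
    {f : ℝ → ℝ} (hf : Continuous f) (hs : ∀ z, z ∉ Icc c e → f z = 0)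
    (h0 : ∫ z in a..b, f z = 0) :
    tsupport (fun z => ∫ t in a..z, f t) ⊆ Icc c e := by
  refine closure_minimal (fun z hz => ?_) isClosed_Icc
  by_contra hz'
  refine hz ?_
  have hi : ∀ x y, IntervalIntegrable f volume x y := fun x y => hf.intervalIntegrable x y
  rcases lt_or_ge z c with h | h
  · refine intervalIntegral.integral_zero_ae (ae_of_all _ fun t ht => hs t fun ht' => ?_)
    rcases mem_uIoc.1 ht with ht | ht
    · linarith [ht.2, ht'.1]
    · linarith [ht.2, ht'.1]
  · have h' : e < z := lt_of_not_ge fun h2 => hz' ⟨h, h2⟩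
    rw [← intervalIntegral.integral_add_adjacent_intervals (hi a z) (hi z b)] at h0
    have h3 : ∫ t in z..b, f t = 0 := by
      refine intervalIntegral.integral_zero_ae (ae_of_all _ fun t ht => hs t fun ht' => ?_)
      rcases mem_uIoc.1 ht with ht | ht
      · linarith [ht.1, ht'.2]
      · linarith [ht.1, ht'.2]
    simpa [h3] using h0

/-- A function with a weak derivative is, up to a constant, the primitive of its derivative. -/
theorem IsWeakDeriv.ae_eq_primitive {a b : ℝ} (hab : a < b) {u v : ℝ → ℂ}
    (hu : IntegrableOn u (Ioo a b)) (hv : IntegrableOn v (Ioo a b)) (h : IsWeakDeriv a b u v) :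
    ∃ c : ℂ, ∀ᵐ z ∂(volume.restrict (Ioo a b)), u z = c + ∫ t in a..z, v t := by
  have hvi : IntervalIntegrable v volume a b := by
    rwa [intervalIntegrable_iff_integrableOn_Ioo_of_le hab.le]
  have toIoo : ∀ f : ℝ → ℂ, ∫ z in Ioo a b, f z = ∫ z in a..b, f z := fun f => by
    rw [intervalIntegral.integral_of_le hab.le, integral_Ioc_eq_integral_Ioo]
  have hprim : ContinuousOn (fun z => ∫ t in a..z, v t) (Icc a b) := by
    have := intervalIntegral.continuousOn_primitive_interval' hvi left_mem_uIcc
    rwa [uIcc_of_le hab.le] at this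
  -- The argument is that of du Bois-Reymond: `g` is orthogonal to the derivatives of all test
  -- functions, and this forces it to be constant.
  set g : ℝ → ℂ := fun z => u z - ∫ t in a..z, v t with hg
  have hgi : IntegrableOn g (Ioo a b) :=
    hu.sub ((hprim.integrableOn_Icc).mono_set Ioo_subset_Icc_self)
  have hmul : ∀ {f : ℝ → ℂ} {ψ : ℝ → ℝ}, IntegrableOn f (Ioo a b) → Continuous ψ →
      IntegrableOn (fun z => ((ψ z : ℝ) : ℂ) * f z) (Ioo a b) := fun {f ψ} hf hψ => by
    have hf' : IntervalIntegrable f volume a b := by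
      rwa [intervalIntegrable_iff_integrableOn_Ioo_of_le hab.le]
    rw [← intervalIntegrable_iff_integrableOn_Ioo_of_le hab.le]
    exact hf'.continuousOn_mul (Complex.continuous_ofReal.comp hψ).continuousOn
  have hg0 : ∀ φ : ℝ → ℝ, ContDiff ℝ ∞ φ → HasCompactSupport φ → tsupport φ ⊆ Ioo a b →
      ∫ z in Ioo a b, ((deriv φ z : ℝ) : ℂ) * g z = 0 := fun φ h1 h2 h3 => by
    have hd : Continuous (deriv φ) := h1.continuous_deriv (by simp)
    have hb : φ b = 0 := image_eq_zero_of_notMem_tsupport fun hb => (h3 hb).2.false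
    have e1 : ∀ z, ((deriv φ z : ℝ) : ℂ) * g z =
        ((deriv φ z : ℝ) : ℂ) * u z - ((deriv φ z : ℝ) : ℂ) * ∫ t in a..z, v t :=
      fun z => mul_sub _ _ _
    simp only [e1]
    rw [integral_sub (hmul hu hd)
      (hmul ((hprim.integrableOn_Icc).mono_set Ioo_subset_Icc_self) hd), h φ h1 h2 h3,
      toIoo (fun z => ((deriv φ z : ℝ) : ℂ) * ∫ t in a..z, v t),
      integral_deriv_mul_primitive (h1.of_le (by exact_mod_cast le_top)) hvi, hb, toIoo]
    simp
  -- a fixed test function with integral one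
  obtain ⟨η, hη, hηs, hηt, hη1⟩ : ∃ η : ℝ → ℝ, ContDiff ℝ ∞ η ∧ HasCompactSupport η ∧
      tsupport η ⊆ Ioo a b ∧ ∫ z in a..b, η z = 1 := by
    let B : ContDiffBump ((a + b) / 2 : ℝ) :=
      ⟨(b - a) / 8, (b - a) / 4, by linarith, by linarith⟩
    have hsub : tsupport (B.normed volume) ⊆ Ioo a b := by
      rw [B.tsupport_normed_eq, Real.closedBall_eq_Icc]
      intro z hz
      have hz1 := hz.1
      have hz2 := hz.2
      simp only [B] at hz1 hz2
      exact ⟨by linarith, by linarith⟩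
    refine ⟨B.normed volume, B.contDiff_normed, B.hasCompactSupport_normed, hsub, ?_⟩
    rw [intervalIntegral.integral_of_le hab.le, integral_Ioc_eq_integral_Ioo,
      setIntegral_eq_integral_of_forall_compl_eq_zero, B.integral_normed]
    intro x hx
    exact image_eq_zero_of_notMem_tsupport fun h => hx (hsub h)
  set c : ℂ := ∫ z in Ioo a b, ((η z : ℝ) : ℂ) * g z with hc
  refine ⟨c, ?_⟩
  have hcl : ∀ ψ : ℝ → ℝ, ContDiff ℝ ∞ ψ → HasCompactSupport ψ → tsupport ψ ⊆ Ioo a b →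
      ∃ l r, a < l ∧ r < b ∧ ∀ z, z ∉ Icc l r → ψ z = 0 := fun ψ _ h2 h3 => by
    by_cases hne : (tsupport ψ).Nonempty
    · have hcpt : IsCompact (tsupport ψ) := h2
      have hl := hcpt.sInf_mem hne
      have hr := hcpt.sSup_mem hne
      refine ⟨_, _, (h3 hl).1, (h3 hr).2, fun z hz => ?_⟩
      refine image_eq_zero_of_notMem_tsupport fun hz' => hz ?_
      exact ⟨csInf_le hcpt.bddBelow hz', le_csSup hcpt.bddAbove hz'⟩
    · refine ⟨(a + b) / 2, (a + b) / 2, by linarith, by linarith, fun z _ => ?_⟩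
      exact image_eq_zero_of_notMem_tsupport fun hz' => hne ⟨z, hz'⟩
  have hkey : ∀ ψ : ℝ → ℝ, ContDiff ℝ ∞ ψ → HasCompactSupport ψ → tsupport ψ ⊆ Ioo a b →
      ∫ z in Ioo a b, ((ψ z : ℝ) : ℂ) * (g z - c) = 0 := fun ψ h1 h2 h3 => by
    -- Subtracting `m * η` removes the mean of ψ, so the primitive of the difference is again a test
    -- function, and `hg0` applies to it.
    set m : ℝ := ∫ z in a..b, ψ z with hm
    set f : ℝ → ℝ := fun z => ψ z - m * η z with hf
    have hfc : ContDiff ℝ ∞ f := h1.sub (contDiff_const.mul hη)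
    set φ : ℝ → ℝ := fun z => ∫ t in a..z, f t with hφ
    have hφd : deriv φ = f := funext fun z => (hfc.continuous.deriv_integral f a z)
    have hφc : ContDiff ℝ ∞ φ := by
      refine contDiff_infty_iff_deriv.2 ⟨fun z => ?_, by rwa [hφd]⟩
      exact (hfc.continuous.integral_hasStrictDerivAt a z).hasDerivAt.differentiableAt
    obtain ⟨l1, r1, hl1, hr1, hz1⟩ := hcl ψ h1 h2 h3
    obtain ⟨l2, r2, hl2, hr2, hz2⟩ := hcl η hη hηs hηt
    have hsupp : tsupport φ ⊆ Icc (min l1 l2) (max r1 r2) := by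
      refine tsupport_integral_subset (lt_min hl1 hl2) (max_lt hr1 hr2) hfc.continuous (fun z hz => ?_) ?_
      · simp only [hf]
        rw [hz1 z fun h => hz ⟨(min_le_left _ _).trans h.1, h.2.trans (le_max_left _ _)⟩,
          hz2 z fun h => hz ⟨(min_le_right _ _).trans h.1, h.2.trans (le_max_right _ _)⟩]
        simp
      · simp only [hf]
        rw [intervalIntegral.integral_sub (h1.continuous.intervalIntegrable _ _)
          ((hη.continuous.const_mul m).intervalIntegrable _ _),
          intervalIntegral.integral_const_mul, hη1, ← hm]
        ring
    have h4 := hg0 φ hφc (isCompact_Icc.of_isClosed_subset (isClosed_tsupport _) hsupp)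
      (hsupp.trans (Icc_subset_Ioo (lt_min hl1 hl2) (max_lt hr1 hr2)))
    rw [hφd] at h4
    have e1 : ∀ z, ((f z : ℝ) : ℂ) * g z =
        ((ψ z : ℝ) : ℂ) * g z - (m : ℂ) * (((η z : ℝ) : ℂ) * g z) := fun z => by
      simp only [hf]; push_cast; ring
    simp only [e1] at h4
    rw [integral_sub (hmul hgi h1.continuous) ((hmul hgi hη.continuous).const_mul _),
      integral_const_mul, ← hc] at h4
    have h5 : ∫ z in Ioo a b, ((ψ z : ℝ) : ℂ) * c = m * c := by
      rw [integral_mul_const, integral_complex_ofReal, hm,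
        intervalIntegral.integral_of_le hab.le, integral_Ioc_eq_integral_Ioo]
    have e2 : ∀ z, ((ψ z : ℝ) : ℂ) * (g z - c) = ((ψ z : ℝ) : ℂ) * g z - ((ψ z : ℝ) : ℂ) * c :=
      fun z => mul_sub _ _ _
    simp only [e2]
    rw [integral_sub (hmul hgi h1.continuous) (hmul (integrableOn_const (by simp)) h1.continuous),
      h5, h4]
  have hfin := isOpen_Ioo.ae_eq_zero_of_integral_contDiff_smul_eq_zero (μ := volume) (U := Ioo a b)
    (f := fun z => g z - c) ((hgi.sub (integrableOn_const (by simp))).locallyIntegrableOn) ?_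
  · rw [ae_restrict_iff' measurableSet_Ioo]
    filter_upwards [hfin] with z hz hz'
    have := hz hz'
    simp only [hg] at this
    linear_combination this
  · intro ψ h1 h2 h3
    rw [← hkey ψ h1 h2 h3, setIntegral_eq_integral_of_forall_compl_eq_zero]
    · simp only [Complex.real_smul]
    · intro x hx
      rw [image_eq_zero_of_notMem_tsupport fun h => hx (h3 h)]
      simp

/-! ### The semidiscrete Sobolev spaces -/

section Sobolev

open scoped ENNReal

variable {S : Slab} {M : ℕ}

instance instIsFiniteMeasureZMeas : IsFiniteMeasure (zMeas S) :=
  Measure.smul_finite _ ENNReal.ofReal_ne_top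

theorem ae_zMeas_iff {P : ℝ → Prop} :
    (∀ᵐ z ∂(zMeas S), P z) ↔ ∀ᵐ z ∂(volume.restrict (Ioo (-S.ξ) S.d)), P z :=
  ⟨ae_zMeas, fun h => Measure.ae_smul_measure h _⟩

theorem ae_mem_zIoo : ∀ᵐ z ∂(zMeas S), z ∈ Ioo (-S.ξ) S.d :=
  ae_zMeas_iff.2 (ae_restrict_mem measurableSet_Ioo)

theorem integral_zMeas {E : Type*} [NormedAddCommGroup E] [NormedSpace ℝ E] (f : ℝ → E) :
    ∫ z, f z ∂(zMeas S) = S.h ^ 2 • ∫ z in Ioo (-S.ξ) S.d, f z := by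
  rw [zMeas, integral_smul_measure, ENNReal.toReal_ofReal (by positivity)]

theorem integral_Ioo_eq {E : Type*} [NormedAddCommGroup E] [NormedSpace ℝ E] (f : ℝ → E) :
    ∫ z in Ioo (-S.ξ) S.d, f z = ∫ z in (-S.ξ)..S.d, f z := by
  rw [intervalIntegral.integral_of_le S.lt.le, integral_Ioc_eq_integral_Ioo]

theorem zIntegrable_iff {E : Type*} [NormedAddCommGroup E] {f : ℝ → E} :
    Integrable f (zMeas S) ↔ IntegrableOn f (Ioo (-S.ξ) S.d) :=
  integrable_smul_measure (by simpa using S.h_pos.ne') ENNReal.ofReal_ne_top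

theorem Lp_integrableOn (f : Lp ℂ 2 (zMeas S)) : IntegrableOn f (Ioo (-S.ξ) S.d) :=
  zIntegrable_iff.1 ((Lp.memLp f).integrable (by norm_num))

theorem Lp_intervalIntegrable (f : Lp ℂ 2 (zMeas S)) :
    IntervalIntegrable f volume (-S.ξ) S.d := by
  rw [intervalIntegrable_iff_integrableOn_Ioo_of_le S.lt.le]
  exact Lp_integrableOn f

theorem norm_sq_zLp (f : Lp ℂ 2 (zMeas S)) :
    ‖f‖ ^ 2 = S.h ^ 2 * ∫ z in (-S.ξ)..S.d, ‖f z‖ ^ 2 := by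
  rw [← integral_Ioo_eq, ← smul_eq_mul, ← integral_zMeas, ← real_inner_self_eq_norm_sq,
    L2.inner_def]
  simp

theorem sq_integrableOn (f : Lp ℂ 2 (zMeas S)) :
    IntegrableOn (fun z => ‖f z‖ ^ 2) (Ioo (-S.ξ) S.d) :=
  zIntegrable_iff.1 ((memLp_two_iff_integrable_sq_norm (Lp.aestronglyMeasurable f)).1 (Lp.memLp f))

theorem norm_primitive_le (f : Lp ℂ 2 (zMeas S)) {z : ℝ} (hz : z ∈ Icc (-S.ξ) S.d) :
    ‖∫ t in (-S.ξ)..z, f t‖ ≤ (S.h ^ 2)⁻¹ * Real.sqrt ((zMeas S).real univ) * ‖f‖ := by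
  have h1 : ∫ t in Ioo (-S.ξ) S.d, ‖f t‖ ≤
      (S.h ^ 2)⁻¹ * (Real.sqrt ((zMeas S).real univ) * ‖f‖) := by
    have h2 := integral_norm_le_mul_norm (zMeas S) f
    rw [integral_zMeas, smul_eq_mul] at h2
    rwa [inv_mul_eq_div, le_div_iff₀ (by have := S.h_pos; positivity), mul_comm]
  rw [mul_assoc]
  refine le_trans ?_ h1
  rw [intervalIntegral.integral_of_le hz.1, integral_Ioc_eq_integral_Ioo]
  refine (norm_integral_le_integral_norm _).trans ?_
  exact setIntegral_mono_set (Lp_integrableOn f).norm (ae_of_all _ fun _ => norm_nonneg _)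
    (Ioo_subset_Ioo_right hz.2).eventuallyLE

theorem memLp_of_continuous {φ : ℝ → ℝ} (hφ : Continuous φ) (p : ℝ≥0∞) :
    MemLp φ p (zMeas S) := by
  obtain ⟨C, hC⟩ := isCompact_Icc.exists_bound_of_continuousOn (s := Icc (-S.ξ) S.d)
    hφ.continuousOn
  refine MemLp.of_bound hφ.aestronglyMeasurable C ?_
  filter_upwards [ae_mem_zIoo] with z hz
  exact hC z (Ioo_subset_Icc_self hz)

/-- The functional `f ↦ ∫ φ f` on `L²(-ξ, d)`. -/
def zPair {φ : ℝ → ℝ} (hφ : Continuous φ) : Lp ℂ 2 (zMeas S) →L[ℝ] ℂ :=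
  ContinuousLinearMap.lpPairing (zMeas S) 2 2 (ContinuousLinearMap.lsmul ℝ ℝ)
    (memLp_of_continuous hφ 2).toLp

theorem zPair_apply {φ : ℝ → ℝ} (hφ : Continuous φ) (f : Lp ℂ 2 (zMeas S)) :
    zPair hφ f = (S.h ^ 2 : ℝ) * ∫ z in Ioo (-S.ξ) S.d, ((φ z : ℝ) : ℂ) * f z := by
  rw [zPair, ContinuousLinearMap.lpPairing_eq_integral, ← Complex.real_smul, ← integral_zMeas]
  refine integral_congr_ae ?_
  filter_upwards [(memLp_of_continuous hφ 2).coeFn_toLp (μ := zMeas S)] with z hz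
  rw [hz]
  exact Complex.real_smul

/-- Expressed through the bounded functionals `zPair`, the condition defines a closed set. The
factor h² in the measure cancels. -/
theorem isWeakDeriv_iff (u v : Lp ℂ 2 (zMeas S)) : IsWeakDeriv (-S.ξ) S.d u v ↔
    ∀ φ : ℝ → ℝ, ∀ (h : ContDiff ℝ ∞ φ), HasCompactSupport φ → tsupport φ ⊆ Ioo (-S.ξ) S.d →
      zPair (h.continuous_deriv (by simp)) u + zPair h.continuous v = 0 := by
  have h0 : ((S.h ^ 2 : ℝ) : ℂ) ≠ 0 := by
    exact_mod_cast (pow_pos S.h_pos 2).ne'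
  refine forall_congr' fun φ => ⟨fun H h h1 h2 => ?_, fun H h h1 h2 => ?_⟩
  · rw [zPair_apply, zPair_apply, H h h1 h2]
    ring
  · have := H h h1 h2
    rw [zPair_apply, zPair_apply, ← mul_add] at this
    exact eq_neg_of_add_eq_zero_left ((mul_eq_zero.1 this).resolve_left h0)

/-- The coordinate projections of `Amb`. -/
def coordL (S : Slab) (M n : ℕ) (a : Grid M × Fin (n + 1)) : Amb S M n →L[ℝ] Lp ℂ 2 (zMeas S) :=
  PiLp.proj 2 (fun _ : Grid M × Fin (n + 1) => Lp ℂ 2 (zMeas S)) a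

theorem coordL_apply {n : ℕ} (a : Grid M × Fin (n + 1)) (U : Amb S M n) : coordL S M n a U = U a :=
  rfl

theorem isClosed_Sob (n : ℕ) : IsClosed (Sob S M n : Set (Amb S M n)) := by
  have : (Sob S M n : Set (Amb S M n)) = ⋂ (g : Grid M) (r : Fin n) (φ : ℝ → ℝ)
      (h : ContDiff ℝ ∞ φ) (_ : HasCompactSupport φ) (_ : tsupport φ ⊆ Ioo (-S.ξ) S.d),
      {U | zPair (h.continuous_deriv (by simp)) (coordL S M n (g, r.castSucc) U) +
        zPair h.continuous (coordL S M n (g, r.succ) U) = 0} := by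
    ext U
    simp only [mem_iInter, mem_ofPred_eq]
    exact forall_congr' fun g => forall_congr' fun r => isWeakDeriv_iff _ _
  rw [this]
  refine isClosed_iInter fun g => isClosed_iInter fun r => isClosed_iInter fun φ =>
    isClosed_iInter fun h => isClosed_iInter fun _ => isClosed_iInter fun _ => ?_
  exact isClosed_eq (by fun_prop) continuous_const

instance instCompleteSob (n : ℕ) : CompleteSpace (Sob S M n) :=
  (isClosed_Sob n).completeSpace_coe

/-! ### Boundary values as bounded functionals -/

section Trace

variable {u v : Lp ℂ 2 (zMeas S)}

theorem exists_primitive (h : IsWeakDeriv (-S.ξ) S.d u v) :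
    ∃ c : ℂ, ∀ᵐ z ∂(zMeas S), u z = c + ∫ t in (-S.ξ)..z, v t := by
  obtain ⟨c, hc⟩ := h.ae_eq_primitive S.lt (Lp_integrableOn u) (Lp_integrableOn v)
  exact ⟨c, ae_zMeas_iff.2 hc⟩

theorem continuousOn_primitive (v : Lp ℂ 2 (zMeas S)) (c : ℂ) :
    ContinuousOn (fun z => c + ∫ t in (-S.ξ)..z, v t) (Icc (-S.ξ) S.d) := by
  have := intervalIntegral.continuousOn_primitive_interval' (Lp_intervalIntegrable v)
    left_mem_uIcc
  rw [uIcc_of_le S.lt.le] at this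
  exact continuousOn_const.add this

/-- Two continuous functions on a nondegenerate interval that agree almost everywhere agree at the
end points too, so the primitive is the only continuous representative. -/
theorem hasValueAt_iff {c : ℂ} (h : ∀ᵐ z ∂(zMeas S), u z = c + ∫ t in (-S.ξ)..z, v t) {x : ℝ}
    (hx : x ∈ Icc (-S.ξ) S.d) (e : ℂ) :
    HasValueAt S u x e ↔ e = c + ∫ t in (-S.ξ)..x, v t := by
  constructor
  · rintro ⟨g, g1, g2, rfl⟩
    have h1 : g =ᵐ[volume.restrict (Ioo (-S.ξ) S.d)] fun z => c + ∫ t in (-S.ξ)..z, v t :=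
      ae_zMeas_iff.1 (g2.symm.trans h)
    rw [Measure.restrict_congr_set Ioo_ae_eq_Icc] at h1
    exact Measure.eqOn_Icc_of_ae_eq volume S.lt.ne h1 g1 (continuousOn_primitive v c) hx
  · rintro rfl
    exact ⟨_, continuousOn_primitive v c, h, rfl⟩

/-- Integrating `v` by parts against z - y cancels the double integral contained in ∫u. The choice y
= d isolates the value at -ξ, and y = -ξ isolates the value at d; this makes both boundary values
bounded functionals of the pair (u, v). -/
theorem zPair_one_add {c : ℂ} (h : ∀ᵐ z ∂(zMeas S), u z = c + ∫ t in (-S.ξ)..z, v t) (y : ℝ) :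
    zPair (φ := fun _ => 1) continuous_const u +
      zPair (φ := fun z => z - y) (continuous_id.sub continuous_const) v =
    (S.h ^ 2 : ℝ) * ((S.d + S.ξ : ℝ) * c + (S.d - y : ℝ) * ∫ t in (-S.ξ)..S.d, v t) := by
  have hi := integral_deriv_mul_primitive (φ := fun z => z - y) (by fun_prop)
    (Lp_intervalIntegrable v)
  have hd : deriv (fun z : ℝ => z - y) = fun _ => 1 := by
    funext z; simp
  have hv := Lp_intervalIntegrable v
  have h1 : ∫ z in Ioo (-S.ξ) S.d, ((1 : ℝ) : ℂ) * u z =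
      (S.d + S.ξ : ℝ) * c + ∫ z in (-S.ξ)..S.d, ∫ t in (-S.ξ)..z, v t := by
    have h2 : ∫ z in Ioo (-S.ξ) S.d, ((1 : ℝ) : ℂ) * u z =
        ∫ z in Ioo (-S.ξ) S.d, (c + ∫ t in (-S.ξ)..z, v t) := by
      refine integral_congr_ae ?_
      filter_upwards [ae_zMeas_iff.1 h] with z hz
      rw [hz]; simp
    rw [h2, integral_Ioo_eq, intervalIntegral.integral_add (by simp)]
    · simp
    · have := intervalIntegral.continuousOn_primitive_interval' hv left_mem_uIcc
      exact this.intervalIntegrable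
  rw [hd] at hi
  simp only [Complex.ofReal_one, one_mul] at hi
  rw [zPair_apply, zPair_apply, h1, hi, integral_Ioo_eq (fun z => ((z - y : ℝ) : ℂ) * v z)]
  ring

theorem hasValueAt_left_iff (h : IsWeakDeriv (-S.ξ) S.d u v) : HasValueAt S u (-S.ξ) 0 ↔
    zPair (φ := fun _ => 1) continuous_const u +
      zPair (φ := fun z => z - S.d) (continuous_id.sub continuous_const) v = 0 := by
  obtain ⟨c, hc⟩ := exists_primitive h
  have h1 : ((S.h ^ 2 : ℝ) : ℂ) ≠ 0 := by exact_mod_cast (pow_pos S.h_pos 2).ne'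
  have h2 : ((S.d + S.ξ : ℝ) : ℂ) ≠ 0 := by
    have := S.lt
    exact_mod_cast (by linarith : (0 : ℝ) < S.d + S.ξ).ne'
  rw [hasValueAt_iff hc (left_mem_Icc.2 S.lt.le), zPair_one_add hc]
  simp only [intervalIntegral.integral_same, add_zero, sub_self, Complex.ofReal_zero, zero_mul,
    mul_eq_zero, h1, h2, false_or]
  exact eq_comm

theorem hasValueAt_right_iff (h : IsWeakDeriv (-S.ξ) S.d u v) : HasValueAt S u S.d 0 ↔
    zPair (φ := fun _ => 1) continuous_const u +
      zPair (φ := fun z => z - -S.ξ) (continuous_id.sub continuous_const) v = 0 := by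
  obtain ⟨c, hc⟩ := exists_primitive h
  have h1 : ((S.h ^ 2 : ℝ) : ℂ) ≠ 0 := by exact_mod_cast (pow_pos S.h_pos 2).ne'
  have h2 : ((S.d + S.ξ : ℝ) : ℂ) ≠ 0 := by
    have := S.lt
    exact_mod_cast (by linarith : (0 : ℝ) < S.d + S.ξ).ne'
  rw [hasValueAt_iff hc (right_mem_Icc.2 S.lt.le), zPair_one_add hc, sub_neg_eq_add, ← mul_add]
  simp only [mul_eq_zero, h1, h2, false_or]
  exact eq_comm

theorem primitive_of_hasValueAt (h : IsWeakDeriv (-S.ξ) S.d u v)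
    (h0 : HasValueAt S u (-S.ξ) 0) : ∀ᵐ z ∂(zMeas S), u z = ∫ t in (-S.ξ)..z, v t := by
  obtain ⟨c, hc⟩ := exists_primitive h
  have h1 := (hasValueAt_iff hc (left_mem_Icc.2 S.lt.le) 0).1 h0
  filter_upwards [hc] with z hz
  rw [hz]
  simp only [intervalIntegral.integral_same, add_zero] at h1
  rw [← h1, zero_add]

/-- A constant in the embedding of `H¹` into the continuous functions. -/
def sobConst (S : Slab) : ℝ :=
  ((S.h ^ 2) * (S.d + S.ξ))⁻¹ * (‖zPair (S := S) (φ := fun _ => 1) continuous_const‖ +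
    ‖zPair (S := S) (φ := fun z => z - S.d) (continuous_id.sub continuous_const)‖) +
    (S.h ^ 2)⁻¹ * Real.sqrt ((zMeas S).real univ)

theorem sobConst_nonneg : 0 ≤ sobConst S := by
  have h1 := S.h_pos
  have h2 : 0 < S.d + S.ξ := by linarith [S.lt]
  unfold sobConst
  positivity

/-- The constant of integration is controlled by `zPair_one_add` with y = d, and the primitive by
the Cauchy–Schwarz inequality. -/
theorem norm_le_of_isWeakDeriv (h : IsWeakDeriv (-S.ξ) S.d u v) {B : ℝ} (hu : ‖u‖ ≤ B)
    (hv : ‖v‖ ≤ B) : ∀ᵐ z ∂(zMeas S), ‖u z‖ ≤ sobConst S * B := by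
  obtain ⟨c, hc⟩ := exists_primitive h
  have h1 := S.h_pos
  have h2 : 0 < S.d + S.ξ := by linarith [S.lt]
  have hB : 0 ≤ B := (norm_nonneg u).trans hu
  have hcb : ‖c‖ ≤ ((S.h ^ 2) * (S.d + S.ξ))⁻¹ *
      (‖zPair (S := S) (φ := fun _ => 1) continuous_const‖ +
      ‖zPair (S := S) (φ := fun z => z - S.d) (continuous_id.sub continuous_const)‖) * B := by
    have h3 := congrArg norm (zPair_one_add hc S.d)
    simp only [sub_self, Complex.ofReal_zero, zero_mul, add_zero, norm_mul, Complex.norm_real,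
      Real.norm_eq_abs] at h3
    rw [abs_of_pos (by positivity), abs_of_pos h2, ← mul_assoc] at h3
    rw [mul_assoc, inv_mul_eq_div, le_div_iff₀ (by positivity), mul_comm, ← h3, add_mul]
    exact (norm_add_le _ _).trans (add_le_add (ContinuousLinearMap.le_opNorm_of_le _ hu)
      (ContinuousLinearMap.le_opNorm_of_le _ hv))
  filter_upwards [hc, ae_mem_zIoo] with z hz hz'
  rw [hz, sobConst, add_mul]
  refine (norm_add_le _ _).trans (add_le_add hcb ?_)
  refine (norm_primitive_le v (Ioo_subset_Icc_self hz')).trans ?_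
  gcongr

end Trace

theorem norm_coord_le {n : ℕ} (U : Amb S M n) (a : Grid M × Fin (n + 1)) : ‖U a‖ ≤ ‖U‖ :=
  PiLp.norm_apply_le U a

/-- Within the closed space `Sob` the boundary conditions are the vanishing of bounded functionals.
Membership in `Sob` is used first, since the value of a function at an end point is expressed
through its weak derivative. -/
theorem isClosed_Sob0 : IsClosed (Sob0 S M : Set (Amb S M 2)) := by
  have : (Sob0 S M : Set (Amb S M 2)) = (Sob S M 2 : Set (Amb S M 2)) ∩
      ((⋂ (i : Fin M) (j : Fin M),
        ({U | zPair (φ := fun _ => 1) continuous_const (coordL S M 2 ((mid i, mid j), 0) U) +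
            zPair (φ := fun z => z - S.d) (continuous_id.sub continuous_const)
              (coordL S M 2 ((mid i, mid j), 1) U) = 0} ∩
        {U | zPair (φ := fun _ => 1) continuous_const (coordL S M 2 ((mid i, mid j), 1) U) +
            zPair (φ := fun z => z - S.d) (continuous_id.sub continuous_const)
              (coordL S M 2 ((mid i, mid j), 2) U) = 0}) ∩
        {U | zPair (φ := fun _ => 1) continuous_const (coordL S M 2 ((mid i, mid j), 0) U) +
            zPair (φ := fun z => z - -S.ξ) (continuous_id.sub continuous_const)
              (coordL S M 2 ((mid i, mid j), 1) U) = 0}) ∩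
      ⋂ (g : Grid M) (_ : OnLateral g), {U | coordL S M 2 (g, 0) U = 0}) := by
    ext U
    simp only [mem_inter_iff, mem_iInter, mem_ofPred_eq]
    refine and_congr_right fun hU => and_congr ?_ Iff.rfl
    refine forall_congr' fun i => forall_congr' fun j => ?_
    have h0 : IsWeakDeriv (-S.ξ) S.d (U ((mid i, mid j), 0)) (U ((mid i, mid j), 1)) :=
      hU (mid i, mid j) 0
    have h1 : IsWeakDeriv (-S.ξ) S.d (U ((mid i, mid j), 1)) (U ((mid i, mid j), 2)) :=
      hU (mid i, mid j) 1
    simp only [coordL_apply]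
    rw [← hasValueAt_left_iff h0, ← hasValueAt_left_iff h1, ← hasValueAt_right_iff h0, and_assoc]
    rfl
  rw [this]
  refine (isClosed_Sob 2).inter (IsClosed.inter ?_ ?_)
  · refine isClosed_iInter fun i => isClosed_iInter fun j => (IsClosed.inter ?_ ?_).inter ?_ <;>
      exact isClosed_eq (by fun_prop) continuous_const
  · refine isClosed_iInter fun g => isClosed_iInter fun _ => ?_
    exact isClosed_eq (by fun_prop) continuous_const

instance instCompleteSob0 : CompleteSpace (Sob0 S M) :=
  isClosed_Sob0.completeSpace_coe

/-- On the lateral boundary all derivatives vanish. -/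
theorem Sob0.lateral (U : Sob0 S M) {g : Grid M} (hg : OnLateral g) (r : Fin 3) :
    (U : Amb S M 2) (g, r) = 0 := by
  -- A weak derivative of zero is orthogonal to all test functions, hence zero.
  have step : ∀ {u v : Lp ℂ 2 (zMeas S)}, IsWeakDeriv (-S.ξ) S.d u v → u = 0 → v = 0 := by
    rintro _ v h rfl
    rw [isWeakDeriv_iff] at h
    have h0 : ((S.h ^ 2 : ℝ) : ℂ) ≠ 0 := by exact_mod_cast (pow_pos S.h_pos 2).ne'
    have hv := isOpen_Ioo.ae_eq_zero_of_integral_contDiff_smul_eq_zero (μ := volume)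
      (Lp_integrableOn v).locallyIntegrableOn fun φ h1 h2 h3 => by
        have h4 := h φ h1 h2 h3
        rw [map_zero, zero_add, zPair_apply] at h4
        rw [← (mul_eq_zero.1 h4).resolve_left h0,
          setIntegral_eq_integral_of_forall_compl_eq_zero]
        · simp only [Complex.real_smul]
        · intro x hx
          rw [image_eq_zero_of_notMem_tsupport fun h => hx (h3 h)]
          simp
    refine Lp.ext ?_
    filter_upwards [ae_zMeas_iff.2 ((ae_restrict_iff' measurableSet_Ioo).2 hv),
      Lp.coeFn_zero ℂ 2 (zMeas S)] with z h1 h2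
    rw [h1, h2, Pi.zero_apply]
  have h1 : (U : Amb S M 2) (g, 1) = 0 := step (U.2.1 g 0) (U.2.2.2 g hg)
  have h2 : (U : Amb S M 2) (g, 2) = 0 := step (U.2.1 g 1) h1
  fin_cases r
  · exact U.2.2.2 g hg
  · exact h1
  · exact h2

end Sobolev

/-! ### Weighted estimates -/

section Weight

open scoped ENNReal

variable {S : Slab} {M : ℕ}

/-- The square root of the weight `e^{2λd} e^{-2λz}`. -/
def wt (S : Slab) (lam z : ℝ) : ℝ := Real.exp (lam * (S.d - z))

theorem wt_pos (lam z : ℝ) : 0 < wt S lam z := Real.exp_pos _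

theorem continuous_wt (lam : ℝ) : Continuous (wt S lam) := by unfold wt; fun_prop

/-- The normalization by e^{λd} is chosen for this bound: the weight can be dropped from lower
estimates, so their constants do not depend on λ. -/
theorem one_le_wt {lam z : ℝ} (hl : 0 ≤ lam) (hz : z ≤ S.d) : 1 ≤ wt S lam z :=
  Real.one_le_exp (mul_nonneg hl (by linarith))

theorem wt_le {lam z : ℝ} (hl : 0 ≤ lam) (hz : -S.ξ ≤ z) :
    wt S lam z ≤ Real.exp (lam * (S.d + S.ξ)) :=
  Real.exp_le_exp.2 (mul_le_mul_of_nonneg_left (by linarith) hl)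

theorem wt_sq (lam z : ℝ) :
    wt S lam z ^ 2 = Real.exp (2 * lam * S.d) * Real.exp (-2 * lam * z) := by
  rw [wt, ← Real.exp_nat_mul, ← Real.exp_add]
  congr 1
  push_cast
  ring

theorem wt_two_mul (lam z : ℝ) : wt S (2 * lam) z = wt S lam z * wt S lam z := by
  rw [wt, wt, ← Real.exp_add]
  congr 1
  ring

/-- Multiplication by `wt`. -/
def wmul (S : Slab) (lam : ℝ) : Lp ℂ 2 (zMeas S) →L[ℝ] Lp ℂ 2 (zMeas S) :=
  mulLp (memLp_of_continuous (S := S) (continuous_wt (S := S) lam) ∞)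

theorem wmul_ae (lam : ℝ) (f : Lp ℂ 2 (zMeas S)) :
    wmul S lam f =ᵐ[zMeas S] fun z => wt S lam z • f z := mulLp_ae _ f

theorem norm_wmul_ae (lam : ℝ) (f : Lp ℂ 2 (zMeas S)) :
    ∀ᵐ z ∂(zMeas S), ‖wmul S lam f z‖ = wt S lam z * ‖f z‖ := by
  filter_upwards [wmul_ae lam f] with z hz
  rw [hz, norm_smul, Real.norm_of_nonneg (wt_pos _ _).le]

theorem wmul_two_mul (lam : ℝ) (f : Lp ℂ 2 (zMeas S)) :
    wmul S (2 * lam) f = wmul S lam (wmul S lam f) := by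
  refine Lp.ext ?_
  filter_upwards [wmul_ae (2 * lam) f, wmul_ae lam f, wmul_ae lam (wmul S lam f)] with z h1 h2 h3
  rw [h1, h3, h2, smul_smul, wt_two_mul]

theorem inner_wmul (lam : ℝ) (f g : Lp ℂ 2 (zMeas S)) :
    ⟪wmul S lam f, g⟫_ℝ = ⟪f, wmul S lam g⟫_ℝ := by
  rw [L2.inner_def, L2.inner_def]
  refine integral_congr_ae ?_
  filter_upwards [wmul_ae lam f, wmul_ae lam g] with z h1 h2
  rw [h1, h2, real_inner_smul_left, real_inner_smul_right]

theorem norm_le_norm_wmul {lam : ℝ} (hl : 0 ≤ lam) (f : Lp ℂ 2 (zMeas S)) :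
    ‖f‖ ≤ ‖wmul S lam f‖ := by
  refine Lp.norm_le_norm_of_ae_le ?_
  filter_upwards [norm_wmul_ae lam f, ae_mem_zIoo] with z h1 h2
  rw [h1]
  exact le_mul_of_one_le_left (norm_nonneg _) (one_le_wt hl h2.2.le)

theorem norm_wmul_le {lam : ℝ} (hl : 0 ≤ lam) (f : Lp ℂ 2 (zMeas S)) :
    ‖wmul S lam f‖ ≤ Real.exp (lam * (S.d + S.ξ)) * ‖f‖ := by
  refine Lp.norm_le_mul_norm_of_ae_le_mul ?_
  filter_upwards [norm_wmul_ae lam f, ae_mem_zIoo] with z h1 h2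
  rw [h1]
  exact mul_le_mul_of_nonneg_right (wt_le hl h2.1.le) (norm_nonneg _)

theorem norm_wmul_sq (lam : ℝ) (f : Lp ℂ 2 (zMeas S)) :
    ‖wmul S lam f‖ ^ 2 = Real.exp (2 * lam * S.d) *
      (S.h ^ 2 * ∫ z in (-S.ξ)..S.d, ‖f z‖ ^ 2 * Real.exp (-2 * lam * z)) := by
  rw [norm_sq_zLp, ← integral_Ioo_eq, ← integral_Ioo_eq, mul_left_comm]
  refine congrArg (S.h ^ 2 * ·) ?_
  rw [← integral_const_mul]
  refine integral_congr_ae ?_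
  filter_upwards [ae_zMeas_iff.1 (norm_wmul_ae lam f)] with z hz
  rw [hz, mul_pow, wt_sq]
  ring

theorem norm_le_of_zBound {f : Lp ℂ 2 (zMeas S)} {C : ℝ} (hC : 0 ≤ C)
    (h : ∀ᵐ z ∂(zMeas S), ‖f z‖ ≤ C) : ‖f‖ ≤ S.h * Real.sqrt (S.d + S.ξ) * C := by
  have hl : 0 ≤ S.d + S.ξ := by linarith [S.lt]
  have h1 : ‖f‖ ^ 2 ≤ (S.h * Real.sqrt (S.d + S.ξ) * C) ^ 2 := by
    rw [norm_sq_zLp, mul_pow, mul_pow, Real.sq_sqrt hl, mul_assoc]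
    refine mul_le_mul_of_nonneg_left ?_ (sq_nonneg _)
    rw [← integral_Ioo_eq]
    calc ∫ z in Ioo (-S.ξ) S.d, ‖f z‖ ^ 2 ≤ ∫ _ in Ioo (-S.ξ) S.d, C ^ 2 := by
          refine integral_mono_ae (sq_integrableOn f) (integrable_const _) ?_
          filter_upwards [ae_zMeas_iff.1 h] with z hz
          exact pow_le_pow_left₀ (norm_nonneg _) hz 2
      _ = (S.d + S.ξ) * C ^ 2 := by
          rw [integral_Ioo_eq]; simp
  have := S.h_pos
  exact (sq_le_sq₀ (norm_nonneg _) (by positivity)).1 h1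

theorem integral_exp_le {c a z d : ℝ} (hc : 0 < c) :
    ∫ t in a..z, Real.exp (c * (t - d)) ≤ Real.exp (c * (z - d)) / c := by
  have h : ∀ t ∈ uIcc a z, HasDerivAt (fun t => Real.exp (c * (t - d)) / c)
      (Real.exp (c * (t - d))) t := fun t _ => by
    have h1 : HasDerivAt (fun t : ℝ => c * (t - d)) c t := by
      simpa using ((hasDerivAt_id t).sub_const d).const_mul c
    have := h1.exp.div_const c
    rwa [mul_div_assoc, div_self hc.ne', mul_one] at this
  rw [intervalIntegral.integral_eq_sub_of_hasDerivAt h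
    (Continuous.intervalIntegrable (by fun_prop) _ _)]
  have : 0 < Real.exp (c * (a - d)) / c := by positivity
  linarith

/-- The gain in the weighted bound for a primitive. -/
def gain (S : Slab) (lam : ℝ) : ℝ := (S.h * Real.sqrt (2 * lam))⁻¹

theorem gain_nonneg (lam : ℝ) : 0 ≤ gain S lam := by
  have := S.h_pos
  unfold gain
  positivity

theorem gain_sq {lam : ℝ} (hl : 0 < lam) : gain S lam ^ 2 = (S.h ^ 2 * (2 * lam))⁻¹ := by
  rw [gain, inv_pow, mul_pow, Real.sq_sqrt (by positivity)]

/-- Apply Cauchy–Schwarz to f = w⁻¹ · (w f). The integral of w⁻² over (-ξ, z) is at most w(z)⁻² /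
(2λ), because w⁻² grows exponentially, and the factor w(z)⁻² is compensated by the weight on the
left. The factor h in `gain` comes from the h² in the measure. -/
theorem wt_mul_norm_primitive_le {lam : ℝ} (hl : 0 < lam) (f : Lp ℂ 2 (zMeas S)) {z : ℝ}
    (hz : z ∈ Ioo (-S.ξ) S.d) :
    wt S lam z * ‖∫ t in (-S.ξ)..z, f t‖ ≤ gain S lam * ‖wmul S lam f‖ := by
  have hh := S.h_pos
  have hsub : Ioo (-S.ξ) z ⊆ Ioo (-S.ξ) S.d := Ioo_subset_Ioo_right hz.2.le
  set A : ℝ := ∫ t in Ioo (-S.ξ) z, ‖f t‖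
  have hA0 : 0 ≤ A := integral_nonneg fun _ => norm_nonneg _
  have hA : ‖∫ t in (-S.ξ)..z, f t‖ ≤ A := by
    rw [intervalIntegral.integral_of_le hz.1.le, integral_Ioc_eq_integral_Ioo]
    exact norm_integral_le_integral_norm _
  set E : ℝ → ℝ := fun t => Real.exp (lam * (t - S.d))
  have hEw : ∀ t, E t * wt S lam t = 1 := fun t => by
    simp only [E, wt, ← Real.exp_add]
    rw [← Real.exp_zero]; congr 1; ring
  have hE : MemLp E 2 (volume.restrict (Ioo (-S.ξ) z)) := by
    have h1 : Continuous E := by fun_prop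
    refine (memLp_two_iff_integrable_sq h1.aestronglyMeasurable).2 ?_
    exact ((h1.pow 2).integrableOn_Icc).mono_set Ioo_subset_Icc_self
  have hG0 : AEStronglyMeasurable (fun t => wt S lam t * ‖f t‖)
      (volume.restrict (Ioo (-S.ξ) S.d)) :=
    (continuous_wt lam).aestronglyMeasurable.mul (Lp_integrableOn f).norm.1
  have hGsq : IntegrableOn (fun t => (wt S lam t * ‖f t‖) ^ 2) (Ioo (-S.ξ) S.d) := by
    refine (sq_integrableOn (wmul S lam f)).congr ?_
    filter_upwards [ae_zMeas_iff.1 (norm_wmul_ae lam f)] with t ht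
    rw [ht]
  have hG : MemLp (fun t => wt S lam t * ‖f t‖) 2 (volume.restrict (Ioo (-S.ξ) z)) :=
    ((memLp_two_iff_integrable_sq hG0).2 hGsq).mono_measure (Measure.restrict_mono hsub le_rfl)
  have hcs := integral_mul_le_Lp_mul_Lq_of_nonneg (μ := volume.restrict (Ioo (-S.ξ) z))
    (p := 2) (q := 2) (Real.HolderConjugate.two_two) (ae_of_all _ fun t => (Real.exp_pos _).le)
    (ae_of_all _ fun t => mul_nonneg (wt_pos _ _).le (norm_nonneg _))
    (by simpa using hE) (by simpa using hG)
  have e1 : ∫ t in Ioo (-S.ξ) z, E t * (wt S lam t * ‖f t‖) = A := by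
    refine integral_congr_ae (ae_of_all _ fun t => ?_)
    simp only
    rw [← mul_assoc, hEw, one_mul]
  rw [e1] at hcs
  simp only [Real.rpow_two, ← Real.sqrt_eq_rpow] at hcs
  have e2 : ∫ t in Ioo (-S.ξ) z, E t ^ 2 ≤ Real.exp (2 * lam * (z - S.d)) / (2 * lam) := by
    rw [← integral_Ioc_eq_integral_Ioo, ← intervalIntegral.integral_of_le hz.1.le]
    refine le_of_eq_of_le ?_ (integral_exp_le (a := -S.ξ) (by positivity))
    refine intervalIntegral.integral_congr fun t _ => ?_
    simp only [E, ← Real.exp_nat_mul]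
    congr 1; push_cast; ring
  have e3 : ∫ t in Ioo (-S.ξ) z, (wt S lam t * ‖f t‖) ^ 2 ≤ (S.h ^ 2)⁻¹ * ‖wmul S lam f‖ ^ 2 := by
    rw [norm_sq_zLp, inv_mul_cancel_left₀ (by positivity), ← integral_Ioo_eq]
    refine (setIntegral_mono_set hGsq (ae_of_all _ fun _ => sq_nonneg _) hsub.eventuallyLE).trans ?_
    refine le_of_eq (integral_congr_ae ?_)
    filter_upwards [ae_zMeas_iff.1 (norm_wmul_ae lam f)] with t ht
    rw [ht]
  have h3 : A ^ 2 ≤ Real.exp (2 * lam * (z - S.d)) / (2 * lam) *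
      ((S.h ^ 2)⁻¹ * ‖wmul S lam f‖ ^ 2) := by
    calc A ^ 2 ≤ (Real.sqrt (∫ t in Ioo (-S.ξ) z, E t ^ 2) *
          Real.sqrt (∫ t in Ioo (-S.ξ) z, (wt S lam t * ‖f t‖) ^ 2)) ^ 2 :=
          pow_le_pow_left₀ hA0 hcs 2
      _ = (∫ t in Ioo (-S.ξ) z, E t ^ 2) * ∫ t in Ioo (-S.ξ) z, (wt S lam t * ‖f t‖) ^ 2 := by
          rw [mul_pow, Real.sq_sqrt (integral_nonneg fun _ => sq_nonneg _),
            Real.sq_sqrt (integral_nonneg fun _ => sq_nonneg _)]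
      _ ≤ _ := mul_le_mul e2 e3 (integral_nonneg fun _ => sq_nonneg _) (by positivity)
  have h4 : (wt S lam z * A) ^ 2 ≤ (gain S lam * ‖wmul S lam f‖) ^ 2 := by
    have h5 : wt S lam z ^ 2 * Real.exp (2 * lam * (z - S.d)) = 1 := by
      rw [wt, ← Real.exp_nat_mul, ← Real.exp_add, ← Real.exp_zero]
      congr 1; push_cast; ring
    rw [mul_pow, mul_pow, gain_sq hl]
    calc wt S lam z ^ 2 * A ^ 2 ≤ wt S lam z ^ 2 * (Real.exp (2 * lam * (z - S.d)) / (2 * lam) *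
          ((S.h ^ 2)⁻¹ * ‖wmul S lam f‖ ^ 2)) := by gcongr
      _ = (wt S lam z ^ 2 * Real.exp (2 * lam * (z - S.d))) *
          ((S.h ^ 2 * (2 * lam))⁻¹ * ‖wmul S lam f‖ ^ 2) := by
          rw [mul_inv]; ring
      _ = _ := by rw [h5, one_mul]
  refine le_trans (mul_le_mul_of_nonneg_left hA (wt_pos _ _).le) ?_
  exact (sq_le_sq₀ (mul_nonneg (wt_pos _ _).le hA0)
    (mul_nonneg (gain_nonneg _) (norm_nonneg _))).1 h4

/-- Integrating |f| ≤ B w⁻¹ gives at most B w(z)⁻¹ / λ. Starting from a pointwise bound, the second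
integration thus gains a full power of λ. -/
theorem wt_mul_norm_primitive_le_of_bound {lam B : ℝ} (hl : 0 < lam) (f : Lp ℂ 2 (zMeas S))
    (hB : ∀ᵐ z ∂(zMeas S), wt S lam z * ‖f z‖ ≤ B) {z : ℝ} (hz : z ∈ Ioo (-S.ξ) S.d) :
    wt S lam z * ‖∫ t in (-S.ξ)..z, f t‖ ≤ B / lam := by
  have hB0 : 0 ≤ B := by
    have hne : NeBot (ae (volume.restrict (Ioo (-S.ξ) S.d))) := by
      rw [ae_neBot, Ne, Measure.restrict_eq_zero, Real.volume_Ioo]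
      simpa using (by linarith [S.lt] : 0 < S.d + S.ξ)
    obtain ⟨t, ht⟩ := (ae_zMeas_iff.1 hB).exists
    exact (mul_nonneg (wt_pos _ _).le (norm_nonneg _)).trans ht
  have hsub : Ioo (-S.ξ) z ⊆ Ioo (-S.ξ) S.d := Ioo_subset_Ioo_right hz.2.le
  have h1 : ‖∫ t in (-S.ξ)..z, f t‖ ≤ ∫ t in (-S.ξ)..z, B * Real.exp (lam * (t - S.d)) := by
    rw [intervalIntegral.integral_of_le hz.1.le, integral_Ioc_eq_integral_Ioo,
      intervalIntegral.integral_of_le hz.1.le, integral_Ioc_eq_integral_Ioo]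
    refine norm_integral_le_of_norm_le ?_ ?_
    · have : Continuous fun t => B * Real.exp (lam * (t - S.d)) := by fun_prop
      exact this.integrableOn_Icc.mono_set Ioo_subset_Icc_self
    · filter_upwards [ae_restrict_of_ae_restrict_of_subset hsub (ae_zMeas_iff.1 hB)] with t ht
      have h2 : Real.exp (lam * (t - S.d)) * wt S lam t = 1 := by
        rw [wt, ← Real.exp_add, ← Real.exp_zero]; congr 1; ring
      calc ‖f t‖ = Real.exp (lam * (t - S.d)) * (wt S lam t * ‖f t‖) := by
            rw [← mul_assoc, h2, one_mul]
        _ ≤ Real.exp (lam * (t - S.d)) * B := by gcongr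
        _ = _ := mul_comm _ _
  rw [intervalIntegral.integral_const_mul] at h1
  have h2 : wt S lam z * Real.exp (lam * (z - S.d)) = 1 := by
    rw [wt, ← Real.exp_add, ← Real.exp_zero]; congr 1; ring
  calc wt S lam z * ‖∫ t in (-S.ξ)..z, f t‖
      ≤ wt S lam z * (B * (Real.exp (lam * (z - S.d)) / lam)) :=
        mul_le_mul_of_nonneg_left (h1.trans (mul_le_mul_of_nonneg_left (integral_exp_le hl) hB0))
          (wt_pos _ _).le
    _ = (wt S lam z * Real.exp (lam * (z - S.d))) * (B / lam) := by ring
    _ = B / lam := by rw [h2, one_mul]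

theorem lateral_or_mid (g : Grid M) : OnLateral g ∨ ∃ i j : Fin M, g = (mid i, mid j) := by
  have h : ∀ x : Fin (M + 2), x = 0 ∨ x = Fin.last (M + 1) ∨ ∃ i : Fin M, x = mid i := fun x => by
    rcases Fin.eq_zero_or_eq_succ x with rfl | ⟨y, rfl⟩
    · exact Or.inl rfl
    · rcases Fin.eq_castSucc_or_eq_last y with ⟨i, rfl⟩ | rfl
      · exact Or.inr (Or.inr ⟨i, rfl⟩)
      · exact Or.inr (Or.inl (Fin.succ_last _))
  rcases h g.1 with h1 | h1 | ⟨i, hi⟩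
  · exact Or.inl (Or.inl h1)
  · exact Or.inl (Or.inr (Or.inl h1))
  · rcases h g.2 with h2 | h2 | ⟨j, hj⟩
    · exact Or.inl (Or.inr (Or.inr (Or.inl h2)))
    · exact Or.inl (Or.inr (Or.inr (Or.inr h2)))
    · exact Or.inr ⟨i, j, Prod.ext hi hj⟩

/-- At interior points the Cauchy data at z = -ξ vanish, so both lower derivatives are iterated
primitives of the second one. At lateral points all derivatives are zero. -/
theorem Sob0.weighted_bounds {lam : ℝ} (hl : 0 < lam) (s : Sob0 S M) (g : Grid M) :
    (∀ᵐ z ∂(zMeas S), wt S lam z * ‖(s : Amb S M 2) (g, 1) z‖ ≤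
      gain S lam * ‖wmul S lam ((s : Amb S M 2) (g, 2))‖) ∧
    ∀ᵐ z ∂(zMeas S), wt S lam z * ‖(s : Amb S M 2) (g, 0) z‖ ≤
      gain S lam * ‖wmul S lam ((s : Amb S M 2) (g, 2))‖ / lam := by
  rcases lateral_or_mid g with hg | ⟨i, j, rfl⟩
  · have h0 : ∀ r : Fin 3, ∀ᵐ z ∂(zMeas S), (s : Amb S M 2) (g, r) z = 0 := fun r => by
      rw [Sob0.lateral s hg r]
      exact Lp.coeFn_zero ℂ 2 (zMeas S)
    rw [Sob0.lateral s hg 2]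
    constructor
    · filter_upwards [h0 1] with z hz
      rw [hz]; simp
    · filter_upwards [h0 0] with z hz
      rw [hz]; simp
  · have h1 : ∀ᵐ z ∂(zMeas S), (s : Amb S M 2) ((mid i, mid j), 1) z =
        ∫ t in (-S.ξ)..z, (s : Amb S M 2) ((mid i, mid j), 2) t :=
      primitive_of_hasValueAt (s.2.1 (mid i, mid j) 1) (s.2.2.1 i j).2.1
    have h0 : ∀ᵐ z ∂(zMeas S), (s : Amb S M 2) ((mid i, mid j), 0) z =
        ∫ t in (-S.ξ)..z, (s : Amb S M 2) ((mid i, mid j), 1) t :=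
      primitive_of_hasValueAt (s.2.1 (mid i, mid j) 0) (s.2.2.1 i j).1
    have hb : ∀ᵐ z ∂(zMeas S), wt S lam z * ‖(s : Amb S M 2) ((mid i, mid j), 1) z‖ ≤
        gain S lam * ‖wmul S lam ((s : Amb S M 2) ((mid i, mid j), 2))‖ := by
      filter_upwards [h1, ae_mem_zIoo] with z h2 h3
      rw [h2]
      exact wt_mul_norm_primitive_le hl _ h3
    refine ⟨hb, ?_⟩
    filter_upwards [h0, ae_mem_zIoo] with z h2 h3
    rw [h2]
    exact wt_mul_norm_primitive_le_of_bound hl _ hb h3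

end Weight

/-! ### Difference operators with values in `L²` and the Carleman estimate -/

section Operators

open scoped ENNReal

variable {S : Slab} {M : ℕ}

/-- Families of functions in `L²(-ξ, d)`, indexed by the interior grid points. -/
abbrev YSp (S : Slab) (M : ℕ) : Type :=
  PiLp 2 (fun _ : Fin M × Fin M => Lp ℂ 2 (zMeas S))

section ToY

variable {E : Type*} [NormedAddCommGroup E] [NormedSpace ℝ E]

/-- The operator with the given components. -/
def toY (f : Fin M × Fin M → E →L[ℝ] Lp ℂ 2 (zMeas S)) : E →L[ℝ] YSp S M :=
  (PiLp.continuousLinearEquiv 2 ℝ (fun _ : Fin M × Fin M => Lp ℂ 2 (zMeas S))).symm ∘L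
    ContinuousLinearMap.pi f

@[simp]
theorem toY_apply (f : Fin M × Fin M → E →L[ℝ] Lp ℂ 2 (zMeas S)) (x : E) (a : Fin M × Fin M) :
    toY f x a = f a x := rfl

end ToY

theorem norm_sq_Y (y : YSp S M) : ‖y‖ ^ 2 = ∑ a, ‖y a‖ ^ 2 := PiLp.norm_sq_eq_of_L2 _ y

theorem norm_Y_le_sum (y : YSp S M) : ‖y‖ ≤ ∑ a, ‖y a‖ := by
  refine (sq_le_sq₀ (norm_nonneg _) (Finset.sum_nonneg fun _ _ => norm_nonneg _)).1 ?_
  rw [norm_sq_Y]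
  exact Finset.sum_sq_le_sq_sum_of_nonneg fun _ _ => norm_nonneg _

theorem norm_Y_le_card {y : YSp S M} {C : ℝ} (h : ∀ a, ‖y a‖ ≤ C) : ‖y‖ ≤ (M * M : ℝ) * C := by
  refine (norm_Y_le_sum y).trans ((Finset.sum_le_sum fun a _ => h a).trans ?_)
  simp

/-- Multiplication by `wt` of all components. -/
def wmulY (S : Slab) (M : ℕ) (lam : ℝ) : YSp S M →L[ℝ] YSp S M :=
  toY fun a => wmul S lam ∘L PiLp.proj 2 (fun _ : Fin M × Fin M => Lp ℂ 2 (zMeas S)) a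

@[simp]
theorem wmulY_apply (lam : ℝ) (y : YSp S M) (a : Fin M × Fin M) :
    wmulY S M lam y a = wmul S lam (y a) := rfl

theorem norm_wmulY_le {lam : ℝ} (hl : 0 ≤ lam) (y : YSp S M) :
    ‖wmulY S M lam y‖ ≤ Real.exp (lam * (S.d + S.ξ)) * ‖y‖ := by
  refine (sq_le_sq₀ (norm_nonneg _) (by positivity)).1 ?_
  rw [mul_pow, norm_sq_Y, norm_sq_Y, Finset.mul_sum]
  refine Finset.sum_le_sum fun a _ => ?_
  rw [← mul_pow]
  exact pow_le_pow_left₀ (norm_nonneg _) (norm_wmul_le hl _) 2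

/-- Both weights are moved onto the second argument. When that argument is a product of two small
functions, each of them receives one weight and the first argument stays unweighted. -/
theorem inner_wmulY (lam : ℝ) (y y' : YSp S M) :
    ⟪wmulY S M lam y, wmulY S M lam y'⟫_ℝ = ⟪y, wmulY S M (2 * lam) y'⟫_ℝ := by
  rw [PiLp.inner_apply, PiLp.inner_apply]
  refine Finset.sum_congr rfl fun a _ => ?_
  rw [wmulY_apply, wmulY_apply, wmulY_apply, inner_wmul, wmul_two_mul]

theorem norm_wmulY_sq (lam : ℝ) (y : YSp S M) :
    ‖wmulY S M lam y‖ ^ 2 = Real.exp (2 * lam * S.d) * wInt S lam fun i j => y (i, j) := by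
  rw [norm_sq_Y, wInt, Fintype.sum_prod_type, Finset.mul_sum]
  refine Finset.sum_congr rfl fun i _ => ?_
  rw [Finset.mul_sum]
  exact Finset.sum_congr rfl fun j _ => norm_wmul_sq lam _

theorem wInt_congr {lam : ℝ} {f g : Fin M → Fin M → ℝ → ℂ}
    (h : ∀ i j, ∀ᵐ z ∂(zMeas S), f i j z = g i j z) : wInt S lam f = wInt S lam g := by
  refine Finset.sum_congr rfl fun i _ => Finset.sum_congr rfl fun j _ => ?_
  rw [← integral_Ioo_eq, ← integral_Ioo_eq]
  refine congrArg (S.h ^ 2 * ·) (integral_congr_ae ?_)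
  filter_upwards [ae_zMeas_iff.1 (h i j)] with z hz
  rw [hz]

/-- The second derivative at the interior grid points. -/
def dzzY (S : Slab) (M : ℕ) : Amb S M 2 →L[ℝ] YSp S M :=
  toY fun a => coordL S M 2 ((mid a.1, mid a.2), 2)

/-- The values at translated grid points. -/
def shiftY (S : Slab) (f : Fin M × Fin M → Grid M) (r : Fin 3) : Amb S M 2 →L[ℝ] YSp S M :=
  toY fun a => coordL S M 2 (f a, r)

theorem dzzY_eq_shiftY : dzzY S M = shiftY S (fun a => (mid a.1, mid a.2)) 2 := rfl

/-- The finite difference Laplacian. -/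
def lapY (S : Slab) (M : ℕ) : Amb S M 2 →L[ℝ] YSp S M :=
  dzzY S M + (S.h ^ 2)⁻¹ • (shiftY S (fun a => (lo a.1, mid a.2)) 0
      - (2 : ℝ) • shiftY S (fun a => (mid a.1, mid a.2)) 0
      + shiftY S (fun a => (hi a.1, mid a.2)) 0)
    + (S.h ^ 2)⁻¹ • (shiftY S (fun a => (mid a.1, lo a.2)) 0
      - (2 : ℝ) • shiftY S (fun a => (mid a.1, mid a.2)) 0
      + shiftY S (fun a => (mid a.1, hi a.2)) 0)

theorem lapY_ae (U : Amb S M 2) (i j : Fin M) :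
    ∀ᵐ z ∂(zMeas S), lapY S M U (i, j) z = lapH S.h (prof U) i j z := by
  have key : ∀ (c : ℝ) (f a₁ a₂ a₃ b₁ b₂ b₃ : Lp ℂ 2 (zMeas S)), ∀ᵐ z ∂(zMeas S),
      (f + c • (a₁ - (2 : ℝ) • a₂ + a₃) + c • (b₁ - (2 : ℝ) • b₂ + b₃) : Lp ℂ 2 (zMeas S)) z =
      f z + c * (a₁ z - 2 * a₂ z + a₃ z) + c * (b₁ z - 2 * b₂ z + b₃ z) := by
    intro c f a₁ a₂ a₃ b₁ b₂ b₃
    have hs : ∀ a₁ a₂ a₃ : Lp ℂ 2 (zMeas S), ∀ᵐ z ∂(zMeas S),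
        (c • (a₁ - (2 : ℝ) • a₂ + a₃) : Lp ℂ 2 (zMeas S)) z =
          c * (a₁ z - 2 * a₂ z + a₃ z) := by
      intro a₁ a₂ a₃
      filter_upwards [Lp.coeFn_smul c (a₁ - (2 : ℝ) • a₂ + a₃),
        Lp.coeFn_add (a₁ - (2 : ℝ) • a₂) a₃, Lp.coeFn_sub a₁ ((2 : ℝ) • a₂),
        Lp.coeFn_smul (2 : ℝ) a₂] with z h1 h2 h3 h4
      rw [h1, Pi.smul_apply, h2, Pi.add_apply, h3, Pi.sub_apply, h4, Pi.smul_apply,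
        Complex.real_smul, Complex.real_smul, Complex.ofReal_ofNat]
    filter_upwards [hs a₁ a₂ a₃, hs b₁ b₂ b₃,
      Lp.coeFn_add (f + c • (a₁ - (2 : ℝ) • a₂ + a₃)) (c • (b₁ - (2 : ℝ) • b₂ + b₃)),
      Lp.coeFn_add f (c • (a₁ - (2 : ℝ) • a₂ + a₃))] with z h1 h2 h3 h4
    rw [h3, Pi.add_apply, h4, Pi.add_apply, h1, h2]
  filter_upwards [key (S.h ^ 2)⁻¹ (U ((mid i, mid j), 2)) (U ((lo i, mid j), 0))
    (U ((mid i, mid j), 0)) (U ((hi i, mid j), 0)) (U ((mid i, lo j), 0))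
    (U ((mid i, mid j), 0)) (U ((mid i, hi j), 0))] with z hz
  refine hz.trans ?_
  simp only [lapH, prof]
  push_cast
  ring

theorem mid_injective : Function.Injective (mid : Fin M → Fin (M + 2)) :=
  (Fin.succ_injective _).comp (Fin.castSucc_injective _)

theorem lo_injective : Function.Injective (lo : Fin M → Fin (M + 2)) :=
  (Fin.castSucc_injective _).comp (Fin.castSucc_injective _)

theorem hi_injective : Function.Injective (hi : Fin M → Fin (M + 2)) :=
  (Fin.succ_injective _).comp (Fin.succ_injective _)

theorem prodMk_injective {f g : Fin M → Fin (M + 2)} (hf : Function.Injective f)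
    (hg : Function.Injective g) :
    Function.Injective (fun a : Fin M × Fin M => ((f a.1, g a.2) : Grid M)) :=
  hf.prodMap hg

/-- An injective translation reaches each grid point at most once, and the lateral points contribute
nothing. The factor is therefore 1, whatever the number of grid points. -/
theorem sum_shift_le {t : Grid M → ℝ} (h0 : ∀ g, 0 ≤ t g) (hl : ∀ g, OnLateral g → t g = 0)
    {f : Fin M × Fin M → Grid M} (hf : Function.Injective f) :
    ∑ a, t (f a) ≤ ∑ a : Fin M × Fin M, t (mid a.1, mid a.2) := by
  classical
  have h1 : ∑ a, t (f a) ≤ ∑ g, t g := by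
    rw [← Finset.sum_image (f := t) (g := f) (s := Finset.univ) (fun x _ y _ h => hf h)]
    exact Finset.sum_le_sum_of_subset_of_nonneg (Finset.subset_univ _) fun g _ _ => h0 g
  refine h1.trans (le_of_eq ?_)
  have hm : Function.Injective (fun a : Fin M × Fin M => ((mid a.1, mid a.2) : Grid M)) :=
    prodMk_injective mid_injective mid_injective
  rw [← Finset.sum_image (f := t) (g := fun a : Fin M × Fin M => ((mid a.1, mid a.2) : Grid M))
    (s := Finset.univ) (fun x _ y _ h => hm h)]
  symm
  refine Finset.sum_subset (Finset.subset_univ _) fun g _ hg => hl g ?_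
  rcases lateral_or_mid g with h | ⟨i, j, rfl⟩
  · exact h
  · exact absurd (Finset.mem_image.2 ⟨(i, j), Finset.mem_univ _, rfl⟩) hg

theorem Sob0.shift_bound (s : Sob0 S M) {lam : ℝ} {r : Fin 3} {τ : ℝ} (hτ0 : 0 ≤ τ)
    (hτ : ∀ g, ‖wmul S lam ((s : Amb S M 2) (g, r))‖ ≤ τ * ‖wmul S lam ((s : Amb S M 2) (g, 2))‖)
    {f : Fin M × Fin M → Grid M} (hf : Function.Injective f) :
    ‖wmulY S M lam (shiftY S f r s)‖ ≤ τ * ‖wmulY S M lam (dzzY S M s)‖ := by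
  refine (sq_le_sq₀ (norm_nonneg _) (by positivity)).1 ?_
  rw [mul_pow, norm_sq_Y, norm_sq_Y]
  have h1 : ∑ a, ‖wmul S lam ((s : Amb S M 2) (f a, 2))‖ ^ 2 ≤
      ∑ a : Fin M × Fin M, ‖wmul S lam ((s : Amb S M 2) ((mid a.1, mid a.2), 2))‖ ^ 2 :=
    sum_shift_le (t := fun g => ‖wmul S lam ((s : Amb S M 2) (g, 2))‖ ^ 2)
      (fun _ => sq_nonneg _) (fun g hg => by simp [Sob0.lateral s hg 2]) hf
  refine le_trans ?_ (mul_le_mul_of_nonneg_left h1 (sq_nonneg τ))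
  rw [Finset.mul_sum]
  refine Finset.sum_le_sum fun a _ => ?_
  rw [← mul_pow]
  exact pow_le_pow_left₀ (norm_nonneg _) (hτ _) 2

/-- The gain in the weighted `L²` bound for a primitive. -/
def gain2 (S : Slab) (lam : ℝ) : ℝ := S.h * Real.sqrt (S.d + S.ξ) * gain S lam

theorem gain2_nonneg (lam : ℝ) : 0 ≤ gain2 S lam := by
  have := S.h_pos
  have := gain_nonneg (S := S) lam
  unfold gain2
  positivity

theorem gain2_sq {lam : ℝ} (hl : 0 < lam) : gain2 S lam ^ 2 = (S.d + S.ξ) / (2 * lam) := by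
  have := S.h_pos
  rw [gain2, mul_pow, mul_pow, gain_sq hl, Real.sq_sqrt (by linarith [S.lt])]
  field_simp

theorem Sob0.wmul_one_le {lam : ℝ} (hl : 0 < lam) (s : Sob0 S M) (g : Grid M) :
    ‖wmul S lam ((s : Amb S M 2) (g, 1))‖ ≤
      gain2 S lam * ‖wmul S lam ((s : Amb S M 2) (g, 2))‖ := by
  rw [gain2, mul_assoc]
  refine norm_le_of_zBound (mul_nonneg (gain_nonneg _) (norm_nonneg _)) ?_
  filter_upwards [(Sob0.weighted_bounds hl s g).1,
    norm_wmul_ae lam ((s : Amb S M 2) (g, 1))] with z h1 h2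
  rwa [h2]

theorem Sob0.wmul_zero_le {lam : ℝ} (hl : 0 < lam) (s : Sob0 S M) (g : Grid M) :
    ‖wmul S lam ((s : Amb S M 2) (g, 0))‖ ≤
      gain2 S lam / lam * ‖wmul S lam ((s : Amb S M 2) (g, 2))‖ := by
  have e : gain2 S lam / lam * ‖wmul S lam ((s : Amb S M 2) (g, 2))‖ =
      S.h * Real.sqrt (S.d + S.ξ) *
        (gain S lam * ‖wmul S lam ((s : Amb S M 2) (g, 2))‖ / lam) := by
    rw [gain2]; ring
  rw [e]
  refine norm_le_of_zBound
    (div_nonneg (mul_nonneg (gain_nonneg _) (norm_nonneg _)) hl.le) ?_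
  filter_upwards [(Sob0.weighted_bounds hl s g).2,
    norm_wmul_ae lam ((s : Amb S M 2) (g, 0))] with z h1 h2
  rwa [h2]

/-- The difference quotients contain only values of the function, which are small by
`Sob0.wmul_zero_le`. The coefficients 1, 2, 1 in each of the two directions add up to 8. -/
theorem Sob0.lap_sub_dzz_le {lam : ℝ} (hl : 0 < lam) (s : Sob0 S M) :
    ‖wmulY S M lam (lapY S M s) - wmulY S M lam (dzzY S M s)‖ ≤
      8 * (S.h ^ 2)⁻¹ * (gain2 S lam / lam) * ‖wmulY S M lam (dzzY S M s)‖ := by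
  have hsh := fun f (hf : Function.Injective f) =>
    Sob0.shift_bound s (lam := lam) (r := 0) (div_nonneg (gain2_nonneg _) hl.le)
      (fun g => Sob0.wmul_zero_le hl s g) (f := f) hf
  have h1 := hsh _ (prodMk_injective lo_injective mid_injective)
  have h2 := hsh _ (prodMk_injective mid_injective mid_injective)
  have h3 := hsh _ (prodMk_injective hi_injective mid_injective)
  have h4 := hsh _ (prodMk_injective mid_injective lo_injective)
  have h5 := hsh _ (prodMk_injective mid_injective hi_injective)
  have hc : 0 ≤ (S.h ^ 2)⁻¹ := by positivity
  have e : wmulY S M lam (lapY S M s) - wmulY S M lam (dzzY S M s) =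
      (S.h ^ 2)⁻¹ • (wmulY S M lam (shiftY S (fun a => (lo a.1, mid a.2)) 0 s)
        - (2 : ℝ) • wmulY S M lam (shiftY S (fun a => (mid a.1, mid a.2)) 0 s)
        + wmulY S M lam (shiftY S (fun a => (hi a.1, mid a.2)) 0 s))
      + (S.h ^ 2)⁻¹ • (wmulY S M lam (shiftY S (fun a => (mid a.1, lo a.2)) 0 s)
        - (2 : ℝ) • wmulY S M lam (shiftY S (fun a => (mid a.1, mid a.2)) 0 s)
        + wmulY S M lam (shiftY S (fun a => (mid a.1, hi a.2)) 0 s)) := by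
    simp only [lapY, add_apply, smul_apply, sub_apply, map_add, map_smul, map_sub]
    abel
  have tri : ∀ x y z : YSp S M, ∀ B : ℝ, ‖x‖ ≤ B → ‖y‖ ≤ B → ‖z‖ ≤ B →
      ‖(S.h ^ 2)⁻¹ • (x - (2 : ℝ) • y + z)‖ ≤ (S.h ^ 2)⁻¹ * (4 * B) := by
    intro x y z B hx hy hz
    rw [norm_smul, Real.norm_of_nonneg hc]
    refine mul_le_mul_of_nonneg_left ?_ hc
    refine (norm_add_le _ _).trans ((add_le_add_left (norm_sub_le _ _) _).trans ?_)
    rw [norm_smul]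
    norm_num
    linarith
  rw [e]
  refine (norm_add_le _ _).trans ((add_le_add (tri _ _ _ _ h1 h2 h3) (tri _ _ _ _ h4 h2 h5)).trans
    (le_of_eq ?_))
  ring

/-- The weight parameter in the Carleman estimate. -/
def carlemanThreshold (S : Slab) : ℝ :=
  2 + 16 * (S.h ^ 2)⁻¹ * (1 + (S.d + S.ξ))

theorem carlemanThreshold_ge : 2 ≤ carlemanThreshold S := by
  have : 0 < S.d + S.ξ := by linarith [S.lt]
  have h2 : (0 : ℝ) ≤ 16 * (S.h ^ 2)⁻¹ * (1 + (S.d + S.ξ)) := by positivity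
  unfold carlemanThreshold
  linarith

theorem Sob0.dzz_le_two_mul_lap {lam : ℝ} (hl : carlemanThreshold S ≤ lam) (s : Sob0 S M) :
    ‖wmulY S M lam (dzzY S M s)‖ ≤ 2 * ‖wmulY S M lam (lapY S M s)‖ := by
  have hℓ : 0 < S.d + S.ξ := by linarith [S.lt]
  have hl2 : 2 ≤ lam := carlemanThreshold_ge.trans hl
  have hl0 : 0 < lam := by linarith
  -- With ℓ = d + ξ, the square of `gain2` is ℓ/(2λ) ≤ ℓ ≤ (1 + ℓ)². The threshold contains 16 = 2 ·
  -- 8 so that the perturbation of the second derivative is at most one half of it.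
  have hg : gain2 S lam ≤ 1 + (S.d + S.ξ) := by
    refine (sq_le_sq₀ (gain2_nonneg _) (by positivity)).1 ?_
    rw [gain2_sq hl0]
    refine (div_le_self hℓ.le (by linarith)).trans ?_
    nlinarith
  have hc : 0 ≤ (S.h ^ 2)⁻¹ := by positivity
  have h1 : 8 * (S.h ^ 2)⁻¹ * (gain2 S lam / lam) ≤ 1 / 2 := by
    rw [← mul_div_assoc, div_le_iff₀ hl0]
    have h2 : 16 * (S.h ^ 2)⁻¹ * (1 + (S.d + S.ξ)) ≤ lam := by
      unfold carlemanThreshold at hl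
      linarith
    have h3 := mul_le_mul_of_nonneg_left hg hc
    linarith
  have h2 := (Sob0.lap_sub_dzz_le hl0 s).trans
    (mul_le_mul_of_nonneg_right h1 (norm_nonneg _))
  have h3 := norm_sub_norm_le (wmulY S M lam (dzzY S M s)) (wmulY S M lam (lapY S M s))
  rw [norm_sub_rev] at h3
  linarith

theorem norm_wmulY_shiftY_sq (lam : ℝ) (U : Amb S M 2) (r : Fin 3) :
    ‖wmulY S M lam (shiftY S (fun a => (mid a.1, mid a.2)) r U)‖ ^ 2 =
      Real.exp (2 * lam * S.d) * wInt S lam (fun i j => prof U (mid i, mid j) r) := by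
  rw [norm_wmulY_sq]
  rfl

theorem norm_wmulY_lapY_sq (lam : ℝ) (U : Amb S M 2) :
    ‖wmulY S M lam (lapY S M U)‖ ^ 2 =
      Real.exp (2 * lam * S.d) * wInt S lam (lapH S.h (prof U)) :=
  (norm_wmulY_sq lam (lapY S M U)).trans (congrArg _ (wInt_congr (lapY_ae _)))

/-- Here `n` is the weighted norm of the second derivative, and the factor 4 in `hn` is the square
of the 2 in `Sob0.dzz_le_two_mul_lap`. Each of the two lower order terms costs l/2 · n², which
together with the leading term gives (1 + l) n². -/
theorem carleman_arith {l E lam w0 w1 w2 m n : ℝ} (hl : 0 < l) (hlam : 0 < lam) (hE : 0 < E)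
    (h2 : E * w2 = n ^ 2) (h1 : E * w1 ≤ l / (2 * lam) * n ^ 2)
    (h0 : E * w0 ≤ l / (2 * lam) / lam ^ 2 * n ^ 2) (hn : n ^ 2 ≤ 4 * (E * m)) :
    1 / (4 * (1 + l)) * w2 + 1 / (4 * (1 + l)) * lam * w1 + 1 / (4 * (1 + l)) * lam ^ 3 * w0
      ≤ m := by
  refine le_of_mul_le_mul_left ?_ hE
  have c1 : lam * (E * w1) ≤ l / 2 * n ^ 2 := by
    refine (mul_le_mul_of_nonneg_left h1 hlam.le).trans (le_of_eq ?_)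
    field_simp
  have c0 : lam ^ 3 * (E * w0) ≤ l / 2 * n ^ 2 := by
    refine (mul_le_mul_of_nonneg_left h0 (by positivity)).trans (le_of_eq ?_)
    field_simp
  calc E * (1 / (4 * (1 + l)) * w2 + 1 / (4 * (1 + l)) * lam * w1
        + 1 / (4 * (1 + l)) * lam ^ 3 * w0)
      = 1 / (4 * (1 + l)) * (E * w2 + lam * (E * w1) + lam ^ 3 * (E * w0)) := by ring
    _ ≤ 1 / (4 * (1 + l)) * (n ^ 2 + l / 2 * n ^ 2 + l / 2 * n ^ 2) := by
        rw [h2]; gcongr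
    _ = n ^ 2 / 4 := by field_simp; ring
    _ ≤ _ := by linarith

theorem norm_wmulY_dzzY_sq (lam : ℝ) (U : Amb S M 2) :
    ‖wmulY S M lam (dzzY S M U)‖ ^ 2 =
      Real.exp (2 * lam * S.d) * wInt S lam (fun i j => prof U (mid i, mid j) 2) := by
  rw [dzzY_eq_shiftY, norm_wmulY_shiftY_sq]

theorem Sob0.wInt_le {lam : ℝ} (s : Sob0 S M) {r : Fin 3} {τ : ℝ} (hτ0 : 0 ≤ τ)
    (hτ : ∀ g, ‖wmul S lam ((s : Amb S M 2) (g, r))‖ ≤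
      τ * ‖wmul S lam ((s : Amb S M 2) (g, 2))‖) :
    Real.exp (2 * lam * S.d) * wInt S lam (fun i j => prof (s : Amb S M 2) (mid i, mid j) r) ≤
      τ ^ 2 * ‖wmulY S M lam (dzzY S M s)‖ ^ 2 := by
  rw [← norm_wmulY_shiftY_sq, ← mul_pow]
  exact pow_le_pow_left₀ (norm_nonneg _)
    (Sob0.shift_bound s hτ0 hτ (prodMk_injective mid_injective mid_injective)) 2

theorem carleman : Carleman S M (carlemanThreshold S) (1 / (4 * (1 + (S.d + S.ξ)))) := by
  intro lam hl s
  have hℓ : 0 < S.d + S.ξ := by linarith [S.lt]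
  have hl2 : 2 ≤ lam := carlemanThreshold_ge.trans hl
  have hl0 : 0 < lam := by linarith
  have b1 := Sob0.wInt_le s (gain2_nonneg lam) (fun g => Sob0.wmul_one_le hl0 s g)
  have b0 := Sob0.wInt_le s (div_nonneg (gain2_nonneg lam) hl0.le)
    (fun g => Sob0.wmul_zero_le hl0 s g)
  rw [gain2_sq hl0] at b1
  rw [div_pow, gain2_sq hl0] at b0
  refine carleman_arith hℓ hl0 (Real.exp_pos (2 * lam * S.d))
    (norm_wmulY_dzzY_sq lam (s : Amb S M 2)).symm b1 b0 ?_
  rw [← norm_wmulY_lapY_sq]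
  have := pow_le_pow_left₀ (norm_nonneg _) (Sob0.dzz_le_two_mul_lap hl s) 2
  rw [mul_pow] at this
  exact this.trans_eq (by norm_num)

/-- A constant in the bound of the `H²` norm by the second derivatives. -/
def ellConst (S : Slab) (M : ℕ) : ℝ :=
  (Fintype.card (Grid M × Fin 3) : ℝ) * (1 + gain2 S 1)

theorem ellConst_pos : 0 < ellConst S M := by
  have := gain2_nonneg (S := S) 1
  unfold ellConst
  have : (0 : ℝ) < Fintype.card (Grid M × Fin 3) := by exact_mod_cast Fintype.card_pos
  positivity

theorem gain_anti {lam : ℝ} (hl : 1 ≤ lam) : gain S lam ≤ gain S 1 := by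
  have := S.h_pos
  unfold gain
  gcongr

/-- The weight is at least 1 and the gains decrease in λ, so they can be replaced by their values at
λ = 1; the constant then serves for all λ ≥ 1. -/
theorem Sob0.norm_le {lam : ℝ} (hl : 1 ≤ lam) (s : Sob0 S M) :
    ‖s‖ ≤ ellConst S M * ‖wmulY S M lam (dzzY S M s)‖ := by
  have hl0 : 0 < lam := by linarith
  set n := ‖wmulY S M lam (dzzY S M s)‖
  have hgm : gain2 S lam ≤ gain2 S 1 := by
    have := S.h_pos
    unfold gain2
    have := gain_anti (S := S) hl
    gcongr
  have hg0 := gain2_nonneg (S := S) lam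
  have h2 : ∀ g : Grid M, ‖wmul S lam ((s : Amb S M 2) (g, 2))‖ ≤ n := fun g => by
    rcases lateral_or_mid g with hg | ⟨i, j, rfl⟩
    · rw [Sob0.lateral s hg 2, map_zero, norm_zero]
      exact norm_nonneg _
    · exact PiLp.norm_apply_le (wmulY S M lam (dzzY S M s)) (i, j)
  have hn0 : 0 ≤ n := norm_nonneg _
  have hb : ∀ a : Grid M × Fin 3, ‖(s : Amb S M 2) a‖ ≤ (1 + gain2 S 1) * n := by
    rintro ⟨g, r⟩
    refine (norm_le_norm_wmul hl0.le _).trans ?_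
    fin_cases r
    · refine (Sob0.wmul_zero_le hl0 s g).trans (mul_le_mul ?_ (h2 g) (norm_nonneg _) (by linarith))
      exact (div_le_self hg0 hl).trans (by linarith)
    · refine (Sob0.wmul_one_le hl0 s g).trans (mul_le_mul ?_ (h2 g) (norm_nonneg _) (by linarith))
      linarith
    · refine (h2 g).trans ?_
      nlinarith
  have hs : ‖(s : Amb S M 2)‖ ≤ ∑ a, ‖(s : Amb S M 2) a‖ := by
    refine (sq_le_sq₀ (norm_nonneg _) (Finset.sum_nonneg fun _ _ => norm_nonneg _)).1 ?_
    rw [PiLp.norm_sq_eq_of_L2]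
    exact Finset.sum_sq_le_sq_sum_of_nonneg fun _ _ => norm_nonneg _
  refine hs.trans ((Finset.sum_le_sum fun a _ => hb a).trans (le_of_eq ?_))
  rw [Finset.sum_const, ellConst, nsmul_eq_mul, Finset.card_univ, mul_assoc]

end Operators

/-! ### The product of two gradients -/

section Products

open scoped ENNReal

variable {S : Slab} {M : ℕ}

/-- The components of the finite difference gradient. -/
def gradL (S : Slab) (M : ℕ) (c : Fin 3) (a : Fin M × Fin M) :
    Amb S M 2 →L[ℝ] Lp ℂ 2 (zMeas S) :=
  ![(2 * S.h)⁻¹ • (coordL S M 2 ((hi a.1, mid a.2), 0) - coordL S M 2 ((lo a.1, mid a.2), 0)),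
    (2 * S.h)⁻¹ • (coordL S M 2 ((mid a.1, hi a.2), 0) - coordL S M 2 ((mid a.1, lo a.2), 0)),
    coordL S M 2 ((mid a.1, mid a.2), 1)] c

theorem smul_sub_ae (t : ℝ) (f g : Lp ℂ 2 (zMeas S)) :
    ∀ᵐ z ∂(zMeas S), (t • (f - g) : Lp ℂ 2 (zMeas S)) z = (t : ℂ) * (f z - g z) := by
  filter_upwards [Lp.coeFn_smul t (f - g), Lp.coeFn_sub f g] with z h1 h2
  rw [h1, Pi.smul_apply, h2, Pi.sub_apply, Complex.real_smul]

theorem gradL_ae (U : Amb S M 2) (c : Fin 3) (i j : Fin M) :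
    ∀ᵐ z ∂(zMeas S), gradL S M c (i, j) U z = gradH S.h (prof U) i j z c := by
  fin_cases c
  · filter_upwards [smul_sub_ae (2 * S.h)⁻¹ (U ((hi i, mid j), 0)) (U ((lo i, mid j), 0))]
      with z hz
    refine hz.trans ?_
    simp only [gradH, prof]
    push_cast
    simp
    ring
  · filter_upwards [smul_sub_ae (2 * S.h)⁻¹ (U ((mid i, hi j), 0)) (U ((mid i, lo j), 0))]
      with z hz
    refine hz.trans ?_
    simp only [gradH, prof]
    push_cast
    simp
    ring
  · exact ae_of_all _ fun z => rfl

/-- The weight is left general: the constant 1 gives the embedding into bounded functions, and `wt`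
gives the weighted estimates. In the difference quotients two values of size A divided by 2h give
A/h. -/
theorem norm_gradL_le {U : Amb S M 2} {w : ℝ → ℝ} {A B : ℝ} (hw : ∀ z, 0 < w z)
    (h0 : ∀ g, ∀ᵐ z ∂(zMeas S), w z * ‖U (g, 0) z‖ ≤ A)
    (h1 : ∀ g, ∀ᵐ z ∂(zMeas S), w z * ‖U (g, 1) z‖ ≤ B) (c : Fin 3) (a : Fin M × Fin M) :
    ∀ᵐ z ∂(zMeas S), w z * ‖gradL S M c a U z‖ ≤ max (S.h⁻¹ * A) B := by
  have hh := S.h_pos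
  have key : ∀ g g' : Grid M, ∀ᵐ z ∂(zMeas S),
      w z * ‖((2 * S.h)⁻¹ • (U (g, 0) - U (g', 0)) : Lp ℂ 2 (zMeas S)) z‖ ≤ S.h⁻¹ * A := by
    intro g g'
    filter_upwards [smul_sub_ae (2 * S.h)⁻¹ (U (g, 0)) (U (g', 0)), h0 g, h0 g'] with z hz h2 h3
    rw [hz, norm_mul, Complex.norm_real, Real.norm_of_nonneg (by positivity)]
    calc w z * ((2 * S.h)⁻¹ * ‖U (g, 0) z - U (g', 0) z‖)
        ≤ w z * ((2 * S.h)⁻¹ * (‖U (g, 0) z‖ + ‖U (g', 0) z‖)) := by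
          have := (hw z).le
          gcongr
          exact norm_sub_le _ _
      _ = (2 * S.h)⁻¹ * (w z * ‖U (g, 0) z‖ + w z * ‖U (g', 0) z‖) := by ring
      _ ≤ (2 * S.h)⁻¹ * (A + A) := by gcongr
      _ = S.h⁻¹ * A := by field_simp; ring
  fin_cases c
  · filter_upwards [key (hi a.1, mid a.2) (lo a.1, mid a.2)] with z hz
    exact hz.trans (le_max_left _ _)
  · filter_upwards [key (mid a.1, hi a.2) (mid a.1, lo a.2)] with z hz
    exact hz.trans (le_max_left _ _)
  · filter_upwards [h1 (mid a.1, mid a.2)] with z hz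
    exact hz.trans (le_max_right _ _)

/-- A constant in the bound of the supremum of the gradient. -/
def gradSupConst (S : Slab) : ℝ := max (S.h⁻¹ * sobConst S) (sobConst S)

theorem Sob.gradL_bound (U : Sob S M 2) (c : Fin 3) (a : Fin M × Fin M) :
    ∀ᵐ z ∂(zMeas S), ‖gradL S M c a (U : Amb S M 2) z‖ ≤ gradSupConst S * ‖U‖ := by
  have hb : ∀ (g : Grid M) (r : Fin 2), ∀ᵐ z ∂(zMeas S),
      (1 : ℝ) * ‖(U : Amb S M 2) (g, r.castSucc) z‖ ≤ sobConst S * ‖U‖ := fun g r => by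
    simp only [one_mul]
    exact norm_le_of_isWeakDeriv (U.2 g r) (norm_coord_le _ _) (norm_coord_le _ _)
  filter_upwards [norm_gradL_le (w := fun _ => 1) (fun _ => one_pos) (fun g => hb g 0)
    (fun g => hb g 1) c a] with z hz
  rw [one_mul] at hz
  refine hz.trans (le_of_eq ?_)
  rw [gradSupConst, max_mul_of_nonneg _ _ (norm_nonneg _), mul_assoc]

theorem memLp_gradL (U : Sob S M 2) (c : Fin 3) (a : Fin M × Fin M) :
    MemLp (gradL S M c a (U : Amb S M 2)) ∞ (zMeas S) :=
  memLp_top_of_bound (Lp.aestronglyMeasurable _) _ (Sob.gradL_bound U c a)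

/-- The components of the gradient, as bounded functions. -/
def gradSup (S : Slab) (M : ℕ) (c : Fin 3) (a : Fin M × Fin M) :
    Sob S M 2 →L[ℝ] Lp ℂ ∞ (zMeas S) :=
  LinearMap.mkContinuous
    { toFun := fun U => (memLp_gradL U c a).toLp
      map_add' := fun U V => by
        rw [← MemLp.toLp_add]
        refine MemLp.toLp_congr _ _ ?_
        rw [Submodule.coe_add, map_add]
        exact Lp.coeFn_add _ _
      map_smul' := fun t U => by
        rw [RingHom.id_apply, ← MemLp.toLp_const_smul]
        refine MemLp.toLp_congr _ _ ?_
        rw [Submodule.coe_smul, map_smul]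
        exact Lp.coeFn_smul _ _ }
    (measureUnivNNReal (zMeas S) ^ (∞ : ℝ≥0∞).toReal⁻¹ * gradSupConst S) fun U => by
    rw [mul_assoc]
    have h0 : 0 ≤ gradSupConst S * ‖U‖ :=
      mul_nonneg (sobConst_nonneg.trans (le_max_right _ _)) (norm_nonneg _)
    refine Lp.norm_le_of_ae_bound h0 ?_
    filter_upwards [Sob.gradL_bound U c a, (memLp_gradL U c a).coeFn_toLp] with z h1 h2
    simp only [LinearMap.coe_mk, AddHom.coe_mk]
    rwa [h2]

theorem gradSup_ae (U : Sob S M 2) (c : Fin 3) (a : Fin M × Fin M) :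
    gradSup S M c a U =ᵐ[zMeas S] gradL S M c a (U : Amb S M 2) :=
  (memLp_gradL U c a).coeFn_toLp

/-- The product of one component of the gradients. -/
def gradMul (S : Slab) (M : ℕ) (c : Fin 3) (a : Fin M × Fin M) :
    Sob S M 2 →L[ℝ] Sob S M 2 →L[ℝ] Lp ℂ 2 (zMeas S) :=
  ((ContinuousLinearMap.mul ℝ ℂ).holderL (zMeas S) ∞ 2 2).bilinearComp (gradSup S M c a)
    (gradL S M c a ∘L (Sob S M 2).subtypeL)

theorem gradMul_ae (U V : Sob S M 2) (c : Fin 3) (a : Fin M × Fin M) :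
    ∀ᵐ z ∂(zMeas S), gradMul S M c a U V z =
      gradL S M c a (U : Amb S M 2) z * gradL S M c a (V : Amb S M 2) z := by
  filter_upwards [(ContinuousLinearMap.mul ℝ ℂ).coeFn_holder (r := 2) (gradSup S M c a U)
    (gradL S M c a (V : Amb S M 2)), gradSup_ae U c a] with z h1 h2
  refine h1.trans ?_
  rw [h2]
  rfl

/-- The inclusion of one component. -/
def singleY (S : Slab) {M : ℕ} (a : Fin M × Fin M) : Lp ℂ 2 (zMeas S) →L[ℝ] YSp S M :=
  toY fun a' => if a' = a then ContinuousLinearMap.id ℝ _ else 0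

/-- The scalar product, without conjugation, of two gradients. -/
def gradDot (S : Slab) (M : ℕ) : Sob S M 2 →L[ℝ] Sob S M 2 →L[ℝ] YSp S M :=
  ∑ a, ∑ c, (ContinuousLinearMap.compL ℝ (Sob S M 2) (Lp ℂ 2 (zMeas S)) (YSp S M) (singleY S a)) ∘L
    gradMul S M c a

theorem gradDot_apply (U V : Sob S M 2) (a : Fin M × Fin M) :
    gradDot S M U V a = ∑ c, gradMul S M c a U V := by
  have h1 : gradDot S M U V = ∑ a, ∑ c, singleY S a (gradMul S M c a U V) := by
    simp [gradDot]
  have h2 : ∀ (y : Fin M × Fin M → Fin 3 → YSp S M), (∑ a', ∑ c, y a' c) a =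
      ∑ a', ∑ c, y a' c a := fun y => by
    simp
  rw [h1, h2, Finset.sum_eq_single a]
  · exact Finset.sum_congr rfl fun c _ => by simp [singleY]
  · intro a' _ ha'
    exact Finset.sum_eq_zero fun c _ => by simp [singleY, Ne.symm ha']
  · simp

/-- The product has no conjugation. By symmetry it suffices to estimate products whose first factor
satisfies the homogeneous conditions. -/
theorem gradDot_comm (U V : Sob S M 2) : gradDot S M U V = gradDot S M V U := by
  ext1 a
  rw [gradDot_apply, gradDot_apply]
  refine Finset.sum_congr rfl fun c _ => Lp.ext ?_
  filter_upwards [gradMul_ae U V c a, gradMul_ae V U c a] with z h1 h2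
  rw [h1, h2, mul_comm]

/-- The inclusion of `Sob0` in `Sob`. -/
def inclL (S : Slab) (M : ℕ) : Sob0 S M →L[ℝ] Sob S M 2 :=
  (Sob0 S M).subtypeL.codRestrict (Sob S M 2) fun U => U.2.1

theorem Sob0.gradL_bound {lam : ℝ} (hl : 1 ≤ lam) (s : Sob0 S M) (c : Fin 3)
    (a : Fin M × Fin M) : ∀ᵐ z ∂(zMeas S), wt S lam z * ‖gradL S M c a (s : Amb S M 2) z‖ ≤
      (1 + S.h⁻¹) * gain S lam * ‖wmulY S M lam (dzzY S M s)‖ := by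
  have hl0 : 0 < lam := by linarith
  have hh := S.h_pos
  have hg0 := gain_nonneg (S := S) lam
  set n := ‖wmulY S M lam (dzzY S M s)‖
  have hn : 0 ≤ n := norm_nonneg _
  have h2 : ∀ g : Grid M, ‖wmul S lam ((s : Amb S M 2) (g, 2))‖ ≤ n := fun g => by
    rcases lateral_or_mid g with hg | ⟨i, j, rfl⟩
    · rw [Sob0.lateral s hg 2, map_zero, norm_zero]
      exact norm_nonneg _
    · exact PiLp.norm_apply_le (wmulY S M lam (dzzY S M s)) (i, j)
  have hB : ∀ g : Grid M, gain S lam * ‖wmul S lam ((s : Amb S M 2) (g, 2))‖ ≤ gain S lam * n :=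
    fun g => mul_le_mul_of_nonneg_left (h2 g) hg0
  filter_upwards [norm_gradL_le (U := (s : Amb S M 2)) (w := wt S lam) (wt_pos lam)
    (A := gain S lam * n) (B := gain S lam * n)
    (fun g => by
      filter_upwards [(Sob0.weighted_bounds hl0 s g).2] with z hz
      refine hz.trans ((div_le_self (by positivity) hl).trans (hB g)))
    (fun g => by
      filter_upwards [(Sob0.weighted_bounds hl0 s g).1] with z hz
      exact hz.trans (hB g)) c a] with z hz
  refine hz.trans (max_le ?_ ?_)
  · have : 0 ≤ gain S lam * n := by positivity
    nlinarith
  · have : 0 ≤ S.h⁻¹ * (gain S lam * n) := by positivity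
    nlinarith

/-- The sum of the norms of the components of the gradient. -/
def gradConst (S : Slab) (M : ℕ) : ℝ := ∑ a, ∑ c, ‖gradL S M c a‖

theorem norm_gradL_le_gradConst (c : Fin 3) (a : Fin M × Fin M) :
    ‖gradL S M c a‖ ≤ gradConst S M := by
  refine (Finset.single_le_sum (f := fun c => ‖gradL S M c a‖) (fun _ _ => norm_nonneg _)
    (Finset.mem_univ c)).trans ?_
  exact Finset.single_le_sum (f := fun a => ∑ c, ‖gradL S M c a‖)
    (fun _ _ => Finset.sum_nonneg fun _ _ => norm_nonneg _) (Finset.mem_univ a)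

theorem gradConst_nonneg : 0 ≤ gradConst S M :=
  Finset.sum_nonneg fun _ _ => Finset.sum_nonneg fun _ _ => norm_nonneg _

theorem norm_wmulY_gradDot_le_of {lam C : ℝ} {U V : Sob S M 2}
    (h : ∀ c a, ‖wmul S lam (gradMul S M c a U V)‖ ≤ C) :
    ‖wmulY S M lam (gradDot S M U V)‖ ≤ (M * M : ℝ) * (3 * C) := by
  refine norm_Y_le_card fun a => ?_
  rw [wmulY_apply, gradDot_apply, map_sum]
  refine (norm_sum_le _ _).trans ((Finset.sum_le_sum fun c _ => h c a).trans ?_)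
  simp

/-- A constant in the weighted bounds of products of gradients. -/
def dotConst (S : Slab) (M : ℕ) : ℝ :=
  (M * M : ℝ) * (3 * ((1 + S.h⁻¹) * gradConst S M))

theorem dotConst_nonneg : 0 ≤ dotConst S M := by
  have := S.h_pos
  have := gradConst_nonneg (S := S) (M := M)
  unfold dotConst
  positivity

/-- The factor in `Sob0` takes the weight and is estimated in the supremum norm, where it is small;
the other factor enters in L² without weight. -/
theorem Sob0.norm_wmulY_gradDot_le {lam : ℝ} (hl : 1 ≤ lam) (s : Sob0 S M) (x : Sob S M 2) :
    ‖wmulY S M lam (gradDot S M (inclL S M s) x)‖ ≤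
      dotConst S M * gain S lam * ‖wmulY S M lam (dzzY S M s)‖ * ‖x‖ := by
  have hh := S.h_pos
  have hg0 := gain_nonneg (S := S) lam
  have h : ∀ c a, ‖wmul S lam (gradMul S M c a (inclL S M s) x)‖ ≤
      (1 + S.h⁻¹) * gain S lam * ‖wmulY S M lam (dzzY S M s)‖ * (gradConst S M * ‖x‖) := by
    intro c a
    refine (Lp.norm_le_mul_norm_of_ae_le_mul (g := gradL S M c a (x : Amb S M 2)) ?_).trans
      (mul_le_mul_of_nonneg_left ?_ (by positivity))
    · filter_upwards [norm_wmul_ae lam (gradMul S M c a (inclL S M s) x),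
        gradMul_ae (inclL S M s) x c a, Sob0.gradL_bound hl s c a] with z h1 h2 h3
      rw [h1, h2, norm_mul, ← mul_assoc]
      exact mul_le_mul_of_nonneg_right h3 (norm_nonneg _)
    · exact ContinuousLinearMap.le_of_opNorm_le _ (norm_gradL_le_gradConst c a) _
  refine (norm_wmulY_gradDot_le_of h).trans (le_of_eq ?_)
  unfold dotConst
  ring

/-- A constant in the weighted bounds of products of gradients of functions in `Sob0`. -/
def dotConst0 (S : Slab) (M : ℕ) : ℝ :=
  (M * M : ℝ) * (3 * ((1 + S.h⁻¹) ^ 2 * (S.h * Real.sqrt (S.d + S.ξ))))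

theorem dotConst0_nonneg : 0 ≤ dotConst0 S M := by
  have := S.h_pos
  unfold dotConst0
  positivity

/-- The weight with parameter 2λ is the square of the one with parameter λ, so each factor takes one
copy and each contributes one gain. -/
theorem Sob0.norm_wmulY_two_gradDot_le {lam : ℝ} (hl : 1 ≤ lam) (s t : Sob0 S M) :
    ‖wmulY S M (2 * lam) (gradDot S M (inclL S M s) (inclL S M t))‖ ≤
      dotConst0 S M * gain S lam ^ 2 * ‖wmulY S M lam (dzzY S M s)‖ *
        ‖wmulY S M lam (dzzY S M t)‖ := by
  have hh := S.h_pos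
  have hg0 := gain_nonneg (S := S) lam
  have h : ∀ c a, ‖wmul S (2 * lam) (gradMul S M c a (inclL S M s) (inclL S M t))‖ ≤
      S.h * Real.sqrt (S.d + S.ξ) *
        (((1 + S.h⁻¹) * gain S lam * ‖wmulY S M lam (dzzY S M s)‖) *
          ((1 + S.h⁻¹) * gain S lam * ‖wmulY S M lam (dzzY S M t)‖)) := by
    intro c a
    refine norm_le_of_zBound (by positivity) ?_
    filter_upwards [norm_wmul_ae (2 * lam) (gradMul S M c a (inclL S M s) (inclL S M t)),
      gradMul_ae (inclL S M s) (inclL S M t) c a, Sob0.gradL_bound hl s c a,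
      Sob0.gradL_bound hl t c a] with z h1 h2 h3 h4
    rw [h1, h2, norm_mul, wt_two_mul, mul_mul_mul_comm]
    exact mul_le_mul h3 h4 (mul_nonneg (wt_pos _ _).le (norm_nonneg _)) (by positivity)
  refine (norm_wmulY_gradDot_le_of h).trans (le_of_eq ?_)
  unfold dotConst0
  ring

/-- Multiplication by `2i`. -/
def twoI : ℂ →L[ℝ] ℂ := ContinuousLinearMap.mul ℝ ℂ (2 * Complex.I)

/-- The term `2i ∂f/∂z`. -/
def dzIY (S : Slab) (M : ℕ) : Amb S M 2 →L[ℝ] YSp S M :=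
  toY fun a => twoI.compLpL 2 (zMeas S) ∘L coordL S M 2 ((mid a.1, mid a.2), 1)

theorem dzIY_ae (U : Amb S M 2) (i j : Fin M) :
    ∀ᵐ z ∂(zMeas S), dzIY S M U (i, j) z = 2 * Complex.I * gradH S.h (prof U) i j z 2 := by
  filter_upwards [twoI.coeFn_compLpL (U ((mid i, mid j), 1))] with z hz
  exact hz

theorem Sob0.norm_wmulY_dzIY_le {lam : ℝ} (hl : 0 < lam) (s : Sob0 S M) :
    ‖wmulY S M lam (dzIY S M s)‖ ≤ 2 * gain2 S lam * ‖wmulY S M lam (dzzY S M s)‖ := by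
  refine le_trans ?_ (le_of_le_of_eq (mul_le_mul_of_nonneg_left (Sob0.shift_bound s
    (gain2_nonneg lam) (fun g => Sob0.wmul_one_le hl s g)
    (prodMk_injective mid_injective mid_injective)) zero_le_two) (mul_assoc _ _ _).symm)
  refine (sq_le_sq₀ (norm_nonneg _) (by positivity)).1 ?_
  rw [mul_pow, norm_sq_Y, norm_sq_Y, Finset.mul_sum]
  refine Finset.sum_le_sum fun a _ => ?_
  rw [← mul_pow]
  refine pow_le_pow_left₀ (norm_nonneg _) (Lp.norm_le_mul_norm_of_ae_le_mul ?_) 2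
  filter_upwards [
    norm_wmul_ae lam (twoI.compLpL 2 (zMeas S) ((s : Amb S M 2) ((mid a.1, mid a.2), 1))),
    norm_wmul_ae lam ((s : Amb S M 2) ((mid a.1, mid a.2), 1)),
    twoI.coeFn_compLpL ((s : Amb S M 2) ((mid a.1, mid a.2), 1))] with z h1 h2 h3
  refine le_of_le_of_eq (le_of_eq h1) ?_
  rw [h3]
  refine Eq.trans ?_ (congrArg (2 * ·) h2.symm)
  simp [twoI]
  ring

end Products

/-! ### Integro-differential operators with respect to the parameter -/

section WeightedQuadratic

variable {H K₁ K₂ Y : Type*} [NormedAddCommGroup H] [InnerProductSpace ℝ H]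
  [NormedAddCommGroup K₁] [NormedSpace ℝ K₁] [NormedAddCommGroup K₂] [NormedSpace ℝ K₂]
  [NormedAddCommGroup Y] [InnerProductSpace ℝ Y]

theorem quadMap_map (m : Y →L[ℝ] Y) (c : Y) (Λ : H →L[ℝ] Y) (β : K₁ →L[ℝ] K₂ →L[ℝ] Y)
    (T : H →L[ℝ] K₁) (P : H →L[ℝ] K₂) (v : K₁) (w : K₂) (p : H) :
    quadMap (m c) (m ∘L Λ) (ContinuousLinearMap.compL ℝ K₂ Y Y m ∘L β) T P v w p =
      m (quadMap c Λ β T P v w p) := by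
  simp [quadMap]

/-- The weighted increment differs from D r by at most ‖D r‖/2, so its square is at least ‖D r‖²/4.
The pairing with the quadratic part, after both weights are moved onto it by `hm`, costs at most ‖D
r‖²/8. The bound `N` concerns the unweighted operators and data only. -/
theorem quadMap_remainder_ge [CompleteSpace H] {m m₂ : Y →L[ℝ] Y}
    (hm : ∀ f g, ⟪m f, m g⟫_ℝ = ⟪f, m₂ g⟫_ℝ) (D : H →L[ℝ] Y)
    (c : Y) (Λ : H →L[ℝ] Y) (β : K₁ →L[ℝ] K₂ →L[ℝ] Y)
    (T : H →L[ℝ] K₁) (P : H →L[ℝ] K₂) (v : K₁) (w : K₂) {p r : H} {ε₁ ε₂ ε₃ ε₄ N : ℝ}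
    (h1 : ‖m (Λ r) - D r‖ ≤ ε₁ * ‖D r‖)
    (h2 : ∀ x, ‖m (β (T r) x)‖ ≤ ε₂ * ‖D r‖ * ‖x‖)
    (h3 : ∀ u, ‖m (β u (P r))‖ ≤ ε₃ * ‖D r‖ * ‖u‖)
    (h4 : ‖m₂ (β (T r) (P r))‖ ≤ ε₄ * ‖D r‖ ^ 2)
    (hε₂ : 0 ≤ ε₂) (hε₃ : 0 ≤ ε₃)
    (hN : 0 < N) (hc : ‖c‖ ≤ N) (hΛ : ‖Λ‖ ≤ N)
    (hβ : ∀ u x, ‖β u x‖ ≤ N * ‖u‖ * ‖x‖) (hT : ‖T‖ ≤ N) (hP : ‖P‖ ≤ N)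
    (hv : ‖v‖ ≤ N) (hw : ‖w‖ ≤ N) (hp : ‖p‖ ≤ N) (hpr : ‖p + r‖ ≤ N)
    (hs1 : ε₁ + ε₂ * (N + N ^ 2) + ε₃ * (N + N ^ 2) ≤ 1 / 2)
    (hs2 : (N + N ^ 2 + N * (N + N ^ 2) ^ 2) * ε₄ ≤ 1 / 16) :
    ‖D r‖ ^ 2 / 8 ≤
      ‖quadMap (m c) (m ∘L Λ) (ContinuousLinearMap.compL ℝ K₂ Y Y m ∘L β) T P v w (p + r)‖ ^ 2
      - ‖quadMap (m c) (m ∘L Λ) (ContinuousLinearMap.compL ℝ K₂ Y Y m ∘L β) T P v w p‖ ^ 2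
      - ⟪quadGrad (m c) (m ∘L Λ) (ContinuousLinearMap.compL ℝ K₂ Y Y m ∘L β) T P v w p, r⟫_ℝ := by
  have bp := norm_quadMap_le c Λ β T P v w hN hc hΛ hβ hT hP hv hw hp
  have bpr := norm_quadMap_le c Λ β T P v w hN hc hΛ hβ hT hP hv hw hpr
  have hD : 0 ≤ ‖D r‖ := norm_nonneg _
  rw [norm_sq_quadMap_remainder, quadMap_map, quadMap_map, ← map_sub, quadMap_add_sub, map_add,
    map_sub]
  have e1 : (ContinuousLinearMap.compL ℝ K₂ Y Y m ∘L β) (T r) (P r) = m (β (T r) (P r)) := rfl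
  rw [e1, hm]
  have b2 := (h2 (w + P (p + r))).trans (mul_le_mul_of_nonneg_left bpr.2.1 (by positivity))
  have b3 := (h3 (v - T p)).trans (mul_le_mul_of_nonneg_left bp.1 (by positivity))
  have b4 := (real_inner_le_norm (quadMap c Λ β T P v w p) (m₂ (β (T r) (P r)))).trans
    (mul_le_mul bp.2.2 h4 (norm_nonneg _) (by positivity))
  -- D r is the increment minus three errors, whose relative sizes sum to at most 1/2 by `hs1`.
  have key : ‖D r‖ / 2 ≤ ‖m (Λ r) - m (β (T r) (w + P (p + r))) + m (β (v - T p) (P r))‖ := by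
    have e2 : D r = (m (Λ r) - m (β (T r) (w + P (p + r))) + m (β (v - T p) (P r))) -
        (m (Λ r) - D r) + m (β (T r) (w + P (p + r))) - m (β (v - T p) (P r)) := by abel
    have e3 : ‖D r‖ ≤ ‖m (Λ r) - m (β (T r) (w + P (p + r))) + m (β (v - T p) (P r))‖ +
        ‖m (Λ r) - D r‖ + ‖m (β (T r) (w + P (p + r)))‖ + ‖m (β (v - T p) (P r))‖ := by
      nth_rewrite 1 [e2]
      refine (norm_sub_le _ _).trans (add_le_add_left ((norm_add_le _ _).trans
        (add_le_add_left (norm_sub_le _ _) _)) _)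
    nlinarith [mul_le_mul_of_nonneg_right hs1 hD]
  have key2 := pow_le_pow_left₀ (by positivity) key 2
  nlinarith [mul_le_mul_of_nonneg_right hs2 (sq_nonneg ‖D r‖)]

end WeightedQuadratic

section KOperators

open scoped ENNReal

variable {kmin kmax : ℝ}

theorem norm_le_mul_of_ae_le {α E F : Type*} [MeasurableSpace α] [NormedAddCommGroup E]
    [NormedAddCommGroup F] {μ : Measure α} {p : ℝ≥0∞} {f : Lp E p μ} {g : Lp F p μ} {c B : ℝ}
    (hc : 0 ≤ c) (hg : ‖g‖ ≤ B) (h : ∀ᵐ x ∂μ, ‖f x‖ ≤ c * ‖g x‖) : ‖f‖ ≤ c * B :=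
  (Lp.norm_le_mul_norm_of_ae_le_mul h).trans (mul_le_mul_of_nonneg_left hg hc)

theorem ae_norm_le_norm_top {α E : Type*} [MeasurableSpace α] [NormedAddCommGroup E]
    {μ : Measure α} (f : Lp E ∞ μ) : ∀ᵐ x ∂μ, ‖f x‖ ≤ ‖f‖ := by
  filter_upwards [ae_le_eLpNormEssSup (f := f) (μ := μ)] with x hx
  rw [Lp.norm_def, eLpNorm_exponent_top, ← toReal_enorm]
  refine ENNReal.toReal_mono ?_ hx
  rw [← eLpNorm_exponent_top]
  exact Lp.eLpNorm_ne_top f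

/-- The bilinear operator on functions of `k` given by `2k B`. -/
def holderK {Z₁ Z₂ Z₃ : Type*} [NormedAddCommGroup Z₁] [NormedSpace ℝ Z₁] [NormedAddCommGroup Z₂]
    [NormedSpace ℝ Z₂] [NormedAddCommGroup Z₃] [NormedSpace ℝ Z₃] (kmin kmax : ℝ)
    (B : Z₁ →L[ℝ] Z₂ →L[ℝ] Z₃) :
    Lp Z₁ ∞ (kMeas kmin kmax) →L[ℝ] Lp Z₂ 2 (kMeas kmin kmax) →L[ℝ] Lp Z₃ 2 (kMeas kmin kmax) :=
  (ContinuousLinearMap.compL ℝ (Lp Z₂ 2 (kMeas kmin kmax)) (Lp Z₃ 2 (kMeas kmin kmax))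
    (Lp Z₃ 2 (kMeas kmin kmax)) ((2 : ℝ) • mulLp memLp_id_kMeas)) ∘L
      B.holderL (kMeas kmin kmax) ∞ 2 2

theorem holderK_ae {Z₁ Z₂ Z₃ : Type*} [NormedAddCommGroup Z₁] [NormedSpace ℝ Z₁]
    [NormedAddCommGroup Z₂] [NormedSpace ℝ Z₂] [NormedAddCommGroup Z₃] [NormedSpace ℝ Z₃]
    (B : Z₁ →L[ℝ] Z₂ →L[ℝ] Z₃) (u : Lp Z₁ ∞ (kMeas kmin kmax)) (x : Lp Z₂ 2 (kMeas kmin kmax)) :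
    ∀ᵐ k ∂(kMeas kmin kmax), holderK kmin kmax B u x k = (2 * k) • B (u k) (x k) := by
  have e : holderK kmin kmax B u x = (2 : ℝ) • mulLp memLp_id_kMeas (B.holder 2 u x) := rfl
  filter_upwards [B.coeFn_holder (r := 2) u x, mulLp_ae memLp_id_kMeas (B.holder 2 u x),
    Lp.coeFn_smul (2 : ℝ) (mulLp memLp_id_kMeas (B.holder 2 u x))] with k h1 h2 h3
  rw [e, h3, Pi.smul_apply, h2, h1, smul_smul]

theorem two_mul_abs_le {k : ℝ} (h0 : 0 < kmin) (hk : k ∈ Ioo kmin kmax) :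
    ‖2 * k‖ ≤ 2 * kmax := by
  rw [Real.norm_of_nonneg (by linarith [hk.1])]
  linarith [hk.2]

variable {Z₀ Z Y : Type*} [NormedAddCommGroup Z₀] [InnerProductSpace ℝ Z₀] [CompleteSpace Z₀]
  [NormedAddCommGroup Z] [InnerProductSpace ℝ Z] [CompleteSpace Z]
  [NormedAddCommGroup Y] [InnerProductSpace ℝ Y] [CompleteSpace Y]

/-- The integral over `(k, kmax)`, as a bounded function of `k`. -/
def tailK (kmin kmax : ℝ) (ι : Z₀ →L[ℝ] Z) :
    Lp Z₀ 2 (kMeas kmin kmax) →L[ℝ] Lp Z ∞ (kMeas kmin kmax) :=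
  tailLp Z kmin kmax ∞ ∘L ι.compLpL 2 (kMeas kmin kmax)

/-- The operator `r ↦ k r - ∫ r dκ`. -/
def diffK (kmin kmax : ℝ) (ι : Z₀ →L[ℝ] Z) :
    Lp Z₀ 2 (kMeas kmin kmax) →L[ℝ] Lp Z 2 (kMeas kmin kmax) :=
  mulSubTail Z kmin kmax ∘L ι.compLpL 2 (kMeas kmin kmax)

/-- The linear part which does not involve the data. -/
def linK (kmin kmax : ℝ) (ι : Z₀ →L[ℝ] Z) (Λ₁ Λ₂ : Z →L[ℝ] Y) :
    Lp Z₀ 2 (kMeas kmin kmax) →L[ℝ] Lp Y 2 (kMeas kmin kmax) :=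
  (Λ₁ ∘L ι).compLpL 2 (kMeas kmin kmax) + Λ₂.compLpL 2 (kMeas kmin kmax) ∘L diffK kmin kmax ι

theorem inner_compLpL {m m₂ : Y →L[ℝ] Y} (h : ∀ f g, ⟪m f, m g⟫_ℝ = ⟪f, m₂ g⟫_ℝ)
    (f g : Lp Y 2 (kMeas kmin kmax)) :
    ⟪m.compLpL 2 (kMeas kmin kmax) f, m.compLpL 2 (kMeas kmin kmax) g⟫_ℝ =
      ⟪f, m₂.compLpL 2 (kMeas kmin kmax) g⟫_ℝ := by
  rw [L2.inner_def, L2.inner_def]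
  refine integral_congr_ae ?_
  filter_upwards [m.coeFn_compLpL f, m.coeFn_compLpL g, m₂.coeFn_compLpL g] with k h1 h2 h3
  rw [h1, h2, h3, h]

/-- The norm of the integration over `(k, kmax)`. -/
def tailConst (kmin kmax : ℝ) : ℝ := Real.sqrt ((kMeas kmin kmax).real univ)

theorem norm_tail_map_le (D : Z₀ →L[ℝ] Y) (r : Lp Z₀ 2 (kMeas kmin kmax)) {k : ℝ}
    (hk : k ∈ Icc kmin kmax) :
    ‖D (∫ κ in k..kmax, r κ)‖ ≤ tailConst kmin kmax * ‖D.compLpL 2 (kMeas kmin kmax) r‖ := by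
  rw [map_tail D r hk]
  exact norm_tail_le _ hk

theorem tailK_ae (ι : Z₀ →L[ℝ] Z) (r : Lp Z₀ 2 (kMeas kmin kmax)) :
    ∀ᵐ k ∂(kMeas kmin kmax), tailK kmin kmax ι r k = ι (∫ κ in k..kmax, r κ) := by
  filter_upwards [tailLp_ae ∞ (ι.compLpL 2 (kMeas kmin kmax) r), ae_mem_Ioo] with k h1 h2
  rw [map_tail ι r (Ioo_subset_Icc_self h2)]
  exact h1

/-- The operator k r - ∫ r dκ commutes with ι, so its values come from Z₀ and the weighted bounds
apply to them. -/
theorem diffK_ae (ι : Z₀ →L[ℝ] Z) (r : Lp Z₀ 2 (kMeas kmin kmax)) :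
    ∀ᵐ k ∂(kMeas kmin kmax), diffK kmin kmax ι r k = ι (mulSubTail Z₀ kmin kmax r k) := by
  have e : diffK kmin kmax ι r =
      ι.compLpL 2 (kMeas kmin kmax) (mulSubTail Z₀ kmin kmax r) := (mulSubTail_compLp ι r).symm
  rw [e]
  exact ι.coeFn_compLpL _

/-- The norm of the operator `f ↦ k f - ∫ f dκ` on functions with values in `Y`. -/
def diffConst (Y : Type*) [NormedAddCommGroup Y] [InnerProductSpace ℝ Y] [CompleteSpace Y]
    (kmin kmax : ℝ) : ℝ := ‖mulSubTail Y kmin kmax‖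

theorem diffConst_nonneg (Y : Type*) [NormedAddCommGroup Y] [InnerProductSpace ℝ Y]
    [CompleteSpace Y] (kmin kmax : ℝ) : 0 ≤ diffConst Y kmin kmax := by
  unfold diffConst
  positivity

theorem norm_mulSubTail_map_le (D : Z₀ →L[ℝ] Y) (r : Lp Z₀ 2 (kMeas kmin kmax)) :
    ‖D.compLpL 2 (kMeas kmin kmax) (mulSubTail Z₀ kmin kmax r)‖ ≤
      diffConst Y kmin kmax * ‖D.compLpL 2 (kMeas kmin kmax) r‖ := by
  rw [mulSubTail_compLp]
  exact ContinuousLinearMap.le_opNorm _ _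

/-- Bounds of operators with the weights `m` and `m₂ = m * m` by the leading part `D`. -/
structure WeightBounds (ι : Z₀ →L[ℝ] Z) (Λ₁ Λ₂ : Z →L[ℝ] Y) (B : Z →L[ℝ] Z →L[ℝ] Y)
    (m m₂ : Y →L[ℝ] Y) (D : Z₀ →L[ℝ] Y) (ε : ℝ) : Prop where
  nonneg : 0 ≤ ε
  inner : ∀ f g, ⟪m f, m g⟫_ℝ = ⟪f, m₂ g⟫_ℝ
  lead : ∀ s, ‖m (Λ₁ (ι s)) - D s‖ ≤ ε * ‖D s‖
  lower : ∀ s, ‖m (Λ₂ (ι s))‖ ≤ ε * ‖D s‖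
  left : ∀ s x, ‖m (B (ι s) x)‖ ≤ ε * ‖D s‖ * ‖x‖
  right : ∀ s x, ‖m (B x (ι s))‖ ≤ ε * ‖D s‖ * ‖x‖
  both : ∀ s t, ‖m₂ (B (ι s) (ι t))‖ ≤ ε * ‖D s‖ * ‖D t‖

namespace WeightBounds

variable {ι : Z₀ →L[ℝ] Z} {Λ₁ Λ₂ : Z →L[ℝ] Y} {B : Z →L[ℝ] Z →L[ℝ] Y} {m m₂ : Y →L[ℝ] Y}
  {D : Z₀ →L[ℝ] Y} {ε : ℝ}

/-- The bounds of `WeightBounds` are used at almost every fixed k. The integral term is bounded in k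
and the other factor is square integrable, so the product stays in L². -/
theorem norm_tail_le (h : WeightBounds ι Λ₁ Λ₂ B m m₂ D ε) (h0 : 0 < kmin) (h1 : kmin < kmax)
    (r : Lp Z₀ 2 (kMeas kmin kmax)) (x : Lp Z 2 (kMeas kmin kmax)) :
    ‖m.compLpL 2 (kMeas kmin kmax) (holderK kmin kmax B (tailK kmin kmax ι r) x)‖ ≤
      2 * kmax * tailConst kmin kmax * ε * ‖D.compLpL 2 (kMeas kmin kmax) r‖ * ‖x‖ := by
  refine Lp.norm_le_mul_norm_of_ae_le_mul ?_
  filter_upwards [m.coeFn_compLpL (holderK kmin kmax B (tailK kmin kmax ι r) x),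
    holderK_ae B (tailK kmin kmax ι r) x, tailK_ae ι r, ae_mem_Ioo] with k e1 e2 e3 hk
  have hT := norm_tail_map_le D r (Ioo_subset_Icc_self hk)
  have hb := h.left (∫ κ in k..kmax, r κ) (x k)
  have hε := h.nonneg
  rw [e1, e2, e3, map_smul, norm_smul]
  have hk2 := two_mul_abs_le h0 hk
  calc _ ≤ 2 * kmax * (ε * (tailConst kmin kmax * ‖D.compLpL 2 (kMeas kmin kmax) r‖) * ‖x k‖) :=
        mul_le_mul hk2 (hb.trans (by gcongr)) (norm_nonneg _) (by linarith)
    _ = _ := by ring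

theorem norm_diff_le (h : WeightBounds ι Λ₁ Λ₂ B m m₂ D ε) (h0 : 0 < kmin) (h1 : kmin < kmax)
    (r : Lp Z₀ 2 (kMeas kmin kmax)) (v : Lp Z ∞ (kMeas kmin kmax)) :
    ‖m.compLpL 2 (kMeas kmin kmax) (holderK kmin kmax B v (diffK kmin kmax ι r))‖ ≤
      2 * kmax * diffConst Y kmin kmax * ε * ‖D.compLpL 2 (kMeas kmin kmax) r‖ * ‖v‖ := by
  have hε := h.nonneg
  have hkm : 0 < kmax := h0.trans h1
  refine (norm_le_mul_of_ae_le (c := 2 * kmax * ε * ‖v‖) (by positivity)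
    (norm_mulSubTail_map_le D r) ?_).trans (le_of_eq (by ring))
  filter_upwards [m.coeFn_compLpL (holderK kmin kmax B v (diffK kmin kmax ι r)),
    holderK_ae B v (diffK kmin kmax ι r), diffK_ae ι r, ae_mem_Ioo, ae_norm_le_norm_top v,
    D.coeFn_compLpL (mulSubTail Z₀ kmin kmax r)] with k e1 e2 e3 hk hv e4
  have hb := h.right (mulSubTail Z₀ kmin kmax r k) (v k)
  rw [e1, e2, e3, map_smul, norm_smul, e4]
  have hk2 := two_mul_abs_le h0 hk
  calc _ ≤ 2 * kmax * (ε * ‖D (mulSubTail Z₀ kmin kmax r k)‖ * ‖v‖) :=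
        mul_le_mul hk2 (hb.trans (by gcongr)) (norm_nonneg _) (by linarith)
    _ = _ := by ring

theorem norm_both_le (h : WeightBounds ι Λ₁ Λ₂ B m m₂ D ε) (h0 : 0 < kmin) (h1 : kmin < kmax)
    (r : Lp Z₀ 2 (kMeas kmin kmax)) :
    ‖m₂.compLpL 2 (kMeas kmin kmax)
        (holderK kmin kmax B (tailK kmin kmax ι r) (diffK kmin kmax ι r))‖ ≤
      2 * kmax * tailConst kmin kmax * diffConst Y kmin kmax * ε *
        ‖D.compLpL 2 (kMeas kmin kmax) r‖ ^ 2 := by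
  have hε := h.nonneg
  have hkm : 0 < kmax := h0.trans h1
  have ht : 0 ≤ tailConst kmin kmax := Real.sqrt_nonneg _
  refine (norm_le_mul_of_ae_le
    (c := 2 * kmax * ε * (tailConst kmin kmax * ‖D.compLpL 2 (kMeas kmin kmax) r‖))
    (by positivity) (norm_mulSubTail_map_le D r) ?_).trans (le_of_eq (by ring))
  filter_upwards [m₂.coeFn_compLpL
      (holderK kmin kmax B (tailK kmin kmax ι r) (diffK kmin kmax ι r)),
    holderK_ae B (tailK kmin kmax ι r) (diffK kmin kmax ι r), tailK_ae ι r, diffK_ae ι r,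
    ae_mem_Ioo, D.coeFn_compLpL (mulSubTail Z₀ kmin kmax r)] with k e1 e2 e3 e5 hk e4
  have hT := norm_tail_map_le D r (Ioo_subset_Icc_self hk)
  have hb := h.both (∫ κ in k..kmax, r κ) (mulSubTail Z₀ kmin kmax r k)
  rw [e1, e2, e3, e5, map_smul, norm_smul, e4]
  have hk2 := two_mul_abs_le h0 hk
  calc _ ≤ 2 * kmax * (ε * (tailConst kmin kmax * ‖D.compLpL 2 (kMeas kmin kmax) r‖) *
        ‖D (mulSubTail Z₀ kmin kmax r k)‖) :=
        mul_le_mul hk2 (hb.trans (by gcongr)) (norm_nonneg _) (by linarith)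
    _ = _ := by ring

theorem norm_lin_sub_le (h : WeightBounds ι Λ₁ Λ₂ B m m₂ D ε) (r : Lp Z₀ 2 (kMeas kmin kmax)) :
    ‖m.compLpL 2 (kMeas kmin kmax) (linK kmin kmax ι Λ₁ Λ₂ r) -
        D.compLpL 2 (kMeas kmin kmax) r‖ ≤
      (1 + diffConst Y kmin kmax) * ε * ‖D.compLpL 2 (kMeas kmin kmax) r‖ := by
  have h1 : ‖m.compLpL 2 (kMeas kmin kmax) ((Λ₁ ∘L ι).compLpL 2 (kMeas kmin kmax) r) -
      D.compLpL 2 (kMeas kmin kmax) r‖ ≤ ε * ‖D.compLpL 2 (kMeas kmin kmax) r‖ := by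
    refine Lp.norm_le_mul_norm_of_ae_le_mul ?_
    filter_upwards [m.coeFn_compLpL ((Λ₁ ∘L ι).compLpL 2 (kMeas kmin kmax) r),
      (Λ₁ ∘L ι).coeFn_compLpL r, D.coeFn_compLpL r,
      Lp.coeFn_sub (m.compLpL 2 (kMeas kmin kmax) ((Λ₁ ∘L ι).compLpL 2 (kMeas kmin kmax) r))
        (D.compLpL 2 (kMeas kmin kmax) r)] with k e1 e2 e3 e4
    rw [e4, Pi.sub_apply, e1, e2, e3]
    exact h.lead (r k)
  have h2 : ‖m.compLpL 2 (kMeas kmin kmax) (Λ₂.compLpL 2 (kMeas kmin kmax)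
      (diffK kmin kmax ι r))‖ ≤
      ε * (diffConst Y kmin kmax * ‖D.compLpL 2 (kMeas kmin kmax) r‖) := by
    refine norm_le_mul_of_ae_le h.nonneg (norm_mulSubTail_map_le D r) ?_
    filter_upwards [m.coeFn_compLpL (Λ₂.compLpL 2 (kMeas kmin kmax) (diffK kmin kmax ι r)),
      Λ₂.coeFn_compLpL (diffK kmin kmax ι r), diffK_ae ι r,
      D.coeFn_compLpL (mulSubTail Z₀ kmin kmax r)] with k e1 e2 e3 e4
    rw [e1, e2, e3, e4]
    exact h.lower _
  have e : m.compLpL 2 (kMeas kmin kmax) (linK kmin kmax ι Λ₁ Λ₂ r) -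
      D.compLpL 2 (kMeas kmin kmax) r =
      (m.compLpL 2 (kMeas kmin kmax) ((Λ₁ ∘L ι).compLpL 2 (kMeas kmin kmax) r) -
        D.compLpL 2 (kMeas kmin kmax) r) +
      m.compLpL 2 (kMeas kmin kmax) (Λ₂.compLpL 2 (kMeas kmin kmax) (diffK kmin kmax ι r)) := by
    rw [linK, add_apply, map_add, ContinuousLinearMap.comp_apply]
    abel
  rw [e]
  exact (norm_add_le _ _).trans ((add_le_add h1 h2).trans (le_of_eq (by ring)))

end WeightBounds

/-- The operator of the integro-differential problem, as a quadratic map. -/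
def opK (kmin kmax : ℝ) (ι : Z₀ →L[ℝ] Z) (Λ₁ Λ₂ : Z →L[ℝ] Y) (B : Z →L[ℝ] Z →L[ℝ] Y)
    (c : Lp Y 2 (kMeas kmin kmax)) (v : Lp Z ∞ (kMeas kmin kmax))
    (w : Lp Z 2 (kMeas kmin kmax)) (p : Lp Z₀ 2 (kMeas kmin kmax)) : Lp Y 2 (kMeas kmin kmax) :=
  quadMap c (linK kmin kmax ι Λ₁ Λ₂) (holderK kmin kmax B) (tailK kmin kmax ι)
    (diffK kmin kmax ι) v w p

/-- The squared norm of `opK` with the weight `m`. -/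
def costK (kmin kmax : ℝ) (ι : Z₀ →L[ℝ] Z) (Λ₁ Λ₂ : Z →L[ℝ] Y) (B : Z →L[ℝ] Z →L[ℝ] Y)
    (m : Y →L[ℝ] Y) (c : Lp Y 2 (kMeas kmin kmax)) (v : Lp Z ∞ (kMeas kmin kmax))
    (w : Lp Z 2 (kMeas kmin kmax)) (p : Lp Z₀ 2 (kMeas kmin kmax)) : ℝ :=
  ‖m.compLpL 2 (kMeas kmin kmax) (opK kmin kmax ι Λ₁ Λ₂ B c v w p)‖ ^ 2

/-- The gradient of `costK`. -/
def gradK (kmin kmax : ℝ) (ι : Z₀ →L[ℝ] Z) (Λ₁ Λ₂ : Z →L[ℝ] Y) (B : Z →L[ℝ] Z →L[ℝ] Y)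
    (m : Y →L[ℝ] Y) (c : Lp Y 2 (kMeas kmin kmax)) (v : Lp Z ∞ (kMeas kmin kmax))
    (w : Lp Z 2 (kMeas kmin kmax)) (p : Lp Z₀ 2 (kMeas kmin kmax)) : Lp Z₀ 2 (kMeas kmin kmax) :=
  quadGrad (m.compLpL 2 (kMeas kmin kmax) c)
    (m.compLpL 2 (kMeas kmin kmax) ∘L linK kmin kmax ι Λ₁ Λ₂)
    (ContinuousLinearMap.compL ℝ _ _ _ (m.compLpL 2 (kMeas kmin kmax)) ∘L holderK kmin kmax B)
    (tailK kmin kmax ι) (diffK kmin kmax ι) v w p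

theorem isGradient_costK (ι : Z₀ →L[ℝ] Z) (Λ₁ Λ₂ : Z →L[ℝ] Y) (B : Z →L[ℝ] Z →L[ℝ] Y)
    (m : Y →L[ℝ] Y) (c : Lp Y 2 (kMeas kmin kmax)) (v : Lp Z ∞ (kMeas kmin kmax))
    (w : Lp Z 2 (kMeas kmin kmax)) :
    IsGradient (costK kmin kmax ι Λ₁ Λ₂ B m c v w) (gradK kmin kmax ι Λ₁ Λ₂ B m c v w) := by
  have e : costK kmin kmax ι Λ₁ Λ₂ B m c v w = fun p =>
      ‖quadMap (m.compLpL 2 (kMeas kmin kmax) c)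
        (m.compLpL 2 (kMeas kmin kmax) ∘L linK kmin kmax ι Λ₁ Λ₂)
        (ContinuousLinearMap.compL ℝ _ _ _ (m.compLpL 2 (kMeas kmin kmax)) ∘L
          holderK kmin kmax B)
        (tailK kmin kmax ι) (diffK kmin kmax ι) v w p‖ ^ 2 := by
    funext p
    rw [costK, opK, ← quadMap_map]
  rw [e]
  exact isGradient_quadGrad _ _ _ _ _ v w

/-- A bound of the operators in `opK`. -/
structure OpBound (kmin kmax : ℝ) (ι : Z₀ →L[ℝ] Z) (Λ₁ Λ₂ : Z →L[ℝ] Y)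
    (B : Z →L[ℝ] Z →L[ℝ] Y) (N : ℝ) : Prop where
  pos : 0 < N
  lin : ‖linK kmin kmax ι Λ₁ Λ₂‖ ≤ N
  holder : ∀ u x, ‖holderK kmin kmax B u x‖ ≤ N * ‖u‖ * ‖x‖
  tail : ‖tailK kmin kmax ι‖ ≤ N
  diff : ‖diffK kmin kmax ι‖ ≤ N

theorem exists_opBound (kmin kmax : ℝ) (ι : Z₀ →L[ℝ] Z) (Λ₁ Λ₂ : Z →L[ℝ] Y)
    (B : Z →L[ℝ] Z →L[ℝ] Y) (a : ℝ) : ∃ N, a ≤ N ∧ OpBound kmin kmax ι Λ₁ Λ₂ B N := by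
  have h1 := norm_nonneg (linK kmin kmax ι Λ₁ Λ₂)
  obtain ⟨C, h2, hC⟩ := exists_bilin_bound (holderK kmin kmax B)
  have h3 := norm_nonneg (tailK kmin kmax ι)
  have h4 := norm_nonneg (diffK kmin kmax ι)
  have h5 := abs_nonneg a
  have h6 := le_abs_self a
  refine ⟨1 + |a| + ‖linK kmin kmax ι Λ₁ Λ₂‖ + C + ‖tailK kmin kmax ι‖ +
    ‖diffK kmin kmax ι‖, ?_, ?_, ?_, fun u x => (hC u x).trans ?_, ?_, ?_⟩
  case refine_4 =>
    gcongr
    linarith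
  all_goals linarith

/-- The threshold ε₀ is fixed before the weights `m`, `m₂` and the leading part `D`, since it
depends only on `N` and on the interval of k. This lets λ be chosen afterwards. -/
theorem exists_convexity_threshold (h0 : 0 < kmin) (h1 : kmin < kmax) {ι : Z₀ →L[ℝ] Z}
    {Λ₁ Λ₂ : Z →L[ℝ] Y} {B : Z →L[ℝ] Z →L[ℝ] Y} {N : ℝ} (hN : OpBound kmin kmax ι Λ₁ Λ₂ B N) :
    ∃ ε₀ : ℝ, 0 < ε₀ ∧ ∀ (ε : ℝ) (m m₂ : Y →L[ℝ] Y) (D : Z₀ →L[ℝ] Y), ε ≤ ε₀ →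
      WeightBounds ι Λ₁ Λ₂ B m m₂ D ε →
      ∀ (c : Lp Y 2 (kMeas kmin kmax)) (v : Lp Z ∞ (kMeas kmin kmax))
        (w : Lp Z 2 (kMeas kmin kmax)), ‖c‖ ≤ N → ‖v‖ ≤ N → ‖w‖ ≤ N →
      ∀ p r : Lp Z₀ 2 (kMeas kmin kmax), ‖p‖ ≤ N → ‖p + r‖ ≤ N →
        ‖D.compLpL 2 (kMeas kmin kmax) r‖ ^ 2 / 8 ≤ costK kmin kmax ι Λ₁ Λ₂ B m c v w (p + r) -
          costK kmin kmax ι Λ₁ Λ₂ B m c v w p - ⟪gradK kmin kmax ι Λ₁ Λ₂ B m c v w p, r⟫_ℝ := by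
  have hN0 := hN.pos
  have ht : 0 ≤ tailConst kmin kmax := Real.sqrt_nonneg _
  have hd := diffConst_nonneg Y kmin kmax
  have hkm : 0 < kmax := h0.trans h1
  set K₁ := 1 + diffConst Y kmin kmax + 2 * kmax * tailConst kmin kmax * (N + N ^ 2) +
    2 * kmax * diffConst Y kmin kmax * (N + N ^ 2) with hK₁
  set K₂ := (N + N ^ 2 + N * (N + N ^ 2) ^ 2) *
    (2 * kmax * tailConst kmin kmax * diffConst Y kmin kmax) with hK₂
  have p1 : 0 < K₁ := by positivity
  have p2 : 0 ≤ K₂ := by positivity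
  -- `K₁` collects the relative errors of the increment and `K₂` those of the quadratic pairing. The
  -- choice gives εK₁ ≤ 1/16 and εK₂ ≤ 1/16, which covers both smallness conditions.
  refine ⟨1 / (16 * (K₁ + K₂)), by positivity, fun ε m m₂ D hε h c v w hc hv hw p r hp hpr => ?_⟩
  have hε0 := h.nonneg
  rw [le_div_iff₀ (by positivity)] at hε
  have q1 : 0 ≤ ε * K₁ := by positivity
  have q2 : 0 ≤ ε * K₂ := by positivity
  have key := quadMap_remainder_ge (inner_compLpL (kmin := kmin) (kmax := kmax) h.inner)
    (D.compLpL 2 (kMeas kmin kmax)) c (linK kmin kmax ι Λ₁ Λ₂) (holderK kmin kmax B)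
    (tailK kmin kmax ι) (diffK kmin kmax ι) v w (p := p) (r := r) (N := N)
    (h.norm_lin_sub_le r) (fun x => h.norm_tail_le h0 h1 r x) (fun u => h.norm_diff_le h0 h1 r u)
    (h.norm_both_le h0 h1 r) (by positivity) (by positivity) hN.pos hc hN.lin hN.holder
    hN.tail hN.diff hv hw hp hpr (by nlinarith) (by nlinarith)
  rw [quadMap_map, quadMap_map] at key
  exact key

/-- Only the constant, linear and bilinear parts are multiplied by the weight. Since E ≥ 1, the
number E N bounds these and the unweighted data alike. -/
theorem norm_gradK_sub_le {ι : Z₀ →L[ℝ] Z} {Λ₁ Λ₂ : Z →L[ℝ] Y} {B : Z →L[ℝ] Z →L[ℝ] Y} {N : ℝ}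
    (hN : OpBound kmin kmax ι Λ₁ Λ₂ B N) {m : Y →L[ℝ] Y} {E : ℝ} (hE : 1 ≤ E) (hm : ‖m‖ ≤ E)
    {c : Lp Y 2 (kMeas kmin kmax)} {v : Lp Z ∞ (kMeas kmin kmax)} {w : Lp Z 2 (kMeas kmin kmax)}
    (hc : ‖c‖ ≤ N) (hv : ‖v‖ ≤ N) (hw : ‖w‖ ≤ N)
    {p q : Lp Z₀ 2 (kMeas kmin kmax)} (hp : ‖p‖ ≤ N) (hq : ‖q‖ ≤ N) :
    ‖gradK kmin kmax ι Λ₁ Λ₂ B m c v w p - gradK kmin kmax ι Λ₁ Λ₂ B m c v w q‖ ≤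
      quadLip (E * N) * ‖p - q‖ := by
  have h0 := hN.pos
  have hle : N ≤ E * N := le_mul_of_one_le_left h0.le hE
  have hmK : ‖m.compLpL 2 (kMeas kmin kmax)‖ ≤ E := m.norm_compLpL_le.trans hm
  have hW : 0 < E * N := h0.trans_le hle
  refine norm_quadGrad_sub_le _ _ _ _ _ v w hW ?_ ?_ ?_ (hN.tail.trans hle) (hN.diff.trans hle)
    (hv.trans hle) (hw.trans hle) (hp.trans hle) (hq.trans hle)
  · exact (ContinuousLinearMap.le_opNorm _ _).trans
      (mul_le_mul hmK hc (norm_nonneg _) (by positivity))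
  · exact (ContinuousLinearMap.opNorm_comp_le _ _).trans
      (mul_le_mul hmK hN.lin (norm_nonneg _) (by positivity))
  · intro u x
    rw [ContinuousLinearMap.comp_apply, ContinuousLinearMap.compL_apply,
      ContinuousLinearMap.comp_apply]
    refine (ContinuousLinearMap.le_of_opNorm_le _ hmK _).trans ?_
    rw [mul_assoc, mul_assoc, ← mul_assoc N]
    exact mul_le_mul_of_nonneg_left (hN.holder u x) (by positivity)

end KOperators

/-! ### The coefficients determined by V and F -/

section KData

open scoped ENNReal

variable {kmin kmax : ℝ} {Z₀ Z Y : Type*}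
  [NormedAddCommGroup Z₀] [InnerProductSpace ℝ Z₀] [CompleteSpace Z₀]
  [NormedAddCommGroup Z] [InnerProductSpace ℝ Z] [CompleteSpace Z]
  [NormedAddCommGroup Y] [InnerProductSpace ℝ Y] [CompleteSpace Y]

/-- The factor `V - ∫ F dκ`. -/
def dataV (V : Z) (F : Lp Z 2 (kMeas kmin kmax)) : Lp Z ∞ (kMeas kmin kmax) :=
  Lp.constL ∞ (kMeas kmin kmax) ℝ V - tailLp Z kmin kmax ∞ F

/-- The factor `V + k F - ∫ F dκ`. -/
def dataW (V : Z) (F : Lp Z 2 (kMeas kmin kmax)) : Lp Z 2 (kMeas kmin kmax) :=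
  Lp.constL 2 (kMeas kmin kmax) ℝ V + mulSubTail Z kmin kmax F

/-- The term which does not depend on the unknown function. -/
def dataC (Λ₁ Λ₂ : Z →L[ℝ] Y) (V : Z) (F : Lp Z 2 (kMeas kmin kmax)) :
    Lp Y 2 (kMeas kmin kmax) :=
  Λ₁.compLpL 2 (kMeas kmin kmax) F + Λ₂.compLpL 2 (kMeas kmin kmax) (dataW V F)

theorem exists_data_bound (kmin kmax : ℝ) (Λ₁ Λ₂ : Z →L[ℝ] Y) (a b : ℝ) :
    ∃ N, ∀ (V : Z) (F : Lp Z 2 (kMeas kmin kmax)), ‖V‖ ≤ a → ‖F‖ ≤ b →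
      ‖dataC Λ₁ Λ₂ V F‖ ≤ N ∧ ‖dataV V F‖ ≤ N ∧ ‖dataW V F‖ ≤ N := by
  set nv := ‖Lp.constL ∞ (kMeas kmin kmax) ℝ (E := Z)‖ * a + ‖tailLp Z kmin kmax ∞‖ * b with hnv
  set nw := ‖Lp.constL 2 (kMeas kmin kmax) ℝ (E := Z)‖ * a + ‖mulSubTail Z kmin kmax‖ * b with hnw
  set nc := ‖Λ₁.compLpL 2 (kMeas kmin kmax)‖ * b + ‖Λ₂.compLpL 2 (kMeas kmin kmax)‖ * nw with hnc
  refine ⟨max nc (max nv nw), fun V F hV hF => ?_⟩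
  have hw : ‖dataW V F‖ ≤ nw := (norm_add_le _ _).trans (add_le_add
    (ContinuousLinearMap.le_opNorm_of_le _ hV) (ContinuousLinearMap.le_opNorm_of_le _ hF))
  have hv : ‖dataV V F‖ ≤ nv := (norm_sub_le _ _).trans (add_le_add
    (ContinuousLinearMap.le_opNorm_of_le _ hV) (ContinuousLinearMap.le_opNorm_of_le _ hF))
  have hc : ‖dataC Λ₁ Λ₂ V F‖ ≤ nc := (norm_add_le _ _).trans (add_le_add
    (ContinuousLinearMap.le_opNorm_of_le _ hF) (ContinuousLinearMap.le_opNorm_of_le _ hw))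
  exact ⟨hc.trans (le_max_left _ _), hv.trans ((le_max_left _ _).trans (le_max_right _ _)),
    hw.trans ((le_max_right _ _).trans (le_max_right _ _))⟩

/-- The unknown `p` and the data `F` enter the operator only through their sum `x`. Regrouping the
quadratic map in terms of `x` recovers the integro-differential expression. -/
theorem opK_data_ae (ι : Z₀ →L[ℝ] Z) (Λ₁ Λ₂ : Z →L[ℝ] Y) (B : Z →L[ℝ] Z →L[ℝ] Y) (V : Z)
    (F x : Lp Z 2 (kMeas kmin kmax)) (p : Lp Z₀ 2 (kMeas kmin kmax))
    (hx : x = ι.compLpL 2 (kMeas kmin kmax) p + F) :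
    ∀ᵐ k ∂(kMeas kmin kmax),
      opK kmin kmax ι Λ₁ Λ₂ B (dataC Λ₁ Λ₂ V F) (dataV V F) (dataW V F) p k =
        Λ₁ (x k) + (2 * k) • B (V - ∫ κ in k..kmax, x κ) (k • x k + V - ∫ κ in k..kmax, x κ) +
          Λ₂ (k • x k + V - ∫ κ in k..kmax, x κ) := by
  set u := dataV V x with hu
  set y := dataW V x with hy
  have eu : dataV V F - tailK kmin kmax ι p = u := by
    rw [hu, hx, dataV, dataV, tailK, ContinuousLinearMap.comp_apply, map_add]
    abel
  have ey : dataW V F + diffK kmin kmax ι p = y := by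
    rw [hy, hx, dataW, dataW, diffK, ContinuousLinearMap.comp_apply, map_add]
    abel
  have hlin : (Λ₁ ∘L ι).compLpL 2 (kMeas kmin kmax) p =
      Λ₁.compLpL 2 (kMeas kmin kmax) (ι.compLpL 2 (kMeas kmin kmax) p) := by
    refine Lp.ext ?_
    filter_upwards [(Λ₁ ∘L ι).coeFn_compLpL p, ι.coeFn_compLpL p,
      Λ₁.coeFn_compLpL (ι.compLpL 2 (kMeas kmin kmax) p)] with k h1 h2 h3
    rw [h1, h3, h2, ContinuousLinearMap.comp_apply]
  have e : opK kmin kmax ι Λ₁ Λ₂ B (dataC Λ₁ Λ₂ V F) (dataV V F) (dataW V F) p =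
      Λ₁.compLpL 2 (kMeas kmin kmax) x + holderK kmin kmax B u y +
        Λ₂.compLpL 2 (kMeas kmin kmax) y := by
    rw [opK, quadMap, eu, ey, ← ey, hx, dataC, linK, add_apply, ContinuousLinearMap.comp_apply,
      hlin, map_add (Λ₁.compLpL 2 (kMeas kmin kmax)),
      map_add (Λ₂.compLpL 2 (kMeas kmin kmax)) (dataW V F)]
    abel
  have aeu : ∀ᵐ k ∂(kMeas kmin kmax), u k = V - ∫ κ in k..kmax, x κ := by
    filter_upwards [Lp.coeFn_sub (Lp.constL ∞ (kMeas kmin kmax) ℝ V) (tailLp Z kmin kmax ∞ x),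
      Lp.coeFn_const ∞ (kMeas kmin kmax) V, tailLp_ae ∞ x] with k h1 h2 h3
    rw [hu, dataV, h1, Pi.sub_apply, h3]
    exact congrArg (· - _) h2
  have aey : ∀ᵐ k ∂(kMeas kmin kmax), y k = k • x k + V - ∫ κ in k..kmax, x κ := by
    filter_upwards [Lp.coeFn_add (Lp.constL 2 (kMeas kmin kmax) ℝ V) (mulSubTail Z kmin kmax x),
      Lp.coeFn_const 2 (kMeas kmin kmax) V, mulSubTail_ae x] with k h1 h2 h3
    rw [hy, dataW, h1, Pi.add_apply, h3]
    have h2' : (Lp.constL 2 (kMeas kmin kmax) ℝ V) k = V := h2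
    rw [h2']
    abel
  rw [e]
  filter_upwards [Lp.coeFn_add (Λ₁.compLpL 2 (kMeas kmin kmax) x + holderK kmin kmax B u y)
      (Λ₂.compLpL 2 (kMeas kmin kmax) y),
    Lp.coeFn_add (Λ₁.compLpL 2 (kMeas kmin kmax) x) (holderK kmin kmax B u y),
    Λ₁.coeFn_compLpL x, Λ₂.coeFn_compLpL y, holderK_ae B u y, aeu, aey]
    with k h1 h2 h3 h4 h5 h6 h7
  rw [h1, Pi.add_apply, h2, Pi.add_apply, h3, h4, h5, h6, h7]

theorem compLpL_add_compLpL_ae {E E₁ E₂ : Type*} [NormedAddCommGroup E] [NormedSpace ℝ E]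
    [NormedAddCommGroup E₁] [NormedSpace ℝ E₁] [NormedAddCommGroup E₂] [NormedSpace ℝ E₂]
    (L₁ : E₁ →L[ℝ] E) (L₂ : E₂ →L[ℝ] E) (f : Lp E₁ 2 (kMeas kmin kmax))
    (g : Lp E₂ 2 (kMeas kmin kmax)) : ∀ᵐ k ∂(kMeas kmin kmax),
      (L₁.compLpL 2 (kMeas kmin kmax) f + L₂.compLpL 2 (kMeas kmin kmax) g :
        Lp E 2 (kMeas kmin kmax)) k = L₁ (f k) + L₂ (g k) := by
  filter_upwards [Lp.coeFn_add (L₁.compLpL 2 (kMeas kmin kmax) f)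
    (L₂.compLpL 2 (kMeas kmin kmax) g), L₁.coeFn_compLpL f, L₂.coeFn_compLpL g] with k e1 e2 e3
  rw [e1, Pi.add_apply, e2, e3]

theorem exists_opK_data_ae {Z₁ : Type*} [NormedAddCommGroup Z₁] [NormedSpace ℝ Z₁]
    (ι : Z₀ →L[ℝ] Z) (Λ₁ Λ₂ : Z →L[ℝ] Y) (B : Z →L[ℝ] Z →L[ℝ] Y) (V : Z) (T : Z₁ →L[ℝ] Z)
    (F : Lp Z₁ 2 (kMeas kmin kmax)) (p : Lp Z₀ 2 (kMeas kmin kmax)) :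
    ∃ x : Lp Z 2 (kMeas kmin kmax), (∀ᵐ k ∂(kMeas kmin kmax), x k = ι (p k) + T (F k)) ∧
      ∀ᵐ k ∂(kMeas kmin kmax), opK kmin kmax ι Λ₁ Λ₂ B
          (dataC Λ₁ Λ₂ V (T.compLpL 2 (kMeas kmin kmax) F))
          (dataV V (T.compLpL 2 (kMeas kmin kmax) F))
          (dataW V (T.compLpL 2 (kMeas kmin kmax) F)) p k =
        Λ₁ (x k) + (2 * k) • B (V - ∫ κ in k..kmax, x κ) (k • x k + V - ∫ κ in k..kmax, x κ) +
          Λ₂ (k • x k + V - ∫ κ in k..kmax, x κ) :=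
  ⟨_, compLpL_add_compLpL_ae ι T p F, opK_data_ae ι Λ₁ Λ₂ B V _ _ p rfl⟩

theorem norm_sq_Lp {E : Type*} [NormedAddCommGroup E] [InnerProductSpace ℝ E]
    (f : Lp E 2 (kMeas kmin kmax)) : ‖f‖ ^ 2 = ∫ k, ‖f k‖ ^ 2 ∂(kMeas kmin kmax) := by
  rw [← real_inner_self_eq_norm_sq, L2.inner_def]
  simp

theorem norm_sq_compLpL_eq_sum {ι : Type*} [Fintype ι] {E E' : Type*} [NormedAddCommGroup E]
    [InnerProductSpace ℝ E] [NormedAddCommGroup E'] [InnerProductSpace ℝ E'] (m : E →L[ℝ] E)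
    (L : ι → E →L[ℝ] E') (h : ∀ y, ‖m y‖ ^ 2 = ∑ a, ‖L a y‖ ^ 2)
    (f : Lp E 2 (kMeas kmin kmax)) :
    ‖m.compLpL 2 (kMeas kmin kmax) f‖ ^ 2 =
      ∑ a, ∫ k, ‖L a (f k)‖ ^ 2 ∂(kMeas kmin kmax) := by
  rw [norm_sq_Lp, ← integral_finsetSum]
  · refine integral_congr_ae ?_
    filter_upwards [m.coeFn_compLpL f] with k hk
    rw [hk, h]
  · intro a _
    have h1 := (memLp_two_iff_integrable_sq_norm (Lp.aestronglyMeasurable _)).1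
      (Lp.memLp ((L a).compLpL 2 (kMeas kmin kmax) f))
    refine h1.congr ?_
    filter_upwards [(L a).coeFn_compLpL f] with k hk
    rw [hk]

/-- The convexity constant combines the lower bound ‖D r‖²/8 with ‖r‖ ≤ e‖D r‖. Both ε₀ and N are
chosen before the weight; the size E of the weight affects only the Lipschitz constant. -/
theorem exists_costK_convex (h0 : 0 < kmin) (h1 : kmin < kmax) (ι : Z₀ →L[ℝ] Z)
    (Λ₁ Λ₂ : Z →L[ℝ] Y) (B : Z →L[ℝ] Z →L[ℝ] Y) (R a b : ℝ) :
    ∃ ε₀ N : ℝ, 0 < ε₀ ∧ 0 < N ∧ ∀ (ε E e : ℝ) (m m₂ : Y →L[ℝ] Y) (D : Z₀ →L[ℝ] Y), ε ≤ ε₀ →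
      WeightBounds ι Λ₁ Λ₂ B m m₂ D ε → 1 ≤ E → ‖m‖ ≤ E → 0 < e → (∀ s, ‖s‖ ≤ e * ‖D s‖) →
      ∀ (V : Z) (F : Lp Z 2 (kMeas kmin kmax)), ‖V‖ ≤ a → ‖F‖ ≤ b →
        StronglyConvexOnBall
          (costK kmin kmax ι Λ₁ Λ₂ B m (dataC Λ₁ Λ₂ V F) (dataV V F) (dataW V F))
          (gradK kmin kmax ι Λ₁ Λ₂ B m (dataC Λ₁ Λ₂ V F) (dataV V F) (dataW V F)) R
          (8 * e ^ 2)⁻¹ ∧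
        ∀ p q : Lp Z₀ 2 (kMeas kmin kmax), ‖p‖ ≤ R → ‖q‖ ≤ R →
          ‖gradK kmin kmax ι Λ₁ Λ₂ B m (dataC Λ₁ Λ₂ V F) (dataV V F) (dataW V F) p -
            gradK kmin kmax ι Λ₁ Λ₂ B m (dataC Λ₁ Λ₂ V F) (dataV V F) (dataW V F) q‖ ≤
              quadLip (E * N) * ‖p - q‖ := by
  obtain ⟨N₁, hN₁⟩ := exists_data_bound kmin kmax Λ₁ Λ₂ a b
  obtain ⟨N, hN, hop⟩ := exists_opBound kmin kmax ι Λ₁ Λ₂ B (max R N₁)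
  obtain ⟨ε₀, hε₀, hconv⟩ := exists_convexity_threshold h0 h1 hop
  have hNN : N₁ ≤ N := (le_max_right _ _).trans hN
  have hR : R ≤ N := (le_max_left _ _).trans hN
  refine ⟨ε₀, N, hε₀, hop.pos, fun ε E e m m₂ D hε hW hE hm he hD V F hV hF => ?_⟩
  obtain ⟨bc, bv, bw⟩ := hN₁ V F hV hF
  refine ⟨fun p r hp hpr => ?_, fun p q hp hq => ?_⟩
  · refine le_trans ?_ (hconv ε m m₂ D hε hW _ _ _ (bc.trans hNN)
      (bv.trans hNN) (bw.trans hNN) p r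
      ((mem_closedBall_zero_iff.1 hp).trans hR) ((mem_closedBall_zero_iff.1 hpr).trans hR))
    have hr1 : ‖r‖ ≤ e * ‖D.compLpL 2 (kMeas kmin kmax) r‖ := by
      refine Lp.norm_le_mul_norm_of_ae_le_mul ?_
      filter_upwards [D.coeFn_compLpL r] with k hk
      rw [hk]
      exact hD (r k)
    have hr := pow_le_pow_left₀ (norm_nonneg r) hr1 2
    rw [inv_mul_le_iff₀ (by positivity)]
    rw [mul_pow] at hr
    linarith
  · exact norm_gradK_sub_le hop hE hm (bc.trans hNN) (bv.trans hNN) (bw.trans hNN)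
      (hp.trans hR) (hq.trans hR)

end KData

/-! ### The weights of the semidiscrete problem -/

section Weights

open scoped ENNReal

variable {S : Slab} {M : ℕ}

/-- The operator `lapY` on `Sob`. -/
def lapX (S : Slab) (M : ℕ) : Sob S M 2 →L[ℝ] YSp S M := lapY S M ∘L (Sob S M 2).subtypeL

/-- The operator `dzIY` on `Sob`. -/
def dzIX (S : Slab) (M : ℕ) : Sob S M 2 →L[ℝ] YSp S M := dzIY S M ∘L (Sob S M 2).subtypeL

/-- The weighted second derivative on `Sob0`. -/
def dzzW (S : Slab) (M : ℕ) (lam : ℝ) : Sob0 S M →L[ℝ] YSp S M :=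
  wmulY S M lam ∘L dzzY S M ∘L (Sob0 S M).subtypeL

theorem dzzW_apply (lam : ℝ) (s : Sob0 S M) :
    dzzW S M lam s = wmulY S M lam (dzzY S M (s : Amb S M 2)) := rfl

/-- The constant in the weighted bounds. -/
def weightConst (S : Slab) (M : ℕ) : ℝ :=
  8 * (S.h ^ 2)⁻¹ * (S.h * Real.sqrt (S.d + S.ξ)) + 2 * (S.h * Real.sqrt (S.d + S.ξ)) +
    dotConst S M + dotConst0 S M

theorem tendsto_gain : Tendsto (gain S) atTop (𝓝 0) :=
  tendsto_inv_atTop_zero.comp (Tendsto.const_mul_atTop S.h_pos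
    (Real.tendsto_sqrt_atTop.comp (tendsto_id.const_mul_atTop two_pos)))

/-- Every error term carries at least one factor `gain`, which tends to zero as λ grows. The bound
with two gains is reduced to one by `hg`. -/
theorem weightBounds {lam : ℝ} (hl : 1 ≤ lam) (hg : gain S lam ≤ 1) :
    WeightBounds (inclL S M) (lapX S M) (dzIX S M) (gradDot S M) (wmulY S M lam)
      (wmulY S M (2 * lam)) (dzzW S M lam) (weightConst S M * gain S lam) := by
  have hl0 : 0 < lam := by linarith
  have g0 := gain_nonneg (S := S) lam
  have d1 := dotConst_nonneg (S := S) (M := M)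
  have d0 := dotConst0_nonneg (S := S) (M := M)
  have hh := S.h_pos
  have p1 : 0 ≤ 8 * (S.h ^ 2)⁻¹ * (S.h * Real.sqrt (S.d + S.ξ)) := by positivity
  have p2 : 0 ≤ 2 * (S.h * Real.sqrt (S.d + S.ξ)) := by positivity
  have hdot : dotConst S M ≤ weightConst S M := by unfold weightConst; linarith
  refine ⟨by unfold weightConst; positivity, inner_wmulY lam, fun s => ?_, fun s => ?_,
    fun s x => ?_, fun s x => ?_, fun s t => ?_⟩
  · refine (Sob0.lap_sub_dzz_le hl0 s).trans ?_
    rw [dzzW_apply]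
    refine mul_le_mul_of_nonneg_right ?_ (norm_nonneg _)
    have : gain2 S lam / lam ≤ gain2 S lam := div_le_self (gain2_nonneg lam) hl
    calc 8 * (S.h ^ 2)⁻¹ * (gain2 S lam / lam) ≤ 8 * (S.h ^ 2)⁻¹ * gain2 S lam := by gcongr
      _ = 8 * (S.h ^ 2)⁻¹ * (S.h * Real.sqrt (S.d + S.ξ)) * gain S lam := by
        unfold gain2; ring
      _ ≤ _ := mul_le_mul_of_nonneg_right (by unfold weightConst; linarith) g0
  · refine (Sob0.norm_wmulY_dzIY_le hl0 s).trans ?_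
    rw [dzzW_apply]
    refine mul_le_mul_of_nonneg_right ?_ (norm_nonneg _)
    calc 2 * gain2 S lam = 2 * (S.h * Real.sqrt (S.d + S.ξ)) * gain S lam := by
          unfold gain2; ring
      _ ≤ _ := mul_le_mul_of_nonneg_right (by unfold weightConst; linarith) g0
  · refine (Sob0.norm_wmulY_gradDot_le hl s x).trans ?_
    rw [dzzW_apply]
    gcongr
  · rw [gradDot_comm]
    refine (Sob0.norm_wmulY_gradDot_le hl s x).trans ?_
    rw [dzzW_apply]
    gcongr
  · refine (Sob0.norm_wmulY_two_gradDot_le hl s t).trans ?_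
    rw [dzzW_apply, dzzW_apply]
    refine mul_le_mul_of_nonneg_right (mul_le_mul_of_nonneg_right ?_ (norm_nonneg _))
      (norm_nonneg _)
    calc dotConst0 S M * gain S lam ^ 2 ≤ dotConst0 S M * gain S lam := by
          refine mul_le_mul_of_nonneg_left ?_ d0
          nlinarith
      _ ≤ _ := mul_le_mul_of_nonneg_right (by unfold weightConst; linarith) g0

/-- The weighted cost functional of the semidiscrete problem. -/
def costS (S : Slab) (M : ℕ) (kmin kmax lam : ℝ) (V : Sob S M 2)
    (F : L2Sob S M 2 kmin kmax) : L2Sob0 S M kmin kmax → ℝ :=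
  costK kmin kmax (inclL S M) (lapX S M) (dzIX S M) (gradDot S M) (wmulY S M lam)
    (dataC (lapX S M) (dzIX S M) V F) (dataV V F) (dataW V F)

/-- The gradient of `costS`. -/
def gradS (S : Slab) (M : ℕ) (kmin kmax lam : ℝ) (V : Sob S M 2)
    (F : L2Sob S M 2 kmin kmax) : L2Sob0 S M kmin kmax → L2Sob0 S M kmin kmax :=
  gradK kmin kmax (inclL S M) (lapX S M) (dzIX S M) (gradDot S M) (wmulY S M lam)
    (dataC (lapX S M) (dzIX S M) V F) (dataV V F) (dataW V F)

theorem isGradient_costS (kmin kmax lam : ℝ) (V : Sob S M 2) (F : L2Sob S M 2 kmin kmax) :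
    IsGradient (costS S M kmin kmax lam V F) (gradS S M kmin kmax lam V F) :=
  isGradient_costK _ _ _ _ _ _ _ _

/-- The constant of strict convexity. -/
def convConst (S : Slab) (M : ℕ) : ℝ := (8 * ellConst S M ^ 2)⁻¹

theorem convConst_pos : 0 < convConst S M := by
  have := ellConst_pos (S := S) (M := M)
  unfold convConst
  positivity

/-- As `gain` tends to zero, all λ beyond some λ₁ meet the smallness condition. The convexity
constant is the same for all of them, while the Lipschitz constant contains e^{λ(d+ξ)}, the maximum
of the weight. -/
theorem costS_convex {kmin kmax : ℝ} (h0 : 0 < kmin) (h1 : kmin < kmax) (R a b lam0 : ℝ) :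
    ∃ lam1 : ℝ, lam0 ≤ lam1 ∧ ∃ L : ℝ → ℝ, ∀ lam : ℝ, lam1 ≤ lam → 0 < L lam ∧
      ∀ (V : Sob S M 2) (F : L2Sob S M 2 kmin kmax), ‖V‖ ≤ a → ‖F‖ ≤ b →
        StronglyConvexOnBall (costS S M kmin kmax lam V F) (gradS S M kmin kmax lam V F) R
          (convConst S M) ∧
        ∀ p q : L2Sob0 S M kmin kmax, ‖p‖ ≤ R → ‖q‖ ≤ R →
          ‖gradS S M kmin kmax lam V F p - gradS S M kmin kmax lam V F q‖ ≤ L lam * ‖p - q‖ := by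
  obtain ⟨ε₀, N, hε₀, hN, hconv⟩ := exists_costK_convex h0 h1 (inclL S M) (lapX S M) (dzIX S M)
    (gradDot S M) R a b
  have t1 : Tendsto (fun lam => weightConst S M * gain S lam) atTop (𝓝 0) := by
    simpa using (tendsto_gain (S := S)).const_mul (weightConst S M)
  obtain ⟨lam1, hlam⟩ := eventually_atTop.1 (((t1.eventually_le_const hε₀).and
    ((tendsto_gain (S := S)).eventually_le_const one_pos)).and (eventually_ge_atTop 1))
  refine ⟨max lam0 lam1, le_max_left _ _,
    fun lam => quadLip (Real.exp (lam * (S.d + S.ξ)) * N), fun lam hl => ?_⟩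
  obtain ⟨⟨hs1, hs2⟩, hl1⟩ := hlam lam ((le_max_right _ _).trans hl)
  refine ⟨quadLip_pos (mul_pos (Real.exp_pos _) hN), fun V F hV hF => ?_⟩
  exact hconv _ _ _ _ _ _ hs1 (weightBounds hl1 hs2)
    (Real.one_le_exp (mul_nonneg (by linarith) (by linarith [S.lt])))
    (ContinuousLinearMap.opNorm_le_bound _ (Real.exp_pos _).le fun y =>
      norm_wmulY_le (by linarith) y) ellConst_pos (Sob0.norm_le hl1) V F hV hF

end Weights

/-! ### The cost functional of the integro-differential equation -/

section CostJ

open scoped ENNReal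

variable {S : Slab} {M : ℕ} {kmin kmax : ℝ}

/-- The operator `trunc` on `Sob`. -/
def truncL (S : Slab) (M : ℕ) : Sob S M 3 →L[ℝ] Sob S M 2 :=
  (((PiLp.continuousLinearEquiv 2 ℝ (fun _ : Grid M × Fin 3 => Lp ℂ 2 (zMeas S))).symm :
      (Grid M × Fin 3 → Lp ℂ 2 (zMeas S)) →L[ℝ] Amb S M 2) ∘L
    ContinuousLinearMap.pi (fun a : Grid M × Fin 3 => coordL S M 3 (a.1, a.2.castSucc)) ∘L
      (Sob S M 3).subtypeL).codRestrict (Sob S M 2) fun U g r => U.2 g r.castSucc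

theorem gradL_comb_ae (k : ℝ) (V X I : Amb S M 2) (c : Fin 3) (i j : Fin M) :
    ∀ᵐ z ∂(zMeas S), gradL S M c (i, j) (k • X + V - I) z =
      k * gradH S.h (prof X) i j z c + gradH S.h (prof V) i j z c -
        gradH S.h (prof I) i j z c := by
  rw [map_sub, map_add, map_smul]
  filter_upwards [
    Lp.coeFn_sub (k • gradL S M c (i, j) X + gradL S M c (i, j) V) (gradL S M c (i, j) I),
    Lp.coeFn_add (k • gradL S M c (i, j) X) (gradL S M c (i, j) V),
    Lp.coeFn_smul k (gradL S M c (i, j) X), gradL_ae X c i j, gradL_ae V c i j, gradL_ae I c i j]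
    with z h1 h2 h3 h4 h5 h6
  rw [h1, Pi.sub_apply, h2, Pi.add_apply, h3, Pi.smul_apply, h4, h5, h6, Complex.real_smul]

theorem gradL_sub_ae (V I : Amb S M 2) (c : Fin 3) (i j : Fin M) :
    ∀ᵐ z ∂(zMeas S), gradL S M c (i, j) (V - I) z =
      gradH S.h (prof V) i j z c - gradH S.h (prof I) i j z c := by
  rw [map_sub]
  filter_upwards [Lp.coeFn_sub (gradL S M c (i, j) V) (gradL S M c (i, j) I), gradL_ae V c i j,
    gradL_ae I c i j] with z h1 h5 h6
  rw [h1, Pi.sub_apply, h5, h6]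

theorem gradDot_ae (k : ℝ) (V X I : Sob S M 2) (i j : Fin M) :
    ∀ᵐ z ∂(zMeas S), gradDot S M (V - I) (k • X + V - I) (i, j) z =
      ∑ c : Fin 3, (gradH S.h (prof (V : Amb S M 2)) i j z c -
          gradH S.h (prof (I : Amb S M 2)) i j z c) *
        (k * gradH S.h (prof (X : Amb S M 2)) i j z c +
          gradH S.h (prof (V : Amb S M 2)) i j z c -
          gradH S.h (prof (I : Amb S M 2)) i j z c) := by
  have h : ∀ c : Fin 3, ∀ᵐ z ∂(zMeas S), gradMul S M c (i, j) (V - I) (k • X + V - I) z =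
      (gradH S.h (prof (V : Amb S M 2)) i j z c - gradH S.h (prof (I : Amb S M 2)) i j z c) *
        (k * gradH S.h (prof (X : Amb S M 2)) i j z c +
          gradH S.h (prof (V : Amb S M 2)) i j z c -
          gradH S.h (prof (I : Amb S M 2)) i j z c) := by
    intro c
    filter_upwards [gradMul_ae (V - I) (k • X + V - I) c (i, j),
      gradL_sub_ae (V : Amb S M 2) (I : Amb S M 2) c i j,
      gradL_comb_ae k (V : Amb S M 2) (X : Amb S M 2) (I : Amb S M 2) c i j] with z h1 h2 h3
    rw [h1, Submodule.coe_sub, Submodule.coe_sub, Submodule.coe_add, Submodule.coe_smul, h2, h3]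
  rw [gradDot_apply, Fin.sum_univ_three]
  filter_upwards [h 0, h 1, h 2,
    Lp.coeFn_add (gradMul S M 0 (i, j) (V - I) (k • X + V - I) +
      gradMul S M 1 (i, j) (V - I) (k • X + V - I)) (gradMul S M 2 (i, j) (V - I) (k • X + V - I)),
    Lp.coeFn_add (gradMul S M 0 (i, j) (V - I) (k • X + V - I))
      (gradMul S M 1 (i, j) (V - I) (k • X + V - I))] with z h0 h1 h2 h3 h4
  rw [h3, Pi.add_apply, h4, Pi.add_apply, h0, h1, h2, Fin.sum_univ_three]

theorem dzIX_ae (k : ℝ) (V X I : Sob S M 2) (i j : Fin M) :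
    ∀ᵐ z ∂(zMeas S), dzIX S M (k • X + V - I) (i, j) z =
      2 * Complex.I * (k * gradH S.h (prof (X : Amb S M 2)) i j z 2 +
          gradH S.h (prof (V : Amb S M 2)) i j z 2 -
          gradH S.h (prof (I : Amb S M 2)) i j z 2) := by
  filter_upwards [dzIY_ae ((k • X + V - I : Sob S M 2) : Amb S M 2) i j,
    gradL_ae ((k • X + V - I : Sob S M 2) : Amb S M 2) 2 i j,
    gradL_comb_ae k (V : Amb S M 2) (X : Amb S M 2) (I : Amb S M 2) 2 i j] with z h1 h2 h3
  refine h1.trans ?_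
  rw [← h2, ← h3]
  rfl

theorem opS_ae (k : ℝ) (V X I : Sob S M 2) (i j : Fin M) :
    ∀ᵐ z ∂(zMeas S),
      (lapX S M X + (2 * k) • gradDot S M (V - I) (k • X + V - I) +
        dzIX S M (k • X + V - I)) (i, j) z =
      lapH S.h (prof (X : Amb S M 2)) i j z +
        2 * (k : ℂ) * ∑ c : Fin 3, (gradH S.h (prof (V : Amb S M 2)) i j z c -
            gradH S.h (prof (I : Amb S M 2)) i j z c) *
          (k * gradH S.h (prof (X : Amb S M 2)) i j z c +
            gradH S.h (prof (V : Amb S M 2)) i j z c -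
            gradH S.h (prof (I : Amb S M 2)) i j z c) +
        2 * Complex.I * (k * gradH S.h (prof (X : Amb S M 2)) i j z 2 +
          gradH S.h (prof (V : Amb S M 2)) i j z 2 -
          gradH S.h (prof (I : Amb S M 2)) i j z 2) := by
  have e : ∀ a b c : YSp S M, (a + b + c) (i, j) = a (i, j) + b (i, j) + c (i, j) :=
    fun _ _ _ => rfl
  have e' : ∀ (t : ℝ) (a : YSp S M), (t • a) (i, j) = t • a (i, j) := fun _ _ => rfl
  rw [e, e']
  filter_upwards [lapY_ae (X : Amb S M 2) i j, gradDot_ae k V X I i j, dzIX_ae k V X I i j,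
    Lp.coeFn_add (lapX S M X (i, j) + (2 * k) • gradDot S M (V - I) (k • X + V - I) (i, j))
      (dzIX S M (k • X + V - I) (i, j)),
    Lp.coeFn_add (lapX S M X (i, j)) ((2 * k) • gradDot S M (V - I) (k • X + V - I) (i, j)),
    Lp.coeFn_smul (2 * k) (gradDot S M (V - I) (k • X + V - I) (i, j))]
    with z h1 h2 h3 h4 h5 h6
  have h1' : lapX S M X (i, j) z = lapH S.h (prof (X : Amb S M 2)) i j z := h1
  rw [h4, Pi.add_apply, h5, Pi.add_apply, h6, Pi.smul_apply, h1', h2, h3, Complex.real_smul]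
  push_cast
  ring

/-- Taking a component is a bounded operator, so integrating each component over κ gives the
components of the integral in the Sobolev space. -/
theorem tailInt_eq {x : L2Sob S M 2 kmin kmax} {q : ℝ → Amb S M 2}
    (hq : ∀ᵐ k ∂(kMeas kmin kmax), ((x k : Sob S M 2) : Amb S M 2) = q k) {k : ℝ}
    (hk : k ∈ Icc kmin kmax) :
    tailInt kmax q k = prof ((∫ κ in k..kmax, x κ : Sob S M 2) : Amb S M 2) := by
  funext g r z
  have e : ((∫ κ in k..kmax, x κ : Sob S M 2) : Amb S M 2) (g, r) =
      ∫ κ in k..kmax, q κ (g, r) := by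
    refine (map_tail (coordL S M 2 (g, r) ∘L (Sob S M 2).subtypeL) x hk).trans
      (tail_congr ?_ hk)
    filter_upwards [(coordL S M 2 (g, r) ∘L (Sob S M 2).subtypeL).coeFn_compLpL x, hq]
      with κ h1 h2
    rw [h1, ← h2]
    rfl
  rw [tailInt, prof, e]

theorem opL_ae {V : Sob S M 2} {x : L2Sob S M 2 kmin kmax} {q : ℝ → Amb S M 2}
    (hq : ∀ᵐ k ∂(kMeas kmin kmax), ((x k : Sob S M 2) : Amb S M 2) = q k) :
    ∀ᵐ k ∂(kMeas kmin kmax), ∀ i j : Fin M, ∀ᵐ z ∂(zMeas S),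
      (lapX S M (x k) + (2 * k) • gradDot S M (V - ∫ κ in k..kmax, x κ)
          (k • x k + V - ∫ κ in k..kmax, x κ) +
        dzIX S M (k • x k + V - ∫ κ in k..kmax, x κ)) (i, j) z =
      opL kmax (V : Amb S M 2) q i j k z := by
  filter_upwards [hq, ae_mem_Ioo] with k h1 hk i j
  filter_upwards [opS_ae k V (x k) (∫ κ in k..kmax, x κ) i j] with z hz
  rw [hz, opL, tailInt_eq hq (Ioo_subset_Icc_self hk), h1]

end CostJ

section CostJ

open scoped ENNReal

variable {S : Slab} {M : ℕ} {kmin kmax : ℝ}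

/-- The weighted components. -/
def wCoordY (S : Slab) (M : ℕ) (lam : ℝ) (a : Fin M × Fin M) : YSp S M →L[ℝ] Lp ℂ 2 (zMeas S) :=
  wmul S lam ∘L PiLp.proj 2 (fun _ : Fin M × Fin M => Lp ℂ 2 (zMeas S)) a

theorem norm_sq_wmulY_eq_sum (lam : ℝ) (y : YSp S M) :
    ‖wmulY S M lam y‖ ^ 2 = ∑ a, ‖wCoordY S M lam a y‖ ^ 2 := norm_sq_Y _

theorem norm_sq_wCoordY (lam : ℝ) (a : Fin M × Fin M) (y : YSp S M) {f : ℝ → ℂ}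
    (hf : ∀ᵐ z ∂(zMeas S), y a z = f z) : ‖wCoordY S M lam a y‖ ^ 2 =
      Real.exp (2 * lam * S.d) *
        (S.h ^ 2 * ∫ z in (-S.ξ)..S.d, ‖f z‖ ^ 2 * Real.exp (-2 * lam * z)) := by
  refine (norm_wmul_sq lam (y a)).trans ?_
  rw [← integral_Ioo_eq, ← integral_Ioo_eq]
  refine congrArg (fun t => Real.exp (2 * lam * S.d) * (S.h ^ 2 * t)) (integral_congr_ae ?_)
  filter_upwards [ae_zMeas_iff.1 hf] with z hz
  rw [hz]

theorem norm_sq_wmulY_compLpL (h1 : kmin < kmax) (lam : ℝ)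
    (f : Lp (YSp S M) 2 (kMeas kmin kmax)) {g : Fin M → Fin M → ℝ → ℝ → ℂ}
    (hg : ∀ᵐ k ∂(kMeas kmin kmax), ∀ i j : Fin M, ∀ᵐ z ∂(zMeas S), f k (i, j) z = g i j k z) :
    ‖(wmulY S M lam).compLpL 2 (kMeas kmin kmax) f‖ ^ 2 =
      Real.exp (2 * lam * S.d) * ∑ i : Fin M, ∑ j : Fin M, S.h ^ 2 *
        ∫ k in kmin..kmax, ∫ z in (-S.ξ)..S.d, ‖g i j k z‖ ^ 2 * Real.exp (-2 * lam * z) := by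
  rw [norm_sq_compLpL_eq_sum (wmulY S M lam) (wCoordY S M lam) (norm_sq_wmulY_eq_sum lam) f,
    Fintype.sum_prod_type, Finset.mul_sum]
  refine Finset.sum_congr rfl fun i _ => ?_
  rw [Finset.mul_sum]
  refine Finset.sum_congr rfl fun j _ => ?_
  rw [intervalIntegral.integral_of_le h1.le, integral_Ioc_eq_integral_Ioo, ← integral_const_mul,
    ← integral_const_mul]
  refine integral_congr_ae ?_
  filter_upwards [hg] with k hk
  exact norm_sq_wCoordY lam (i, j) (f k) (hk i j)

/-- Identifies the concrete iterated integral with the abstract squared norm. The integrands agree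
only for almost all k and, for such k, almost all z, which is enough for the integrals. -/
theorem costJ_eq_costS (h1 : kmin < kmax) (lam : ℝ) (V : Sob S M 2)
    (F : L2Sob S M 3 kmin kmax) (p : L2Sob0 S M kmin kmax) :
    costJ lam (V : Amb S M 2) F p =
      costS S M kmin kmax lam V ((truncL S M).compLpL 2 (kMeas kmin kmax) F) p := by
  obtain ⟨x, hx, e⟩ := exists_opK_data_ae (inclL S M) (lapX S M) (dzIX S M) (gradDot S M) V
    (truncL S M) F p
  have hq : ∀ᵐ k ∂(kMeas kmin kmax), ((x k : Sob S M 2) : Amb S M 2) =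
      (p k : Amb S M 2) + trunc (F k : Amb S M 3) :=
    hx.mono fun k hk => congrArg (Subtype.val : Sob S M 2 → Amb S M 2) hk
  refine (norm_sq_wmulY_compLpL h1 lam _ ?_).symm
  filter_upwards [e, opL_ae (V := V) hq] with k e1 e2 i j
  rw [e1]
  exact e2 i j

end CostJ

/-! ### The tail function -/

section Tail

variable {S : Slab} {M : ℕ}

theorem costI_eq (mu : ℝ) (Q : Amb S M 2) (W : Sob0 S M) :
    costI mu Q W = ‖wmulY S M mu (lapY S M (W : Amb S M 2) + lapY S M Q)‖ ^ 2 := by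
  rw [norm_wmulY_sq, costI]
  refine congrArg _ (wInt_congr fun i j => ?_)
  filter_upwards [lapY_ae (W : Amb S M 2) i j, lapY_ae Q i j,
    Lp.coeFn_add (lapY S M (W : Amb S M 2) (i, j)) (lapY S M Q (i, j))] with z e1 e2 e3
  rw [← e1, ← e2]
  exact e3.symm

end Tail

/-- Existence and uniqueness in linear least squares problems. -/
theorem existsUnique_leastSquares {H Y : Type*} [NormedAddCommGroup H] [InnerProductSpace ℝ H]
    [CompleteSpace H] [NormedAddCommGroup Y] [InnerProductSpace ℝ Y] (A : H →L[ℝ] Y) {C : ℝ}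
    (hA : ∀ s, ‖s‖ ≤ C * ‖A s‖) (b : Y) : ∃! s, ∀ t, ‖A s + b‖ ^ 2 ≤ ‖A t + b‖ ^ 2 := by
  have hanti : AntilipschitzWith C.toNNReal A := A.antilipschitz_of_bound fun x =>
    (hA x).trans (mul_le_mul_of_nonneg_right (Real.le_coe_toNNReal C) (norm_nonneg _))
  -- A bounded operator that is bounded below on a complete space has complete range, so -b has a
  -- nearest point there.
  have hcomp : IsComplete (LinearMap.range (A : H →ₗ[ℝ] Y) : Set Y) := by
    rw [LinearMap.coe_range]
    exact hanti.isComplete_range A.uniformContinuous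
  obtain ⟨v, hv, hmin⟩ := Submodule.exists_norm_eq_iInf_of_complete_subspace _ hcomp (-b)
  obtain ⟨s, rfl⟩ := hv
  have horth := (Submodule.norm_eq_iInf_iff_real_inner_eq_zero
    (LinearMap.range (A : H →ₗ[ℝ] Y)) (LinearMap.mem_range_self _ s)).1 hmin
  -- Pythagoras: the residual at `s` is orthogonal to the range. Uniqueness follows from this
  -- identity because A is bounded below.
  have hsplit : ∀ t, ‖A t + b‖ ^ 2 = ‖A s + b‖ ^ 2 + ‖A (t - s)‖ ^ 2 := by
    intro t
    have h1 : ⟪-b - A s, A (t - s)⟫_ℝ = 0 := horth _ ⟨t - s, rfl⟩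
    have h2 : A t + b = A (t - s) - (-b - A s) := by rw [map_sub]; abel
    have h3 : A s + b = -(-b - A s) := by abel
    rw [h2, h3, norm_sub_sq_real, real_inner_comm, h1, norm_neg]
    ring
  refine ⟨s, fun t => ?_, fun t ht => ?_⟩
  · rw [hsplit t]
    linarith [sq_nonneg ‖A (t - s)‖]
  · have h1 := ht s
    rw [hsplit t] at h1
    have h2 : ‖A (t - s)‖ = 0 := by
      nlinarith [norm_nonneg (A (t - s))]
    have h3 := hA (t - s)
    rw [h2, mul_zero] at h3
    exact sub_eq_zero.1 (norm_le_zero_iff.1 h3)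

section Tail

variable {S : Slab} {M : ℕ}

/-- The weighted Laplacian on `Sob0`. -/
def lapW (S : Slab) (M : ℕ) (mu : ℝ) : Sob0 S M →L[ℝ] YSp S M :=
  wmulY S M mu ∘L lapY S M ∘L (Sob0 S M).subtypeL

theorem norm_le_lapW {mu : ℝ} (hm : carlemanThreshold S ≤ mu) (s : Sob0 S M) :
    ‖s‖ ≤ 2 * ellConst S M * ‖lapW S M mu s‖ := by
  have h1 : 1 ≤ mu := by linarith [carlemanThreshold_ge (S := S)]
  refine (Sob0.norm_le h1 s).trans ?_
  have h2 := mul_le_mul_of_nonneg_left (Sob0.dzz_le_two_mul_lap hm s)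
    (ellConst_pos (S := S) (M := M)).le
  refine h2.trans (le_of_eq ?_)
  rw [lapW, ContinuousLinearMap.comp_apply, ContinuousLinearMap.comp_apply]
  simp only [Submodule.subtypeL_apply]
  ring

theorem existsUnique_isMinI {mu : ℝ} (hm : carlemanThreshold S ≤ mu) (Q : Amb S M 2) :
    ∃! W : Sob0 S M, IsMinI mu Q W := by
  have h := existsUnique_leastSquares (lapW S M mu) (norm_le_lapW hm) (wmulY S M mu (lapY S M Q))
  refine (existsUnique_congr fun W => forall_congr' fun W' => ?_).1 h
  rw [costI_eq, costI_eq, map_add, map_add]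
  rfl

theorem HasValueAt.sub {u v : Lp ℂ 2 (zMeas S)} {x : ℝ} {a b : ℂ} (hu : HasValueAt S u x a)
    (hv : HasValueAt S v x b) : HasValueAt S (u - v : Lp ℂ 2 (zMeas S)) x (a - b) := by
  obtain ⟨f, f1, f2, f3⟩ := hu
  obtain ⟨g, g1, g2, g3⟩ := hv
  exact ⟨f - g, f1.sub g1, (Lp.coeFn_sub u v).trans (f2.sub g2), by simp [f3, g3]⟩

theorem sub_mem_Sob0 {ψ₀ ψ₁ : Fin M → Fin M → ℂ} {U V : Sob S M 2}
    (hU : BoundaryCond (U : Amb S M 2) ψ₀ ψ₁) (hV : BoundaryCond (V : Amb S M 2) ψ₀ ψ₁) :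
    (U : Amb S M 2) - V ∈ Sob0 S M := by
  refine ⟨Submodule.sub_mem _ U.2 V.2, fun i j => ⟨?_, ?_, ?_⟩, fun g hg => ?_⟩
  · simpa using (hU.1 i j).1.sub (hV.1 i j).1
  · simpa using (hU.1 i j).2.1.sub (hV.1 i j).2.1
  · simpa using (hU.1 i j).2.2.sub (hV.1 i j).2.2
  · simp [hU.2 g hg, hV.2 g hg]

theorem lapX_eq_zero {U : Sob S M 2}
    (h : ∀ i j : Fin M, ∀ᵐ z ∂(zMeas S), lapH S.h (prof (U : Amb S M 2)) i j z = 0) :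
    lapX S M U = 0 := by
  refine PiLp.ext fun a => Lp.ext ?_
  filter_upwards [h a.1 a.2, lapY_ae (U : Amb S M 2) a.1 a.2,
    Lp.coeFn_zero ℂ 2 (zMeas S)] with z h1 h2 h3
  exact (h2.trans h1).trans h3.symm

/-- The weighted residual of the competitor `W₀` is at most ‖Δ‖ e^{μ(d+ξ)} δ ≤ ‖Δ‖, and by
minimality so is that of `W`. Coercivity of the weighted Laplacian on `Sob0` then bounds W - W₀. The
resulting bound contains no μ, so V stays bounded as the noise level tends to zero. -/
theorem IsMinI.norm_le {mu δ : ℝ} (hm : carlemanThreshold S ≤ mu)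
    (hδ : Real.exp (mu * (S.d + S.ξ)) * δ ≤ 1)
    {ψ₀ ψ₁ : Fin M → Fin M → ℂ} {Q Qs Vs : Sob S M 2}
    (hQs : BoundaryCond (Qs : Amb S M 2) ψ₀ ψ₁) (hVs : BoundaryCond (Vs : Amb S M 2) ψ₀ ψ₁)
    (hlap : ∀ i j : Fin M, ∀ᵐ z ∂(zMeas S), lapH S.h (prof (Vs : Amb S M 2)) i j z = 0)
    (hQ : ‖Q - Qs‖ ≤ δ) {W : Sob0 S M} (hW : IsMinI mu (Q : Amb S M 2) W) :
    ‖inclL S M W + Q‖ ≤ 4 * ellConst S M * ‖lapX S M‖ + ‖Vs‖ + δ := by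
  have hm0 : 0 ≤ mu := by linarith [carlemanThreshold_ge (S := S)]
  -- Equal boundary data make Vs - Qs admissible. As Vs is discretely harmonic, the residual of this
  -- competitor is the Laplacian of Q - Qs, the noise alone.
  set W₀ : Sob0 S M := ⟨(Vs : Amb S M 2) - Qs, sub_mem_Sob0 hVs hQs⟩ with hW₀
  have e₀ : inclL S M W₀ = Vs - Qs := rfl
  have el : ∀ W' : Sob0 S M, lapY S M (W' : Amb S M 2) + lapY S M (Q : Amb S M 2) =
      lapX S M (inclL S M W' + Q) := fun W' => (map_add (lapX S M) (inclL S M W') Q).symm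
  have e1 : lapX S M (inclL S M W₀ + Q) = lapX S M (Q - Qs) := by
    rw [e₀, sub_add_eq_add_sub, add_sub_assoc, map_add, lapX_eq_zero hlap, zero_add]
  have b1 : ‖wmulY S M mu (lapX S M (Q - Qs))‖ ≤ ‖lapX S M‖ := by
    refine (norm_wmulY_le hm0 _).trans ?_
    calc Real.exp (mu * (S.d + S.ξ)) * ‖lapX S M (Q - Qs)‖
        ≤ Real.exp (mu * (S.d + S.ξ)) * (‖lapX S M‖ * δ) :=
          mul_le_mul_of_nonneg_left ((lapX S M).le_opNorm_of_le hQ) (Real.exp_pos _).le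
      _ = ‖lapX S M‖ * (Real.exp (mu * (S.d + S.ξ)) * δ) := by ring
      _ ≤ ‖lapX S M‖ := mul_le_of_le_one_right (lapX S M).opNorm_nonneg hδ
  have b2 : ‖wmulY S M mu (lapX S M (inclL S M W + Q))‖ ≤ ‖lapX S M‖ := by
    refine le_trans ?_ b1
    have h := hW W₀
    rw [costI_eq, costI_eq, el, el, e1] at h
    exact (sq_le_sq₀ (norm_nonneg _) (norm_nonneg _)).1 h
  have e2 : lapW S M mu (W - W₀) = wmulY S M mu (lapX S M (inclL S M W + Q)) -
      wmulY S M mu (lapX S M (Q - Qs)) := by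
    rw [← e1, ← map_sub, ← map_sub, add_sub_add_right_eq_sub, ← map_sub]
    rfl
  have b3 : ‖W - W₀‖ ≤ 4 * ellConst S M * ‖lapX S M‖ := by
    refine (norm_le_lapW hm _).trans ?_
    have h := (norm_sub_le (wmulY S M mu (lapX S M (inclL S M W + Q)))
      (wmulY S M mu (lapX S M (Q - Qs)))).trans (add_le_add b2 b1)
    rw [← e2] at h
    have := ellConst_pos (S := S) (M := M)
    nlinarith
  have e3 : inclL S M W + Q = inclL S M (W - W₀) + Vs + (Q - Qs) := by
    rw [map_sub, e₀]; abel
  rw [e3]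
  exact (norm_add₃_le).trans (add_le_add (add_le_add b3 le_rfl) hQ)

end Tail

section Parameters

variable {S : Slab}

/-- With μ the logarithm, μ(d + ξ) = -(log δ)/2. The largest value of the weight is thus δ^{-1/2},
and its product with δ is δ^{1/2}; the smallness of δ is exactly μ > λ₁. -/
theorem noiseExponent_bounds {δ lam1 : ℝ} (hl : 0 ≤ lam1) (h0 : 0 < δ)
    (h1 : δ < Real.exp (-2 * (S.d + S.ξ) * lam1)) :
    lam1 ≤ Real.log (δ ^ (-1 / (2 * (S.d + S.ξ)))) ∧
      Real.exp (Real.log (δ ^ (-1 / (2 * (S.d + S.ξ)))) * (S.d + S.ξ)) * δ ≤ 1 ∧ δ ≤ 1 := by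
  have hD : 0 < S.d + S.ξ := by linarith [S.lt]
  have h2 : Real.log δ < -2 * (S.d + S.ξ) * lam1 := (Real.log_lt_iff_lt_exp h0).2 h1
  have h3 : 0 ≤ (S.d + S.ξ) * lam1 := by positivity
  have h4 : Real.log δ ≤ 0 := by linarith
  rw [Real.log_rpow h0]
  refine ⟨?_, ?_, ?_⟩
  · rw [div_mul_eq_mul_div, le_div_iff₀ (by positivity)]
    linarith
  · have h5 : -1 / (2 * (S.d + S.ξ)) * Real.log δ * (S.d + S.ξ) = -(Real.log δ / 2) := by
      field_simp
    nth_rewrite 2 [← Real.exp_log h0]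
    rw [h5, ← Real.exp_add]
    exact Real.exp_le_one_iff.2 (by linarith)
  · exact (Real.log_nonpos_iff h0.le).1 h4

end Parameters

end SemiDisc

end

/-! ### The main theorem -/

theorem theorem7p5 (S : Slab) :
    ∃ lam0 C : ℝ, 1 < lam0 ∧ 0 < C ∧ (∀ M : ℕ, Carleman S M lam0 C) ∧
    ∀ (M : ℕ) (kmin kmax : ℝ), 0 < kmin → kmin < kmax →
    ∀ R : ℝ, 0 < R → ∀ normF normV : ℝ,
    ∃ lam1 C1 : ℝ, lam0 ≤ lam1 ∧ 0 < C1 ∧ ∀ lam : ℝ, lam1 ≤ lam →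
    ∃ γ0 ∈ Ioo (0 : ℝ) 1, ∃ θ : ℝ → ℝ, (∀ γ ∈ Ioo 0 γ0, θ γ ∈ Ioo (0 : ℝ) 1) ∧
    -- the noise level, and the data of the problem for the tail function
    ∀ δ : ℝ, 0 < δ → δ < Real.exp (-2 * (S.d + S.ξ) * lam1) →
    ∀ (ψ₀ ψ₁ ψ₀s ψ₁s : Fin M → Fin M → ℂ) (Q Qs Vs : Sob S M 2),
    BoundaryCond (Q : Amb S M 2) ψ₀ ψ₁ → BoundaryCond (Qs : Amb S M 2) ψ₀s ψ₁s → BoundaryCond (Vs : Amb S M 2) ψ₀s ψ₁s →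
    (∀ i j : Fin M, ∀ᵐ z ∂(zMeas S), lapH S.h (prof (Vs : Amb S M 2)) i j z = 0) →
    ‖Vs‖ = normV → ‖Q - Qs‖ < δ →
    -- the data of the integro-differential problem
    ∀ (φ₀ φ₁ φ₀s φ₁s : ℝ → Fin M → Fin M → ℂ) (F Fs : L2Sob S M 3 kmin kmax),
    (∀ᵐ k ∂(kMeas kmin kmax), BoundaryCond (trunc (F k : Amb S M 3)) (φ₀ k) (φ₁ k)) →
    (∀ᵐ k ∂(kMeas kmin kmax), BoundaryCond (trunc (Fs k : Amb S M 3)) (φ₀s k) (φ₁s k)) →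
    ‖Fs‖ = normF → ‖F - Fs‖ < δ →
    -- the tail function `V = W + Q`, where `W` is the minimizer of the first functional
    (∃! W : Sob0 S M, IsMinI (Real.log (δ ^ (-1 / (2 * (S.d + S.ξ))))) Q W) ∧
    ∀ W : Sob0 S M, IsMinI (Real.log (δ ^ (-1 / (2 * (S.d + S.ξ))))) Q W →
    ∀ J : L2Sob0 S M kmin kmax → ℝ, J = costJ lam (W + Q : Amb S M 2) F →
    ∃ G : L2Sob0 S M kmin kmax → L2Sob0 S M kmin kmax, IsGradient J G ∧
    -- strict convexity on the closed ball
    (∀ p r : L2Sob0 S M kmin kmax, p ∈ Metric.closedBall 0 R → p + r ∈ Metric.closedBall 0 R →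
      C1 * ‖r‖ ^ 2 ≤ J (p + r) - J p - ⟪G p, r⟫_ℝ) ∧
    -- the minimizer, its uniqueness and the variational inequality
    ∃ pmin ∈ Metric.closedBall (0 : L2Sob0 S M kmin kmax) R,
      (∀ p ∈ Metric.closedBall (0 : L2Sob0 S M kmin kmax) R,
        ((∀ y ∈ Metric.closedBall (0 : L2Sob0 S M kmin kmax) R, J p ≤ J y) ↔ p = pmin)) ∧
      (∀ p ∈ Metric.closedBall (0 : L2Sob0 S M kmin kmax) R,
        ((∀ y ∈ Metric.closedBall (0 : L2Sob0 S M kmin kmax) R, 0 ≤ ⟪G p, y - p⟫_ℝ) ↔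
          p = pmin)) ∧
      -- the gradient projection method
      ∀ γ ∈ Ioo 0 γ0, ∀ p : ℕ → L2Sob0 S M kmin kmax, p 0 ∈ Metric.ball 0 R →
        (∀ n : ℕ, IsProj (Metric.closedBall 0 R) (p n - γ • G (p n)) (p (n + 1))) →
        (∀ n : ℕ, ‖pmin - p n‖ ≤ θ γ ^ n * ‖pmin - p 0‖) ∧ Tendsto p atTop (𝓝 pmin) := by
  have hS := carlemanThreshold_ge (S := S)
  have hD : 0 < S.d + S.ξ := by linarith [S.lt]
  refine ⟨carlemanThreshold S, 1 / (4 * (1 + (S.d + S.ξ))), by linarith, by positivity,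
    fun M => carleman, fun M kmin kmax h0 h1 R hR normF normV => ?_⟩
  -- The two bounds are a priori bounds for V and F with the noise level replaced by 1. They are
  -- fixed before δ and the data, so λ₁ and the constants depend on the norms of the exact data
  -- only.
  obtain ⟨lam1, hl, L, hL⟩ := costS_convex (S := S) (M := M) h0 h1 R
    (4 * ellConst S M * ‖lapX S M‖ + normV + 1) (‖truncL S M‖ * (normF + 1))
    (carlemanThreshold S)
  refine ⟨lam1, convConst S M, hl, convConst_pos, fun lam hlam => ?_⟩
  obtain ⟨hL0, hconv⟩ := hL lam hlam
  refine ⟨stepBound (convConst S M) (L lam), stepBound_mem convConst_pos hL0,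
    fun γ => Real.sqrt (1 - γ * convConst S M),
    fun γ hγ => sqrt_one_sub_mem convConst_pos hγ, ?_⟩
  intro δ hδ0 hδ1 ψ₀ ψ₁ ψ₀s ψ₁s Q Qs Vs _ hQs hVs hVlap hVn hQQ φ₀ φ₁ φ₀s φ₁s F Fs _ _ hFn hFF
  obtain ⟨hmu, hexp, hδ⟩ := noiseExponent_bounds (S := S) (by linarith) hδ0 hδ1
  have hmu' := hl.trans hmu
  refine ⟨existsUnique_isMinI hmu' _, fun W hW J hJ => ?_⟩
  have hV : ‖inclL S M W + Q‖ ≤ 4 * ellConst S M * ‖lapX S M‖ + normV + 1 := by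
    have h := hW.norm_le hmu' hexp hQs hVs hVlap hQQ.le
    rw [hVn] at h
    linarith
  have hF : ‖(truncL S M).compLpL 2 (kMeas kmin kmax) F‖ ≤ ‖truncL S M‖ * (normF + 1) := by
    have h : ‖F‖ ≤ normF + 1 := by
      have := norm_sub_norm_le F Fs
      linarith
    exact (ContinuousLinearMap.le_of_opNorm_le _ (truncL S M).norm_compLpL_le _).trans
      (mul_le_mul_of_nonneg_left h (truncL S M).opNorm_nonneg)
  obtain ⟨hc, hlip⟩ := hconv _ _ hV hF
  have hJ' : J = costS S M kmin kmax lam (inclL S M W + Q)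
      ((truncL S M).compLpL 2 (kMeas kmin kmax) F) := by
    rw [hJ]
    funext p
    exact costJ_eq_costS h1 lam (inclL S M W + Q) F p
  subst hJ'
  exact ⟨_, isGradient_costS kmin kmax lam _ _, hc,
    hc.gradient_projection hR convConst_pos hL0 hlip⟩
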